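/- Let $N$ be odd, let $3 \le M \le N$ with $M$ odd, and put $m = (M-1)/2$. Consider a ring of $N$ processors, numbered $1, \dots, N$ clockwise, and $M$ tokens, where token $i \in \{1,\dots,M\}$ is initially at processor $z(i)$, with $1 \le z(1) < \cdots < z(M) \le N$. The tokens move independently, according to one of the following two versions of Herman's protocol. - Synchronous protocol (parameter $0 < r < 1$): in each of the time steps $1, 2, 3, \dots$ each token is passed to the clockwise neighbour of its current processor with probability $r$, and is kept with probability $1-r$, all choices being independent. - Asynchronous protocol (parameter $\lambda > 0$): each token is kept at each processor that it visits for an exponentially distributed time with parameter $\lambda$, and is then passed to the clockwise neighbour, all holding times being independent. Whenever two tokens are at the same processor, both are annihilated. Let $\mathbf{T}$ be the time until only one token is left. For $1 \le u < v \le M$ consider the system in which only the tokens $u$ and $v$ are present (the movement and the collisions of the other tokens are ignored). Let $T_{uv}$ be the time until $u$ and $v$ collide in this system, and let $d_u, d_v \ge 0$ be the distances that $u$ and $v$ have then travelled in clockwise direction. Let $A_{uv}^{\downarrow}$ (the tokens collide down) be the event that $u$ and $v$ eventually collide and $z(u) + d_u = z(v) + d_v$, and let $A_{uv}^{\uparrow}$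 (the tokens collide up) be the event that they eventually collide and $z(u) + d_u + N = z(v) + d_v$. A pairing is a set $w = \{(u_1,v_1), \dots, (u_m,v_m)\}$ with $1 \le u_i < v_i \le M$ for all $i$, such that $\{u_1, v_1, \dots, u_m, v_m, w_0\} = \{1,\dots,M\}$ for some $w_0 \in \{1, \dots, M\}$. Let $W_M$ be the set of all pairings. For $w \in W_M$ let $s(w) = 1$ if the permutation $(u_1 v_1 \cdots u_m v_m w_0)$ of $\{1,\dots,M\}$ (in one-line notation) is even, and $s(w) = -1$ otherwise; this does not depend on the order of the pairs. Then, for both protocols and for all real $t \ge 0$, \[ P(\mathbf{T} \le t) = \sum_{w \in W_M} s(w) \prod_{(u,v) \in w} \Bigl( P\bigl(T_{uv} \le t \,\cap\, A_{uv}^{\downarrow}\bigr) - P\bigl(T_{uv} \le t \,\cap\, A_{uv}^{\uparrow}\bigr) \Bigr). \] -/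

import Mathlib

open MeasureTheory ProbabilityTheory
open scoped NNReal ENNReal

namespace Herman

/-! ### The movement of the tokens

`M` tokens move clockwise on a ring of `N` processors.  `d i t ω` is the number of clockwise steps
that token `i` makes up to time `t` as long as it is not annihilated. -/

/-- The synchronous protocol: in each of the time steps `1, 2, 3, …` every token is passed to the
clockwise neighbour with probability `r` and kept with probability `1 - r`, all choices being
independent.  `B i k = true` means that token `i` is passed in time step `k + 1`; up to the (real)
time `t` the steps `1, …, ⌊t⌋` have been executed. -/
def IsSynchronousMovement {Ω : Type*} [MeasurableSpace Ω] (μ : Measure Ω) {M : ℕ} (r : ℝ)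
    (d : Fin M → ℝ≥0 → Ω → ℕ) : Prop :=
  ∃ B : Fin M → ℕ → Ω → Bool,
    (∀ i k, Measurable (B i k)) ∧
    iIndepFun (fun p : Fin M × ℕ => B p.1 p.2) μ ∧
    (∀ i k, μ.real {ω | B i k ω = true} = r) ∧
    ∀ i t ω, d i t ω = ((Finset.range ⌊t⌋₊).filter fun k => B i k ω = true).card

/-- The asynchronous protocol: every token is kept by each processor that it visits for an
exponentially distributed time with parameter `rate` and is then passed to the clockwise neighbour,
all holding times being independent.  `ξ i k` is the holding time of token `i` at the processor
which is `k` steps away from its initial position, so that the `(k + 1)`-st passing of token `i`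
takes place at time `ξ i 0 + ⋯ + ξ i k`. -/
def IsAsynchronousMovement {Ω : Type*} [MeasurableSpace Ω] (μ : Measure Ω) {M : ℕ} (rate : ℝ)
    (d : Fin M → ℝ≥0 → Ω → ℕ) : Prop :=
  ∃ ξ : Fin M → ℕ → Ω → ℝ,
    (∀ i k, Measurable (ξ i k)) ∧
    iIndepFun (fun p : Fin M × ℕ => ξ p.1 p.2) μ ∧
    (∀ i k, μ.map (ξ i k) = expMeasure rate) ∧
    ∀ i t ω, d i t ω = {k : ℕ | ∑ l ∈ Finset.range (k + 1), ξ i l ω ≤ (t : ℝ)}.ncard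

/-! ### Collisions

In this part `x i t` is the number of clockwise steps of token `i` up to time `t` in one fixed
sample run, and `z i` is the initial position of token `i`. -/

section Path

variable {M : ℕ} (N : ℕ) (z : Fin M → ℕ) (x : Fin M → ℝ≥0 → ℕ)

/-- At time `t` the tokens `i` and `j` are (if both are present) at the same processor. -/
def Meet (i j : Fin M) (t : ℝ≥0) : Prop :=
  z i + x i t ≡ z j + x j t [MOD N]

/-- The first time, from time `s` on, at which two different tokens of `A` are at the same
processor (`⊤` if there is none). -/
noncomputable def nextCollision (A : Finset (Fin M)) (s : ℝ≥0∞) : ℝ≥0∞ :=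
  ⨅ (t : ℝ≥0) (_ : s ≤ t ∧ ∃ i ∈ A, ∃ j ∈ A, i ≠ j ∧ Meet N z x i j t), (t : ℝ≥0∞)

open Classical in
/-- The tokens of `A` that are left when all tokens that share their processor with another token
of `A` at time `t` are annihilated. -/
noncomputable def survivors (A : Finset (Fin M)) (t : ℝ≥0) : Finset (Fin M) :=
  A.filter fun i => ∀ j ∈ A, j ≠ i → ¬ Meet N z x i j t

open Classical in
/-- The evolution of the system with all `M` tokens: the time of the `n`-th collision event
(`⊤` if there are fewer), and the set of the tokens that are present immediately after it. -/
noncomputable def stage : ℕ → ℝ≥0∞ × Finset (Fin M)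
  | 0 => (0, Finset.univ)
  | n + 1 =>
    let s := stage n
    let t := nextCollision N z x s.2 s.1
    (t, if t = ⊤ then s.2 else survivors N z x s.2 t.toNNReal)

/-- The time until only one token is left. -/
noncomputable def stabTime : ℝ≥0∞ :=
  ⨅ (n : ℕ) (_ : (stage N z x n).2.card = 1), (stage N z x n).1

/-- The time until `u` and `v` have collided, in the system in which all other tokens
are ignored. -/
noncomputable def pairTime (u v : Fin M) : ℝ≥0∞ :=
  ⨅ (t : ℝ≥0) (_ : Meet N z x u v t), (t : ℝ≥0∞)

/-- In the system in which all other tokens are ignored, `u` and `v` eventually collide down: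
when they collide, `u` has caught up with `v` in clockwise direction. -/
def CollideDown (u v : Fin M) : Prop :=
  ∃ t : ℝ≥0, pairTime N z x u v = t ∧ z u + x u t = z v + x v t

/-- In the system in which all other tokens are ignored, `u` and `v` eventually collide up:
when they collide, `v` has caught up with `u` in clockwise direction. -/
def CollideUp (u v : Fin M) : Prop :=
  ∃ t : ℝ≥0, pairTime N z x u v = t ∧ z u + x u t + N = z v + x v t

end Path

/-! ### Pairings -/

/-- A set `{(u₁, v₁), …, (uₘ, vₘ)}` with `m = (M - 1) / 2` (for odd `M`) and `uᵢ < vᵢ`, such that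
`{u₁, v₁, …, uₘ, vₘ, w₀}` is the set of all tokens for some `w₀`. -/
def IsPairing {M : ℕ} (w : Finset (Fin M × Fin M)) : Prop :=
  w.card = (M - 1) / 2 ∧ (∀ p ∈ w, p.1 < p.2) ∧
    ∃ w₀ : Fin M, insert w₀ (w.image Prod.fst ∪ w.image Prod.snd) = Finset.univ

open Classical in
/-- The set of all pairings. -/
noncomputable def pairings (M : ℕ) : Finset (Finset (Fin M × Fin M)) :=
  Finset.univ.filter IsPairing

/-- The permutation `σ` is, in one-line notation, `u₁ v₁ u₂ v₂ ⋯ uₘ vₘ w₀` for some enumeration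
`(u₁, v₁), …, (uₘ, vₘ)` of `w`. -/
def Lists {M : ℕ} (σ : Equiv.Perm (Fin M)) (w : Finset (Fin M × Fin M)) : Prop :=
  ∀ p : Fin M × Fin M, p ∈ w ↔
    ∃ (i : ℕ) (h : 2 * i + 1 < M), p = (σ ⟨2 * i, Nat.lt_of_succ_lt h⟩, σ ⟨2 * i + 1, h⟩)

open Classical in
/-- The sign of a pairing: `1` if the permutation `u₁ v₁ ⋯ uₘ vₘ w₀` is even, `-1` otherwise
(this does not depend on the order in which the pairs are listed). -/
noncomputable def pairingSign {M : ℕ} (w : Finset (Fin M × Fin M)) : ℝ :=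
  if ∃ σ : Equiv.Perm (Fin M), Lists σ w ∧ Equiv.Perm.sign σ = 1 then 1 else -1

end Herman

/-! The right-hand side is a Pfaffian-like sum (`pairingSum`) of an antisymmetric matrix of odd
size. The proof shows that it obeys the same renewal equation in `t` as the left-hand side, with the
same behaviour at collisions and the same terminal value.

Algebra. If two rows `u` and `v` agree away from `u` and `v`, then exchanging `u` and `v` cancels
all lists in which they are not paired with each other. Hence every entry linking `u` or `v` with
another element may be set to `0` (`pairingSum_isolate`). Applied to consecutive elements, this
evaluates the sum of the matrix of order signs as `1`. As rotations of an odd number of elements are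
even, the value remains `1` for the cyclic order cut at any token (`pairingSum_cutSign`).

Collisions. Let the entry of a pair be the mean of its collision sign: `1` down, `-1` up, `0` not
yet. This mean depends only on the two positions, and it changes sign when `a, b` is replaced by `b,
a + N`. Hence two tokens at the same processor have equal rows, and their own entry is `1` or `-1`.
They can be isolated from the rest, which is the effect of annihilation. A state therefore consists
of the positions, the set `A` of live tokens and a matrix `c` that records the signs of the
annihilated pairs (`stateMatrix`, `IsWeaklyOrdered.exists_settle`). The same operations preserve the
value `1` of the sum for a cyclic order cut at any survivor. When a single token is left, the
entries between live tokens are all `0`, so the sum equals `1`, as does the probability that the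
system has stabilized.

Time. The tokens used by different pairs of a pairing are disjoint, so the product of means is the
mean of a product (`IsTokenPath.integral_pairing_prod`). The difference of the two sides is thus an
integral over paths and can be split at the first jump, after which the system restarts
independently (`HasRenewal`). Before that jump both terms vanish if at least two tokens are alive.
If `q < 1` is the mean of `exp (-s)` for the first jump time `s`, each renewal improves a bound `D *
exp t` of the difference by the factor `q`, so the difference is zero
(`IsState.meanDiscrepancy_eq_zero`).

Only the renewal property depends on the protocol. The synchronous one restarts after each time
step. For the asynchronous one the restart at the first passing is the lack of memory of the
exponential distribution. -/

namespace Herman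

/-! ### Signed sums over pairings -/

section Pairings

open Equiv

variable {m : ℕ}

/-- The position of the first (`false`) or second (`true`) component of the `i`-th pair, or of the
unpaired element, in a one-line notation `u₁ v₁ ⋯ uₘ vₘ w₀`. -/
def position : (Bool × Fin m) ⊕ Unit → Fin (2 * m + 1)
  | Sum.inl (false, i) => ⟨2 * i, by omega⟩
  | Sum.inl (true, i) => ⟨2 * i + 1, by omega⟩
  | Sum.inr _ => ⟨2 * m, by omega⟩

theorem position_injective : Function.Injective (position (m := m)) := by
  rintro (⟨_ | _, i⟩ | _) (⟨_ | _, j⟩ | _) h <;>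
    simp only [position, reduceCtorEq, Sum.inl.injEq, Prod.mk.injEq, true_and,
      false_and, Fin.ext_iff] at h ⊢ <;> omega

/-- `position` as an equivalence. -/
noncomputable def positionEquiv : (Bool × Fin m) ⊕ Unit ≃ Fin (2 * m + 1) :=
  Equiv.ofBijective position <| by
    rw [Fintype.bijective_iff_injective_and_card]
    exact ⟨position_injective, by simp⟩

/-- The first component of the `i`-th pair listed by `σ`. -/
def fstOf (σ : Perm (Fin (2 * m + 1))) (i : Fin m) : Fin (2 * m + 1) :=
  σ (position (Sum.inl (false, i)))

/-- The second component of the `i`-th pair listed by `σ`. -/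
def sndOf (σ : Perm (Fin (2 * m + 1))) (i : Fin m) : Fin (2 * m + 1) :=
  σ (position (Sum.inl (true, i)))

/-- The unpaired element of the list `σ`. -/
def unpaired (σ : Perm (Fin (2 * m + 1))) : Fin (2 * m + 1) :=
  σ (position (Sum.inr ()))

theorem exists_position (σ : Perm (Fin (2 * m + 1))) (x : Fin (2 * m + 1)) :
    (∃ i, x = fstOf σ i) ∨ (∃ i, x = sndOf σ i) ∨ x = unpaired σ := by
  obtain ⟨p, hp⟩ := (positionEquiv (m := m)).surjective (σ.symm x)
  have hx : x = σ (position p) := by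
    have : position p = σ.symm x := hp
    rw [this, apply_symm_apply]
  rcases p with ⟨_ | _, i⟩ | _
  · exact Or.inl ⟨i, hx⟩
  · exact Or.inr (Or.inl ⟨i, hx⟩)
  · exact Or.inr (Or.inr hx)

theorem fstOf_injective (σ : Perm (Fin (2 * m + 1))) : Function.Injective (fstOf σ) := by
  intro i j h
  simpa using position_injective (σ.injective h)

theorem sndOf_injective (σ : Perm (Fin (2 * m + 1))) : Function.Injective (sndOf σ) := by
  intro i j h
  simpa using position_injective (σ.injective h)

theorem fstOf_ne_sndOf (σ : Perm (Fin (2 * m + 1))) (i j : Fin m) : fstOf σ i ≠ sndOf σ j := by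
  intro h
  simpa using position_injective (σ.injective h)

/-- The term of the permutation `σ` in the signed sum over all lists. -/
noncomputable def listTerm (B : Fin (2 * m + 1) → Fin (2 * m + 1) → ℝ)
    (σ : Perm (Fin (2 * m + 1))) : ℝ :=
  (Perm.sign σ : ℤ) * ∏ i, B (fstOf σ i) (sndOf σ i)

theorem lists_iff {σ : Perm (Fin (2 * m + 1))} {w : Finset (Fin (2 * m + 1) × Fin (2 * m + 1))} :
    Lists σ w ↔ ∀ p, p ∈ w ↔ ∃ i, p = (fstOf σ i, sndOf σ i) := by
  refine forall_congr' fun p => ?_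
  have : (∃ (i : ℕ) (h : 2 * i + 1 < 2 * m + 1),
      p = (σ ⟨2 * i, Nat.lt_of_succ_lt h⟩, σ ⟨2 * i + 1, h⟩)) ↔
      ∃ i : Fin m, p = (fstOf σ i, sndOf σ i) :=
    ⟨fun ⟨i, h, e⟩ => ⟨⟨i, by omega⟩, e⟩, fun ⟨i, e⟩ => ⟨i, by omega, e⟩⟩
  rw [this]

/-- The sign of a permutation is determined by the pairs that it lists. -/
theorem sign_eq_of_lists {σ τ : Perm (Fin (2 * m + 1))}
    {w : Finset (Fin (2 * m + 1) × Fin (2 * m + 1))} (hσ : Lists σ w) (hτ : Lists τ w) :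
    Perm.sign σ = Perm.sign τ := by
  rw [lists_iff] at hσ hτ
  have key : ∀ i, ∃ j, fstOf σ i = fstOf τ j ∧ sndOf σ i = sndOf τ j := by
    intro i
    obtain ⟨j, hj⟩ := (hτ _).1 ((hσ _).2 ⟨i, rfl⟩)
    exact ⟨j, congrArg Prod.fst hj, congrArg Prod.snd hj⟩
  choose g hg using key
  have hginj : Function.Injective g := by
    intro i j h
    exact fstOf_injective σ (by rw [(hg i).1, (hg j).1, h])
  let π : Perm (Fin m) := Equiv.ofBijective g (Finite.injective_iff_bijective.1 hginj)
  -- `π` reorders the pairs, and `k` applies it to the first and to the second components at once.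
  let k : Perm (Fin (2 * m + 1)) := positionEquiv.permCongr
    (Perm.sumCongr (prodCongrRight fun _ : Bool => π) (1 : Perm Unit))
  have hk : ∀ p, k (position p) =
      position (Perm.sumCongr (prodCongrRight fun _ : Bool => π) (1 : Perm Unit) p) := by
    intro p
    have : position p = positionEquiv p := rfl
    simp only [k, this, permCongr_apply, symm_apply_apply]
    rfl
  have hpair : ∀ q, (τ * k) (position (Sum.inl q)) = σ (position (Sum.inl q)) := by
    rintro ⟨_ | _, i⟩
    · rw [Perm.mul_apply, hk]; exact (hg i).1.symm
    · rw [Perm.mul_apply, hk]; exact (hg i).2.symm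
  have hsurj : ∀ x : Fin (2 * m + 1), ∃ p : (Bool × Fin m) ⊕ Unit, x = position p := fun x =>
    ⟨positionEquiv.symm x, (positionEquiv.apply_symm_apply x).symm⟩
  have hlast : (τ * k) (position (Sum.inr ())) = σ (position (Sum.inr ())) := by
    obtain ⟨x, hx⟩ := (τ * k).surjective (σ (position (Sum.inr ())))
    obtain ⟨p, rfl⟩ := hsurj x
    rcases p with q | _
    · rw [hpair] at hx
      exact absurd (position_injective (σ.injective hx)) (by simp)
    · exact hx
  have hσk : σ = τ * k := by
    ext1 x
    obtain ⟨p, rfl⟩ := hsurj x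
    rcases p with q | ⟨⟩
    · exact (hpair q).symm
    · exact hlast.symm
  -- The sign of `π` enters once for each component, hence squared.
  have hsk : Perm.sign k = 1 := by
    simp only [k, Perm.sign_permCongr, Perm.sign_sumCongr, Perm.sign_prodCongrRight,
      Fintype.prod_bool, Int.units_mul_self, map_one, mul_one]
  rw [hσk, map_mul, hsk, mul_one]

theorem pairingSign_eq_sign {σ : Perm (Fin (2 * m + 1))}
    {w : Finset (Fin (2 * m + 1) × Fin (2 * m + 1))} (h : Lists σ w) :
    pairingSign w = (Perm.sign σ : ℤ) := by
  unfold pairingSign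
  rcases Int.units_eq_one_or (Perm.sign σ) with hs | hs
  · rw [if_pos ⟨σ, h, hs⟩, hs]; simp
  · rw [if_neg, hs]
    · simp
    · rintro ⟨τ, hτ, hτ1⟩
      rw [sign_eq_of_lists h hτ, hτ1] at hs
      exact absurd hs (by decide)

/-- The components of a pair in increasing order. -/
def sortPair {α : Type*} [LinearOrder α] (p : α × α) : α × α :=
  if p.1 < p.2 then p else (p.2, p.1)

/-- The pairs listed by `σ`, each of them in increasing order. -/
def pairsOf (σ : Perm (Fin (2 * m + 1))) : Finset (Fin (2 * m + 1) × Fin (2 * m + 1)) :=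
  Finset.univ.image fun i => sortPair (fstOf σ i, sndOf σ i)

/-- Each list can be reoriented so that its pairs become increasing, without a change of the
corresponding term for antisymmetric matrices. -/
theorem exists_reorientation (σ : Perm (Fin (2 * m + 1))) :
    ∃ τ : Perm (Fin (2 * m + 1)),
      (∀ i, (fstOf τ i, sndOf τ i) = sortPair (fstOf σ i, sndOf σ i)) ∧
      unpaired τ = unpaired σ ∧
      ∀ B : Fin (2 * m + 1) → Fin (2 * m + 1) → ℝ, (∀ a b, B a b = -B b a) →
        listTerm B τ = listTerm B σ := by
  classical
  -- Decreasing pairs are flipped. Each flip negates both the sign of the list and one factor of the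
  -- product.
  let f : Fin m → Perm Bool := fun i => if fstOf σ i < sndOf σ i then 1 else swap false true
  let k : Perm (Fin (2 * m + 1)) := positionEquiv.permCongr
    (Perm.sumCongr (prodCongrLeft f) (1 : Perm Unit))
  have hk : ∀ p, k (position p) =
      position (Perm.sumCongr (prodCongrLeft f) (1 : Perm Unit) p) := by
    intro p
    have : position p = positionEquiv p := rfl
    simp only [k, this, permCongr_apply, symm_apply_apply]
    rfl
  have hf : ∀ b i, (σ * k) (position (Sum.inl (b, i))) = σ (position (Sum.inl (f i b, i))) := by
    intro b i
    rw [Perm.mul_apply, hk]; rfl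
  have hor : ∀ i, (fstOf (σ * k) i, sndOf (σ * k) i) = sortPair (fstOf σ i, sndOf σ i) := by
    intro i
    by_cases h : fstOf σ i < sndOf σ i
    · have hfi : f i = 1 := if_pos h
      have h1 := hf false i
      have h2 := hf true i
      rw [hfi] at h1 h2
      exact (Prod.ext h1 h2).trans (if_pos h).symm
    · have hfi : f i = swap false true := if_neg h
      have h1 := hf false i
      have h2 := hf true i
      rw [hfi, swap_apply_left] at h1
      rw [hfi, swap_apply_right] at h2
      exact (Prod.ext h1 h2).trans (if_neg h).symm
  refine ⟨σ * k, hor, ?_, fun B hB => ?_⟩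
  · unfold unpaired
    rw [Perm.mul_apply, hk]; rfl
  · have hs : Perm.sign k = ∏ i, Perm.sign (f i) := by
      simp only [k, Perm.sign_permCongr, Perm.sign_sumCongr, Perm.sign_prodCongrLeft, map_one,
        mul_one]
    have hterm : ∀ i, B (fstOf (σ * k) i) (sndOf (σ * k) i) =
        ((Perm.sign (f i) : ℤ) : ℝ) * B (fstOf σ i) (sndOf σ i) := by
      intro i
      have h1 := congrArg Prod.fst (hor i)
      have h2 := congrArg Prod.snd (hor i)
      simp only at h1 h2
      rw [h1, h2]
      unfold sortPair
      by_cases h : fstOf σ i < sndOf σ i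
      · simp [f, h]
      · simp only [h, if_false, f, Perm.sign_swap (show false ≠ true by decide)]
        rw [hB]; simp
    unfold listTerm
    rw [map_mul, hs, Finset.prod_congr rfl fun i _ => hterm i, Finset.prod_mul_distrib]
    have hsq : (∏ i, ((Perm.sign (f i) : ℤ) : ℝ)) * ∏ i, ((Perm.sign (f i) : ℤ) : ℝ) = 1 := by
      rw [← Finset.prod_mul_distrib]
      refine Finset.prod_eq_one fun i _ => ?_
      rcases Int.units_eq_one_or (Perm.sign (f i)) with h | h <;> rw [h] <;> simp
    push_cast
    linear_combination ((Perm.sign σ : ℤ) : ℝ) * (∏ i, B (fstOf σ i) (sndOf σ i)) * hsq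

theorem lists_pairsOf {σ τ : Perm (Fin (2 * m + 1))}
    (h : ∀ i, (fstOf τ i, sndOf τ i) = sortPair (fstOf σ i, sndOf σ i)) :
    Lists τ (pairsOf σ) := by
  rw [lists_iff]
  intro p
  simp only [pairsOf, Finset.mem_image, Finset.mem_univ, true_and]
  exact ⟨fun ⟨i, hi⟩ => ⟨i, by rw [h, hi]⟩, fun ⟨i, hi⟩ => ⟨i, by rw [hi, h]⟩⟩

theorem prod_eq_prod_of_lists {τ : Perm (Fin (2 * m + 1))}
    {w : Finset (Fin (2 * m + 1) × Fin (2 * m + 1))} (h : Lists τ w)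
    (B : Fin (2 * m + 1) → Fin (2 * m + 1) → ℝ) :
    ∏ i, B (fstOf τ i) (sndOf τ i) = ∏ p ∈ w, B p.1 p.2 := by
  classical
  rw [lists_iff] at h
  have hw : w = Finset.univ.image fun i => (fstOf τ i, sndOf τ i) := by
    ext p
    simp only [h, Finset.mem_image, Finset.mem_univ, true_and, eq_comm]
  rw [hw, Finset.prod_image]
  intro i _ j _ hij
  exact fstOf_injective τ (congrArg Prod.fst hij)

/-- After reorientation, both the sign and the product depend only on the set of pairs that is
listed. -/
theorem listTerm_eq (B : Fin (2 * m + 1) → Fin (2 * m + 1) → ℝ) (hB : ∀ a b, B a b = -B b a)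
    (σ : Perm (Fin (2 * m + 1))) :
    listTerm B σ = pairingSign (pairsOf σ) * ∏ p ∈ pairsOf σ, B p.1 p.2 := by
  obtain ⟨τ, hor, -, hterm⟩ := exists_reorientation σ
  have hl := lists_pairsOf hor
  rw [← hterm B hB, pairingSign_eq_sign hl, ← prod_eq_prod_of_lists hl]
  rfl

theorem mem_pairings {M : ℕ} {w : Finset (Fin M × Fin M)} : w ∈ pairings M ↔ IsPairing w := by
  simp [pairings]

theorem pairsOf_mem_pairings (σ : Perm (Fin (2 * m + 1))) :
    pairsOf σ ∈ pairings (2 * m + 1) := by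
  classical
  obtain ⟨τ, hor, -, -⟩ := exists_reorientation σ
  have hp : pairsOf σ = Finset.univ.image fun i => (fstOf τ i, sndOf τ i) := by
    unfold pairsOf
    exact Finset.image_congr fun i _ => (hor i).symm
  rw [mem_pairings]
  refine ⟨?_, ?_, unpaired τ, ?_⟩
  · rw [hp, Finset.card_image_of_injective _
      fun i j hij => fstOf_injective τ (congrArg Prod.fst hij)]
    simp
  · intro p hpm
    simp only [pairsOf, Finset.mem_image, Finset.mem_univ, true_and] at hpm
    obtain ⟨i, rfl⟩ := hpm
    unfold sortPair
    split_ifs with h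
    · exact h
    · exact lt_of_le_of_ne (not_lt.1 h) (fstOf_ne_sndOf σ i i).symm
  · rw [Finset.eq_univ_iff_forall]
    intro x
    rw [hp]
    simp only [Finset.mem_insert, Finset.mem_union, Finset.mem_image, Finset.mem_univ, true_and,
      exists_exists_eq_and]
    rcases exists_position τ x with ⟨i, rfl⟩ | ⟨i, rfl⟩ | rfl
    · exact Or.inr (Or.inl ⟨i, rfl⟩)
    · exact Or.inr (Or.inr ⟨i, rfl⟩)
    · exact Or.inl rfl

/-- A surjection from `2 * m + 1` slots onto `2 * m + 1` elements is bijective. Thus the covering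
condition in `IsPairing` already makes the pairs disjoint. -/
theorem exists_pairsOf_eq {w : Finset (Fin (2 * m + 1) × Fin (2 * m + 1))}
    (hw : w ∈ pairings (2 * m + 1)) : ∃ σ, pairsOf σ = w := by
  classical
  obtain ⟨hcard, hlt, w₀, hcover⟩ := mem_pairings.1 hw
  have hcard' : w.card = m := by simpa using hcard
  let e : Fin m ≃ w := (w.equivFinOfCardEq hcard').symm
  let g : (Bool × Fin m) ⊕ Unit → Fin (2 * m + 1)
    | Sum.inl (false, i) => (e i).1.1
    | Sum.inl (true, i) => (e i).1.2
    | Sum.inr _ => w₀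
  have hg : Function.Bijective g := by
    rw [Fintype.bijective_iff_surjective_and_card]
    refine ⟨fun x => ?_, by simp⟩
    have hx : x ∈ insert w₀ (w.image Prod.fst ∪ w.image Prod.snd) := by
      rw [hcover]; exact Finset.mem_univ x
    simp only [Finset.mem_insert, Finset.mem_union, Finset.mem_image] at hx
    rcases hx with rfl | ⟨p, hp, rfl⟩ | ⟨p, hp, rfl⟩
    · exact ⟨Sum.inr (), rfl⟩
    · exact ⟨Sum.inl (false, e.symm ⟨p, hp⟩), by simp [g]⟩
    · exact ⟨Sum.inl (true, e.symm ⟨p, hp⟩), by simp [g]⟩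
  let σ : Perm (Fin (2 * m + 1)) := positionEquiv.symm.trans (Equiv.ofBijective g hg)
  have hσ : ∀ p, σ (position p) = g p := by
    intro p
    have : position p = positionEquiv p := rfl
    simp only [σ, this, trans_apply, symm_apply_apply]
    rfl
  refine ⟨σ, ?_⟩
  have hs : ∀ i, sortPair (fstOf σ i, sndOf σ i) = (e i).1 := by
    intro i
    have h := hlt _ (e i).2
    simp only [fstOf, sndOf, hσ, g, sortPair]
    rw [if_pos h]
  ext p
  simp only [pairsOf, hs, Finset.mem_image, Finset.mem_univ, true_and]
  constructor
  · rintro ⟨i, rfl⟩; exact (e i).2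
  · intro hp; exact ⟨e.symm ⟨p, hp⟩, by simp⟩

theorem sortPair_swap {α : Type*} [LinearOrder α] (p : α × α) :
    sortPair (p.2, p.1) = sortPair p := by
  unfold sortPair
  rcases lt_trichotomy p.1 p.2 with h | h | h
  · simp [h, not_lt.2 h.le]
  · simp [h]
  · simp [h, not_lt.2 h.le]

theorem sortPair_map_sortPair {α : Type*} [LinearOrder α] (f : α → α) (p : α × α) :
    sortPair (f (sortPair p).1, f (sortPair p).2) = sortPair (f p.1, f p.2) := by
  by_cases h : p.1 < p.2
  · simp only [sortPair, h, if_true]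
  · have : sortPair p = (p.2, p.1) := by simp [sortPair, h]
    rw [this]
    exact sortPair_swap (f p.1, f p.2)

theorem pairsOf_mul (τ σ : Perm (Fin (2 * m + 1))) :
    pairsOf (τ * σ) = (pairsOf σ).image fun p => sortPair (τ p.1, τ p.2) := by
  unfold pairsOf
  rw [Finset.image_image]
  refine Finset.image_congr fun i _ => ?_
  simp only [Function.comp]
  rw [sortPair_map_sortPair]
  rfl

/-- Left multiplication by a permutation that carries one pairing to the other maps the fibres
injectively. Used in both directions, it shows that all fibres have the same size. -/
theorem card_fiber_le {w w' : Finset (Fin (2 * m + 1) × Fin (2 * m + 1))}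
    (hw : w ∈ pairings (2 * m + 1)) (hw' : w' ∈ pairings (2 * m + 1)) :
    (Finset.univ.filter fun σ => pairsOf σ = w).card ≤
      (Finset.univ.filter fun σ => pairsOf σ = w').card := by
  obtain ⟨σ, rfl⟩ := exists_pairsOf_eq hw
  obtain ⟨σ', rfl⟩ := exists_pairsOf_eq hw'
  refine Finset.card_le_card_of_injOn (fun ρ => (σ' * σ⁻¹) * ρ) (fun ρ hρ => ?_)
    (mul_right_injective _).injOn
  simp only [Finset.coe_filter, Finset.mem_univ, true_and, Set.mem_ofPred_eq] at hρ ⊢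
  rw [pairsOf_mul, hρ, ← pairsOf_mul]
  simp

/-- The signed sum over all pairings of the products of the entries of `B`. -/
noncomputable def pairingSum {M : ℕ} (B : Fin M → Fin M → ℝ) : ℝ :=
  ∑ w ∈ pairings M, pairingSign w * ∏ p ∈ w, B p.1 p.2

/-- The sum over all lists is, up to a constant factor, the sum over all pairings. -/
theorem exists_sum_listTerm (m : ℕ) : ∃ C : ℝ, C ≠ 0 ∧
    ∀ B : Fin (2 * m + 1) → Fin (2 * m + 1) → ℝ, (∀ a b, B a b = -B b a) →
      ∑ σ, listTerm B σ = C * pairingSum B := by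
  classical
  let w₁ := pairsOf (1 : Perm (Fin (2 * m + 1)))
  have hw₁ : w₁ ∈ pairings (2 * m + 1) := pairsOf_mem_pairings 1
  -- The constant is the common size of the fibres. Only its nonvanishing matters.
  refine ⟨((Finset.univ.filter fun σ => pairsOf σ = w₁).card : ℝ), ?_, fun B hB => ?_⟩
  · rw [Nat.cast_ne_zero]
    exact (Finset.card_pos.2 ⟨1, by simp [w₁]⟩).ne'
  · rw [← Finset.sum_fiberwise_of_maps_to (t := pairings (2 * m + 1)) (g := pairsOf)
      (fun σ _ => pairsOf_mem_pairings σ), pairingSum, Finset.mul_sum]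
    refine Finset.sum_congr rfl fun w hw => ?_
    rw [Finset.sum_congr rfl (g := fun _ => pairingSign w * ∏ p ∈ w, B p.1 p.2), Finset.sum_const,
      nsmul_eq_mul, le_antisymm (card_fiber_le hw hw₁) (card_fiber_le hw₁ hw)]
    intro σ hσ
    simp only [Finset.mem_filter, Finset.mem_univ, true_and] at hσ
    rw [listTerm_eq B hB, hσ]

/-- `B` with the entries that link `u` or `v` with other elements replaced by `0`. -/
def isolate {M : ℕ} (B : Fin M → Fin M → ℝ) (u v : Fin M) (a b : Fin M) : ℝ :=
  if (a = u ∨ a = v) ↔ (b = u ∨ b = v) then B a b else 0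

theorem isolate_antisymm {M : ℕ} {B : Fin M → Fin M → ℝ} (hB : ∀ a b, B a b = -B b a)
    (u v a b : Fin M) : isolate B u v a b = -isolate B u v b a := by
  unfold isolate
  by_cases h : (a = u ∨ a = v) ↔ (b = u ∨ b = v)
  · rw [if_pos h, if_pos h.symm, hB]
  · rw [if_neg h, if_neg fun h' => h h'.symm, neg_zero]

theorem listTerm_isolate_of_paired {B : Fin (2 * m + 1) → Fin (2 * m + 1) → ℝ}
    {u v : Fin (2 * m + 1)} {σ : Perm (Fin (2 * m + 1))}
    (h : ∀ i, (fstOf σ i = u ∨ fstOf σ i = v) ↔ (sndOf σ i = u ∨ sndOf σ i = v)) :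
    listTerm (isolate B u v) σ = listTerm B σ := by
  unfold listTerm
  congr 1
  refine Finset.prod_congr rfl fun i _ => ?_
  rw [isolate, if_pos (h i)]

theorem listTerm_isolate_of_not_paired {B : Fin (2 * m + 1) → Fin (2 * m + 1) → ℝ}
    {u v : Fin (2 * m + 1)} {σ : Perm (Fin (2 * m + 1))} {i : Fin m}
    (h : ¬((fstOf σ i = u ∨ fstOf σ i = v) ↔ (sndOf σ i = u ∨ sndOf σ i = v))) :
    listTerm (isolate B u v) σ = 0 := by
  unfold listTerm
  rw [Finset.prod_eq_zero (Finset.mem_univ i), mul_zero]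
  rw [isolate, if_neg h]

/-- Since no pair consists of `u` and `v`, the exchange only replaces entries by equal entries of
the other row or column. What remains is the sign of the transposition. -/
theorem listTerm_swap_of_not_paired {B : Fin (2 * m + 1) → Fin (2 * m + 1) → ℝ}
    (hB : ∀ a b, B a b = -B b a) {u v : Fin (2 * m + 1)} (huv : u ≠ v)
    (hrow : ∀ b, b ≠ u → b ≠ v → B u b = B v b) {σ : Perm (Fin (2 * m + 1))} {i : Fin m}
    (h : ¬((fstOf σ i = u ∨ fstOf σ i = v) ↔ (sndOf σ i = u ∨ sndOf σ i = v))) :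
    listTerm B (swap u v * σ) = -listTerm B σ := by
  have hcol : ∀ b, b ≠ u → b ≠ v → B b u = B b v := fun b h1 h2 => by
    rw [hB b u, hB b v, hrow b h1 h2]
  have hprod : ∀ j, B (fstOf (swap u v * σ) j) (sndOf (swap u v * σ) j) =
      B (fstOf σ j) (sndOf σ j) := by
    intro j
    change B (swap u v (fstOf σ j)) (swap u v (sndOf σ j)) = _
    -- A pair that uses up both `u` and `v` would leave neither of them for pair `i`.
    have hboth : ¬((fstOf σ j = u ∨ fstOf σ j = v) ∧ (sndOf σ j = u ∨ sndOf σ j = v)) := by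
      rintro ⟨h1, h2⟩
      have hij : i ≠ j := by
        rintro rfl
        exact h (iff_of_true h1 h2)
      have hmem : ∀ x, x = u ∨ x = v → x = fstOf σ j ∨ x = sndOf σ j := by
        have hne : fstOf σ j ≠ sndOf σ j := fstOf_ne_sndOf σ j j
        rintro x (rfl | rfl)
        · rcases h1 with h1 | h1
          · exact Or.inl h1.symm
          · exact Or.inr (h2.resolve_right fun e => hne (h1.trans e.symm)).symm
        · rcases h1 with h1 | h1
          · exact Or.inr (h2.resolve_left fun e => hne (h1.trans e.symm)).symm
          · exact Or.inl h1.symm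
      refine h (iff_of_false (fun e => ?_) fun e => ?_)
      · rcases hmem _ e with e | e
        · exact hij (fstOf_injective σ e)
        · exact fstOf_ne_sndOf σ i j e
      · rcases hmem _ e with e | e
        · exact fstOf_ne_sndOf σ j i e.symm
        · exact hij (sndOf_injective σ e)
    by_cases h1 : fstOf σ j = u ∨ fstOf σ j = v
    · have h2 := not_or.1 fun h2 => hboth ⟨h1, h2⟩
      rw [swap_apply_of_ne_of_ne h2.1 h2.2]
      rcases h1 with h1 | h1
      · rw [h1, swap_apply_left, hrow _ h2.1 h2.2]
      · rw [h1, swap_apply_right, hrow _ h2.1 h2.2]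
    · rw [not_or] at h1
      rw [swap_apply_of_ne_of_ne h1.1 h1.2]
      by_cases h2 : sndOf σ j = u ∨ sndOf σ j = v
      · rcases h2 with h2 | h2
        · rw [h2, swap_apply_left, hcol _ h1.1 h1.2]
        · rw [h2, swap_apply_right, hcol _ h1.1 h1.2]
      · rw [not_or] at h2
        rw [swap_apply_of_ne_of_ne h2.1 h2.2]
  unfold listTerm
  rw [Finset.prod_congr rfl fun j _ => hprod j, map_mul, Perm.sign_swap huv]
  push_cast
  ring

/-- If the rows of `u` and `v` agree, all entries that link `u` or `v` with other elements can be
replaced by `0`. -/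
theorem pairingSum_isolate {B : Fin (2 * m + 1) → Fin (2 * m + 1) → ℝ}
    (hB : ∀ a b, B a b = -B b a) {u v : Fin (2 * m + 1)} (huv : u ≠ v)
    (hrow : ∀ b, b ≠ u → b ≠ v → B u b = B v b) :
    pairingSum (isolate B u v) = pairingSum B := by
  obtain ⟨C, hC, hsum⟩ := exists_sum_listTerm m
  have hmul : ∀ f : Perm (Fin (2 * m + 1)) → ℝ, ∑ σ, f (swap u v * σ) = ∑ σ, f σ := fun f =>
    _root_.Equiv.sum_comp (Equiv.mulLeft (swap u v)) f
  -- Each list is added to its image under the exchange. Lists that do not separate `u` from `v` are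
  -- unaffected by `isolate`; for the others both sums are zero, one term by term and the other by
  -- cancellation.
  have hpoint : ∀ σ, listTerm (isolate B u v) σ + listTerm (isolate B u v) (swap u v * σ) =
      listTerm B σ + listTerm B (swap u v * σ) := by
    intro σ
    have hsw : ∀ x, (swap u v x = u ∨ swap u v x = v) ↔ (x = u ∨ x = v) := by
      intro x
      rw [swap_apply_eq_iff, swap_apply_eq_iff, swap_apply_left, swap_apply_right, or_comm]
    have hsw' : ∀ i, ((fstOf (swap u v * σ) i = u ∨ fstOf (swap u v * σ) i = v) ↔
        (sndOf (swap u v * σ) i = u ∨ sndOf (swap u v * σ) i = v)) ↔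
        ((fstOf σ i = u ∨ fstOf σ i = v) ↔ (sndOf σ i = u ∨ sndOf σ i = v)) := fun i =>
      iff_congr (hsw _) (hsw _)
    by_cases h : ∀ i, (fstOf σ i = u ∨ fstOf σ i = v) ↔ (sndOf σ i = u ∨ sndOf σ i = v)
    · rw [listTerm_isolate_of_paired h, listTerm_isolate_of_paired fun i => (hsw' i).2 (h i)]
    · push Not at h
      obtain ⟨i, hi⟩ := h
      have hi' : ¬((fstOf σ i = u ∨ fstOf σ i = v) ↔ (sndOf σ i = u ∨ sndOf σ i = v)) := by
        tauto
      rw [listTerm_isolate_of_not_paired hi',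
        listTerm_isolate_of_not_paired fun h => hi' ((hsw' i).1 h),
        listTerm_swap_of_not_paired hB huv hrow hi']
      ring
  have htot := Finset.sum_congr (rfl : (Finset.univ : Finset (Perm (Fin (2 * m + 1)))) = _)
    fun σ _ => hpoint σ
  rw [Finset.sum_add_distrib, Finset.sum_add_distrib, hmul, hmul (listTerm B), hsum B hB,
    hsum _ (isolate_antisymm hB u v)] at htot
  have := mul_left_cancel₀ hC (show C * pairingSum (isolate B u v) = C * pairingSum B by linarith)
  exact this

/-- The signed sum is invariant under even renumberings. -/
theorem pairingSum_comp_perm {B : Fin (2 * m + 1) → Fin (2 * m + 1) → ℝ}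
    (hB : ∀ a b, B a b = -B b a) {τ : Perm (Fin (2 * m + 1))} (hτ : Perm.sign τ = 1) :
    pairingSum (fun a b => B (τ a) (τ b)) = pairingSum B := by
  obtain ⟨C, hC, hsum⟩ := exists_sum_listTerm m
  have hterm : ∀ σ, listTerm (fun a b => B (τ a) (τ b)) σ = listTerm B (τ * σ) := by
    intro σ
    unfold listTerm
    rw [map_mul, hτ, one_mul]
    rfl
  have h : ∑ σ, listTerm (fun a b => B (τ a) (τ b)) σ = ∑ σ, listTerm B σ := by
    simp_rw [hterm]
    exact _root_.Equiv.sum_comp (Equiv.mulLeft τ) (listTerm B)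
  rw [hsum B hB, hsum _ fun a b => hB _ _] at h
  exact mul_left_cancel₀ hC h

end Pairings

/-! ### Sums of order-sign matrices, and the matrix bookkeeping of annihilations -/

section SignMatrices

open Equiv

/-- The matrix with the entries `1` above and `-1` below the diagonal. -/
def orderSign {M : ℕ} (a b : Fin M) : ℝ := if a < b then 1 else if b < a then -1 else 0

theorem orderSign_antisymm {M : ℕ} (a b : Fin M) : orderSign a b = -orderSign b a := by
  unfold orderSign
  rcases lt_trichotomy a b with h | rfl | h
  · simp [h, h.not_gt]
  · simp
  · simp [h, h.not_gt]

/-- `orderSign` with all entries removed that link one of the first `2 * k` elements with an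
element that is not its partner in `{0, 1}, {2, 3}, …`. -/
def blockSign {M : ℕ} (k : ℕ) (a b : Fin M) : ℝ :=
  if (2 * k ≤ a.1 ∧ 2 * k ≤ b.1) ∨ a.1 / 2 = b.1 / 2 then orderSign a b else 0

variable {m : ℕ}

theorem blockSign_antisymm (k : ℕ) (a b : Fin (2 * m + 1)) :
    blockSign k a b = -blockSign k b a := by
  unfold blockSign
  rw [orderSign_antisymm]
  by_cases h : (2 * k ≤ a.1 ∧ 2 * k ≤ b.1) ∨ a.1 / 2 = b.1 / 2
  · rw [if_pos h, if_pos (by omega)]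
  · rw [if_neg h, if_neg (by omega), neg_zero]

/-- In `blockSign k` the elements `2 * k` and `2 * k + 1` are unlinked from all smaller ones, and
all larger ones compare alike with both. Their rows therefore agree and they can be isolated. -/
theorem pairingSum_blockSign_succ {k : ℕ} (hk : k < m) :
    pairingSum (blockSign (M := 2 * m + 1) (k + 1)) =
      pairingSum (blockSign (M := 2 * m + 1) k) := by
  rw [← pairingSum_isolate (blockSign_antisymm k) (u := ⟨2 * k, by omega⟩)
    (v := ⟨2 * k + 1, by omega⟩) (by simp)]
  · congr 1
    funext a b
    simp only [isolate, blockSign, Fin.ext_iff]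
    by_cases h : (2 * (k + 1) ≤ a.1 ∧ 2 * (k + 1) ≤ b.1) ∨ a.1 / 2 = b.1 / 2
    · rw [if_pos h, if_pos (by omega), if_pos (by omega)]
    · rw [if_neg h]
      split_ifs <;> first | rfl | omega
  · intro b hb1 hb2
    simp only [blockSign, orderSign, Fin.lt_def, Fin.ext_iff, ne_eq] at hb1 hb2 ⊢
    split_ifs <;> first | rfl | omega

/-- Isolating `{0, 1}, {2, 3}, …` leaves one pairing with a nonzero product, the one listed by the
identity permutation. -/
theorem pairingSum_orderSign : pairingSum (orderSign (M := 2 * m + 1)) = 1 := by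
  classical
  have h0 : pairingSum (orderSign (M := 2 * m + 1)) =
      pairingSum (blockSign (M := 2 * m + 1) 0) := by
    refine congrArg _ (funext₂ fun a b => ?_)
    simp [blockSign]
  have hk : ∀ k, k ≤ m → pairingSum (blockSign (M := 2 * m + 1) k) =
      pairingSum (blockSign (M := 2 * m + 1) 0) := by
    intro k
    induction k with
    | zero => intro _; rfl
    | succ k ih => intro h; rw [pairingSum_blockSign_succ (by omega), ih (by omega)]
  rw [h0, ← hk m le_rfl, pairingSum,
    Finset.sum_eq_single_of_mem _ (pairsOf_mem_pairings (1 : Perm (Fin (2 * m + 1)))),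
    ← listTerm_eq _ (blockSign_antisymm m)]
  · unfold listTerm
    rw [Perm.sign_one, Finset.prod_eq_one]
    · simp
    · intro i _
      simp only [fstOf, sndOf, position, Perm.coe_one, id_eq, blockSign, orderSign, Fin.lt_def]
      rw [if_pos (by omega), if_pos (by omega)]
  · intro w hw hne
    rw [Finset.prod_eq_zero_iff.2, mul_zero]
    by_contra hcon
    push Not at hcon
    obtain ⟨hcard, hlt, -⟩ := mem_pairings.1 hw
    refine hne (Finset.eq_of_subset_of_card_le (fun p hp => ?_) ?_)
    · have h1 := hcon p hp
      have h2 := hlt p hp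
      simp only [blockSign, ne_eq, ite_eq_right_iff, Classical.not_imp, Fin.lt_def] at h1 h2
      have h3 := p.1.2
      have h4 := p.2.2
      simp only [pairsOf, Finset.mem_image, Finset.mem_univ, true_and]
      refine ⟨⟨p.1.1 / 2, by omega⟩, ?_⟩
      simp only [fstOf, sndOf, position, Perm.coe_one, id_eq, sortPair, Fin.lt_def]
      rw [if_pos (by omega)]
      ext
      · simp only; omega
      · simp only; omega
    · rw [hcard, (mem_pairings.1 (pairsOf_mem_pairings (1 : Perm (Fin (2 * m + 1))))).1]

/-- The matrix `orderSign` for the cyclic order of `Fin M` in which `a` is the smallest element. -/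
def cutSign {M : ℕ} (a u v : Fin M) : ℝ :=
  if a ≤ u ↔ a ≤ v then orderSign u v else -orderSign u v

theorem cutSign_antisymm {M : ℕ} (a u v : Fin M) : cutSign a u v = -cutSign a v u := by
  unfold cutSign
  rw [orderSign_antisymm]
  by_cases h : a ≤ u ↔ a ≤ v
  · rw [if_pos h, if_pos h.symm]
  · rw [if_neg h, if_neg fun h' => h h'.symm]

/-- The `(2 * m + 1)`-st power of the rotation is the identity, and an odd power of a sign is that
sign. -/
theorem sign_subRight (a : Fin (2 * m + 1)) : Perm.sign (Equiv.subRight a) = 1 := by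
  have hpow : ∀ n : ℕ, ∀ x, ((Equiv.subRight a : Perm (Fin (2 * m + 1))) ^ n) x = x - n • a := by
    intro n
    induction n with
    | zero => intro x; simp
    | succ n ih =>
      intro x
      rw [pow_succ', Perm.mul_apply, ih, Equiv.subRight_apply, succ_nsmul]
      abel
  have h1 : (Equiv.subRight a : Perm (Fin (2 * m + 1))) ^ (2 * m + 1) = 1 := by
    ext1 x
    rw [hpow]
    have : (2 * m + 1) • a = 0 := by
      have := card_nsmul_eq_zero' (x := a)
      simpa using this
    rw [this, sub_zero]; rfl
  have h2 := congrArg Perm.sign h1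
  rw [map_pow, Perm.sign_one, pow_succ, pow_mul, Int.units_sq, one_pow, one_mul] at h2
  exact h2

/-- Subtraction of `a` modulo `2 * m + 1` is an even renumbering that turns the order starting at
`a` into the standard one. -/
theorem pairingSum_cutSign (a : Fin (2 * m + 1)) : pairingSum (cutSign a) = 1 := by
  rw [← pairingSum_orderSign (m := m),
    ← pairingSum_comp_perm orderSign_antisymm (sign_subRight a)]
  congr 1
  funext u v
  simp only [Equiv.subRight_apply, cutSign, orderSign, Fin.lt_def, Fin.le_def, Fin.val_sub]
  have hu := u.2
  have hv := v.2
  have ha := a.2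
  have key : ∀ w : Fin (2 * m + 1), (2 * m + 1 - a.1 + w.1) % (2 * m + 1) =
      if a.1 ≤ w.1 then w.1 - a.1 else 2 * m + 1 - a.1 + w.1 := by
    intro w
    have hw := w.2
    split_ifs with h
    · rw [Nat.mod_eq_sub_mod (by omega), Nat.mod_eq_of_lt (by omega)]; omega
    · rw [Nat.mod_eq_of_lt (by omega)]
  rw [key, key]
  split_ifs <;> first | rfl | omega | simp

/-! ### The matrix of a partially annihilated system -/

variable {M : ℕ}

/-- The matrix that is `f` on the tokens of `A` and `c` elsewhere. -/
def stateMatrix (A : Finset (Fin M)) (c f : Fin M → Fin M → ℝ) (u v : Fin M) : ℝ :=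
  if u ∈ A ∧ v ∈ A then f u v else c u v

/-- `c` is an antisymmetric matrix with entries in `[-1, 1]` which does not link tokens of `A` with
other tokens. -/
structure IsDeadMatrix (A : Finset (Fin M)) (c : Fin M → Fin M → ℝ) : Prop where
  antisymm : ∀ a b, c a b = -c b a
  abs_le : ∀ a b, |c a b| ≤ 1
  cross : ∀ a b, a ∈ A → b ∉ A → c a b = 0

theorem IsDeadMatrix.cross' {A : Finset (Fin M)} {c : Fin M → Fin M → ℝ} (hc : IsDeadMatrix A c)
    {a b : Fin M} (ha : a ∉ A) (hb : b ∈ A) : c a b = 0 := by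
  rw [hc.antisymm, hc.cross b a hb ha, neg_zero]

theorem stateMatrix_antisymm {A : Finset (Fin M)} {c f : Fin M → Fin M → ℝ}
    (hc : IsDeadMatrix A c) (hf : ∀ a b, f a b = -f b a) (a b : Fin M) :
    stateMatrix A c f a b = -stateMatrix A c f b a := by
  unfold stateMatrix
  by_cases h : a ∈ A ∧ b ∈ A
  · rw [if_pos h, if_pos h.symm, hf]
  · rw [if_neg h, if_neg fun h' => h h'.symm, hc.antisymm]

/-- The matrix of the annihilated tokens after the annihilation of `u` and `v`. -/
def annihilate (A : Finset (Fin M)) (c : Fin M → Fin M → ℝ) (u v : Fin M) (κ : ℝ)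
    (a b : Fin M) : ℝ :=
  if a = u ∧ b = v then κ else if a = v ∧ b = u then -κ else if a ∈ A ∨ b ∈ A then 0 else c a b

theorem IsDeadMatrix.annihilate {A : Finset (Fin M)} {c : Fin M → Fin M → ℝ}
    (hc : IsDeadMatrix A c) {u v : Fin M} (huv : u ≠ v) {κ : ℝ} (hκ : |κ| ≤ 1) :
    IsDeadMatrix (A \ {u, v}) (annihilate A c u v κ) where
  antisymm a b := by
    unfold Herman.annihilate
    by_cases h1 : a = u ∧ b = v
    · obtain ⟨rfl, rfl⟩ := h1
      simp [huv.symm]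
    by_cases h2 : a = v ∧ b = u
    · obtain ⟨rfl, rfl⟩ := h2
      simp [huv.symm]
    rw [if_neg h1, if_neg h2, if_neg fun h : b = u ∧ a = v => h2 h.symm,
      if_neg fun h : b = v ∧ a = u => h1 h.symm]
    by_cases h3 : a ∈ A ∨ b ∈ A
    · rw [if_pos h3, if_pos h3.symm, neg_zero]
    · rw [if_neg h3, if_neg fun h : b ∈ A ∨ a ∈ A => h3 h.symm, hc.antisymm]
  abs_le a b := by
    unfold Herman.annihilate
    split_ifs
    · exact hκ
    · rwa [abs_neg]
    · simp
    · exact hc.abs_le a b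
  cross a b ha hb := by
    simp only [Finset.mem_sdiff, Finset.mem_insert, Finset.mem_singleton, not_or] at ha
    unfold Herman.annihilate
    rw [if_neg fun h => ha.2.1 h.1, if_neg fun h => ha.2.2 h.1, if_pos (Or.inl ha.1)]

/-- This identifies annihilation with isolation: moving `u` and `v` from the live to the recorded
part, with their mutual entry kept, changes the state matrix exactly as `isolate` does. -/
theorem stateMatrix_annihilate {A : Finset (Fin M)} {c f : Fin M → Fin M → ℝ}
    (hc : IsDeadMatrix A c) (hf : ∀ a b, f a b = -f b a) {u v : Fin M} (hu : u ∈ A) (hv : v ∈ A) :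
    stateMatrix (A \ {u, v}) (annihilate A c u v (f u v)) f =
      isolate (stateMatrix A c f) u v := by
  have hdiag : ∀ a, f a a = 0 := fun a => by linarith [hf a a]
  funext a b
  simp only [stateMatrix, annihilate, isolate, Finset.mem_sdiff, Finset.mem_insert,
    Finset.mem_singleton]
  by_cases ha : a = u ∨ a = v
  · have haA : a ∈ A := by rcases ha with rfl | rfl <;> assumption
    rw [if_neg (by tauto)]
    by_cases hb : b = u ∨ b = v
    · have hbA : b ∈ A := by rcases hb with rfl | rfl <;> assumption
      rw [if_pos (iff_of_true ha hb), if_pos (⟨haA, hbA⟩ : a ∈ A ∧ b ∈ A)]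
      by_cases h1 : a = u ∧ b = v
      · rw [if_pos h1, h1.1, h1.2]
      rw [if_neg h1]
      by_cases h2 : a = v ∧ b = u
      · rw [if_pos h2, h2.1, h2.2, hf u v, neg_neg]
      rw [if_neg h2, if_pos (Or.inl haA)]
      have hab : a = b := by
        rcases ha with rfl | rfl <;> rcases hb with rfl | rfl <;> tauto
      rw [hab, hdiag]
    · rw [if_neg (by tauto), if_neg (by tauto), if_pos (Or.inl haA), if_neg (by tauto)]
  · rw [not_or] at ha
    rw [if_neg fun h : a = u ∧ b = v => ha.1 h.1, if_neg fun h : a = v ∧ b = u => ha.2 h.1]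
    by_cases hb : b = u ∨ b = v
    · have hbA : b ∈ A := by rcases hb with rfl | rfl <;> assumption
      rw [if_neg (by tauto), if_pos (Or.inr hbA), if_neg (by tauto)]
    · rw [not_or] at hb
      by_cases h : a ∈ A ∧ b ∈ A
      · simp [h, ha, hb]
      · rw [if_neg fun h' => h ⟨h'.1.1, h'.2.1⟩,
          if_pos (iff_of_false (not_or.2 ha) (not_or.2 hb)), if_neg h]
        by_cases haA : a ∈ A
        · rw [if_pos (Or.inl haA), hc.cross a b haA (by tauto)]
        · by_cases hbA : b ∈ A
          · rw [if_pos (Or.inr hbA), hc.cross' haA hbA]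
          · rw [if_neg (by tauto)]

/-- Agreement of the rows is needed on live tokens only, because `c` does not link live tokens with
others. -/
theorem pairingSum_annihilate {A : Finset (Fin (2 * m + 1))}
    {c f : Fin (2 * m + 1) → Fin (2 * m + 1) → ℝ}
    (hc : IsDeadMatrix A c) (hf : ∀ a b, f a b = -f b a) {u v : Fin (2 * m + 1)} (huv : u ≠ v)
    (hu : u ∈ A) (hv : v ∈ A) (hrow : ∀ b ∈ A, b ≠ u → b ≠ v → f u b = f v b) :
    pairingSum (stateMatrix (A \ {u, v}) (annihilate A c u v (f u v)) f) =
      pairingSum (stateMatrix A c f) := by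
  rw [stateMatrix_annihilate hc hf hu hv,
    pairingSum_isolate (stateMatrix_antisymm hc hf) huv]
  intro b hbu hbv
  unfold stateMatrix
  by_cases hb : b ∈ A
  · rw [if_pos ⟨hu, hb⟩, if_pos ⟨hv, hb⟩, hrow b hb hbu hbv]
  · rw [if_neg fun h => hb h.2, if_neg fun h => hb h.2, hc.cross u b hu hb, hc.cross v b hv hb]

end SignMatrices

/-! ### Deterministic properties of the collision times -/

section Paths

/-- Common form of all hitting times below: what cannot happen before `s` can be timed from `s` on.
-/
theorem iInf_coe_eq_add_iInf {p q : ℝ≥0 → Prop} {s : ℝ≥0} (hlt : ∀ t < s, ¬p t)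
    (hpq : ∀ t, p (s + t) ↔ q t) :
    ⨅ (t : ℝ≥0) (_ : p t), (t : ℝ≥0∞) = s + ⨅ (t : ℝ≥0) (_ : q t), (t : ℝ≥0∞) := by
  simp only [ENNReal.add_iInf]
  refine le_antisymm (le_iInf₂ fun t ht => ?_) (le_iInf₂ fun t ht => ?_)
  · refine (iInf₂_le (s + t) ((hpq t).2 ht)).trans ?_
    rw [ENNReal.coe_add]
  · have hst : s ≤ t := not_lt.1 fun h => hlt t h ht
    obtain ⟨r, rfl⟩ := exists_add_of_le hst
    exact (iInf₂_le r ((hpq r).1 ht)).trans (by rw [ENNReal.coe_add])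

variable {M : ℕ} {N : ℕ} {z : Fin M → ℕ} {x x' : Fin M → ℝ≥0 → ℕ} {s : ℝ≥0} {e : Fin M → ℕ}

/-- In `x` nobody moves before time `s`, where the jumps `e` occur; `x'` describes what happens
from then on. -/
structure IsFirstJump (x x' : Fin M → ℝ≥0 → ℕ) (s : ℝ≥0) (e : Fin M → ℕ) : Prop where
  before : ∀ i, ∀ t < s, x i t = 0
  after : ∀ i t, x i (s + t) = e i + x' i t

/-- No two tokens of `A` have the same processor in the configuration `z`. -/
def IsFree (N : ℕ) (z : Fin M → ℕ) (A : Finset (Fin M)) : Prop :=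
  ∀ i ∈ A, ∀ j ∈ A, i ≠ j → ¬z i ≡ z j [MOD N]

theorem IsFirstJump.meet_after (h : IsFirstJump x x' s e) (i j : Fin M) (t : ℝ≥0) :
    Meet N z x i j (s + t) ↔ Meet N (z + e) x' i j t := by
  simp only [Meet, h.after, Pi.add_apply, add_assoc]

theorem IsFirstJump.meet_before (h : IsFirstJump x x' s e) {i j : Fin M} {t : ℝ≥0} (ht : t < s) :
    Meet N z x i j t ↔ z i ≡ z j [MOD N] := by
  simp only [Meet, h.before i t ht, h.before j t ht, add_zero]

theorem IsFirstJump.nextCollision_add (h : IsFirstJump x x' s e) (A : Finset (Fin M)) (r : ℝ≥0∞) :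
    nextCollision N z x A (s + r) = s + nextCollision N (z + e) x' A r := by
  refine iInf_coe_eq_add_iInf (fun t ht hp => ?_) fun t => ?_
  · exact absurd ((le_self_add.trans hp.1)) (not_le.2 (ENNReal.coe_lt_coe.2 ht))
  · simp only [h.meet_after, ENNReal.coe_add]
    rw [ENNReal.add_le_add_iff_left ENNReal.coe_ne_top]

theorem IsFirstJump.nextCollision_zero (h : IsFirstJump x x' s e) {A : Finset (Fin M)}
    (hA : IsFree N z A) :
    nextCollision N z x A 0 = s + nextCollision N (z + e) x' A 0 := by
  refine iInf_coe_eq_add_iInf (fun t ht hp => ?_) fun t => ?_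
  · obtain ⟨-, i, hi, j, hj, hij, hm⟩ := hp
    exact hA i hi j hj hij ((h.meet_before ht).1 hm)
  · simp only [h.meet_after, zero_le]

theorem IsFirstJump.survivors_add (h : IsFirstJump x x' s e) (A : Finset (Fin M)) (t : ℝ≥0) :
    survivors N z x A (s + t) = survivors N (z + e) x' A t := by
  ext i
  simp only [survivors, Finset.mem_filter, h.meet_after]

open Classical in
/-- The evolution of the system that starts with the tokens of `A`. -/
noncomputable def stageFrom (N : ℕ) (z : Fin M → ℕ) (x : Fin M → ℝ≥0 → ℕ) (A : Finset (Fin M)) :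
    ℕ → ℝ≥0∞ × Finset (Fin M)
  | 0 => (0, A)
  | n + 1 =>
    let s := stageFrom N z x A n
    let t := nextCollision N z x s.2 s.1
    (t, if t = ⊤ then s.2 else survivors N z x s.2 t.toNNReal)

/-- The time until only one of the tokens of `A` is left. -/
noncomputable def stabFrom (N : ℕ) (z : Fin M → ℕ) (x : Fin M → ℝ≥0 → ℕ) (A : Finset (Fin M)) :
    ℝ≥0∞ :=
  ⨅ (n : ℕ) (_ : (stageFrom N z x A n).2.card = 1), (stageFrom N z x A n).1

theorem stage_eq_stageFrom (N : ℕ) (z : Fin M → ℕ) (x : Fin M → ℝ≥0 → ℕ) (n : ℕ) :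
    stage N z x n = stageFrom N z x Finset.univ n := by
  induction n with
  | zero => rfl
  | succ n ih => simp only [stage, stageFrom, ih]

theorem stabTime_eq_stabFrom (N : ℕ) (z : Fin M → ℕ) (x : Fin M → ℝ≥0 → ℕ) :
    stabTime N z x = stabFrom N z x Finset.univ := by
  simp only [stabTime, stabFrom, stage_eq_stageFrom]

/-- Stage `0` is at time `0` in both systems, so only the stages from the first collision on are
delayed by `s`. Freeness excludes collisions before the jump. -/
theorem IsFirstJump.stageFrom_succ (h : IsFirstJump x x' s e) {A : Finset (Fin M)}
    (hA : IsFree N z A) (n : ℕ) :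
    stageFrom N z x A (n + 1) = (s + (stageFrom N (z + e) x' A (n + 1)).1,
      (stageFrom N (z + e) x' A (n + 1)).2) := by
  have step : ∀ (B : Finset (Fin M)) (t t' : ℝ≥0∞), t = s + t' →
      (t, if t = ⊤ then B else survivors N z x B t.toNNReal) =
      (s + t', if t' = ⊤ then B else survivors N (z + e) x' B t'.toNNReal) := by
    rintro B t t' rfl
    by_cases ht : t' = ⊤
    · simp [ht]
    · have : ((s : ℝ≥0∞) + t').toNNReal = s + t'.toNNReal := by
        rw [ENNReal.toNNReal_add ENNReal.coe_ne_top ht, ENNReal.toNNReal_coe]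
      rw [if_neg ht, if_neg (by simp [ht]), this, h.survivors_add]
  induction n with
  | zero => exact step A _ _ (h.nextCollision_zero hA)
  | succ n ih =>
    rw [stageFrom, ih, stageFrom.eq_2 N (z + e) x' A (n + 1)]
    exact step _ _ _ (h.nextCollision_add _ _)

theorem IsFirstJump.stabFrom_eq (h : IsFirstJump x x' s e) {A : Finset (Fin M)}
    (hA : IsFree N z A) (hcard : A.card ≠ 1) :
    stabFrom N z x A = s + stabFrom N (z + e) x' A := by
  simp only [stabFrom, ENNReal.add_iInf]
  refine le_antisymm (le_iInf₂ fun n hn => ?_) (le_iInf₂ fun n hn => ?_)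
  · cases n with
    -- Stage `0`, the only one that is not delayed, does not count because more or fewer than one
    -- token is present.
    | zero => exact absurd hn hcard
    | succ n =>
      have := h.stageFrom_succ hA n
      refine (iInf₂_le (n + 1) (by rw [this]; exact hn)).trans ?_
      rw [this]
  · cases n with
    | zero => exact absurd hn hcard
    | succ n =>
      have := h.stageFrom_succ hA n
      rw [this] at hn ⊢
      exact iInf₂_le (n + 1) hn

theorem stabFrom_of_card_eq_one {A : Finset (Fin M)} (hA : A.card = 1) : stabFrom N z x A = 0 :=
  le_antisymm (iInf₂_le 0 hA) (zero_le)

open Classical in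
/-- The tokens of `A` that share their processor in the configuration `z` with no other token of
`A`. -/
noncomputable def settle (N : ℕ) (z : Fin M → ℕ) (A : Finset (Fin M)) : Finset (Fin M) :=
  A.filter fun i => ∀ j ∈ A, j ≠ i → ¬z i ≡ z j [MOD N]

theorem settle_eq_self {A : Finset (Fin M)} (hA : IsFree N z A) : settle N z A = A :=
  Finset.filter_true_of_mem fun i hi j hj hji => hA i hi j hj hji.symm

/-- If some tokens share a processor initially, the first collision event is at time `0` and leaves
`settle N z A`. The stages are renumbered by one without any delay. -/
theorem stabFrom_settle (hx : ∀ i, x i 0 = 0) (A : Finset (Fin M)) :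
    stabFrom N z x A = stabFrom N z x (settle N z A) := by
  by_cases hA : IsFree N z A
  · rw [settle_eq_self hA]
  have hmeet : ∀ i j, Meet N z x i j 0 ↔ z i ≡ z j [MOD N] := by simp [Meet, hx]
  have hcard : A.card ≠ 1 := by
    intro h1
    obtain ⟨a, rfl⟩ := Finset.card_eq_one.1 h1
    refine hA fun i hi j hj hij => ?_
    rw [Finset.mem_singleton] at hi hj
    exact absurd (hi.trans hj.symm) hij
  have hnext : nextCollision N z x A 0 = 0 := by
    unfold IsFree at hA
    push Not at hA
    obtain ⟨i, hi, j, hj, hij, hm⟩ := hA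
    refine le_antisymm ((iInf₂_le 0 ⟨by simp, i, hi, j, hj, hij, (hmeet i j).2 hm⟩).trans ?_)
      (zero_le)
    simp
  have hstage : ∀ n, stageFrom N z x A (n + 1) = stageFrom N z x (settle N z A) n := by
    intro n
    induction n with
    | zero =>
      simp only [stageFrom, hnext, ENNReal.zero_ne_top, if_false, ENNReal.toNNReal_zero,
        survivors, hmeet, settle]
    | succ n ih => rw [stageFrom, ih, ← stageFrom.eq_2]
  refine le_antisymm (le_iInf₂ fun n hn => ?_) (le_iInf₂ fun n hn => ?_)
  · rw [← hstage] at hn ⊢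
    exact iInf₂_le (n + 1) hn
  · cases n with
    | zero => exact absurd hn hcard
    | succ n =>
      rw [hstage] at hn ⊢
      exact iInf₂_le n hn

end Paths

/-! ### A system of two tokens -/

section Pair

variable {N a b ea eb : ℕ} {x y x' y' : ℝ≥0 → ℕ} {s t : ℝ≥0}

/-- The collision time of two tokens with the initial positions `a`, `b` and the paths `x`, `y`. -/
noncomputable def meetTime (N a b : ℕ) (x y : ℝ≥0 → ℕ) : ℝ≥0∞ :=
  ⨅ (t : ℝ≥0) (_ : a + x t ≡ b + y t [MOD N]), (t : ℝ≥0∞)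

/-- The two tokens collide and the first one has then an advance of `k` on the second one. -/
def MeetsWith (N a b : ℕ) (x y : ℝ≥0 → ℕ) (k : ℕ) : Prop :=
  ∃ t : ℝ≥0, meetTime N a b x y = t ∧ a + x t + k = b + y t

open Classical in
/-- `1` if `p` holds and `0` otherwise. -/
noncomputable def propIndicator (p : Prop) : ℝ := if p then 1 else 0

theorem propIndicator_of_true {p : Prop} (hp : p) : propIndicator p = 1 := if_pos hp

theorem propIndicator_of_false {p : Prop} (hp : ¬p) : propIndicator p = 0 := if_neg hp

theorem propIndicator_nonneg (p : Prop) : 0 ≤ propIndicator p := by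
  unfold propIndicator
  split_ifs <;> norm_num

theorem propIndicator_le_one (p : Prop) : propIndicator p ≤ 1 := by
  unfold propIndicator
  split_ifs <;> norm_num

/-- `1` if the tokens have collided down up to time `t`, `-1` if they have collided up, and `0`
otherwise. -/
noncomputable def collisionSign (N a b : ℕ) (x y : ℝ≥0 → ℕ) (t : ℝ≥0) : ℝ :=
  propIndicator (meetTime N a b x y ≤ t ∧ MeetsWith N a b x y 0) -
    propIndicator (meetTime N a b x y ≤ t ∧ MeetsWith N a b x y N)

theorem abs_collisionSign_le (N a b : ℕ) (x y : ℝ≥0 → ℕ) (t : ℝ≥0) :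
    |collisionSign N a b x y t| ≤ 1 := by
  unfold collisionSign
  rw [abs_le]
  constructor <;>
    linarith [propIndicator_nonneg (meetTime N a b x y ≤ t ∧ MeetsWith N a b x y 0),
      propIndicator_nonneg (meetTime N a b x y ≤ t ∧ MeetsWith N a b x y N),
      propIndicator_le_one (meetTime N a b x y ≤ t ∧ MeetsWith N a b x y 0),
      propIndicator_le_one (meetTime N a b x y ≤ t ∧ MeetsWith N a b x y N)]

theorem meetTime_first_jump (hx : ∀ t < s, x t = 0) (hy : ∀ t < s, y t = 0)
    (hx' : ∀ t, x (s + t) = ea + x' t) (hy' : ∀ t, y (s + t) = eb + y' t)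
    (hab : ¬a ≡ b [MOD N]) :
    meetTime N a b x y = s + meetTime N (a + ea) (b + eb) x' y' := by
  refine iInf_coe_eq_add_iInf (fun t ht hp => ?_) fun t => ?_
  · rw [hx t ht, hy t ht] at hp
    exact hab hp
  · rw [hx', hy', add_assoc, add_assoc]

theorem meetsWith_first_jump (hx : ∀ t < s, x t = 0) (hy : ∀ t < s, y t = 0)
    (hx' : ∀ t, x (s + t) = ea + x' t) (hy' : ∀ t, y (s + t) = eb + y' t)
    (hab : ¬a ≡ b [MOD N]) (k : ℕ) :
    MeetsWith N a b x y k ↔ MeetsWith N (a + ea) (b + eb) x' y' k := by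
  unfold MeetsWith
  rw [meetTime_first_jump hx hy hx' hy' hab]
  constructor
  · rintro ⟨t, ht, he⟩
    have hst : s ≤ t := by
      rw [← ENNReal.coe_le_coe, ← ht]
      exact le_self_add
    obtain ⟨r, rfl⟩ := exists_add_of_le hst
    refine ⟨r, ?_, ?_⟩
    · rw [ENNReal.coe_add] at ht
      exact (ENNReal.add_right_inj ENNReal.coe_ne_top).1 ht
    · rw [hx', hy'] at he
      omega
  · rintro ⟨t, ht, he⟩
    refine ⟨s + t, by rw [ht, ENNReal.coe_add], ?_⟩
    rw [hx', hy']
    omega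

theorem collisionSign_first_jump (hx : ∀ t < s, x t = 0) (hy : ∀ t < s, y t = 0)
    (hx' : ∀ t, x (s + t) = ea + x' t) (hy' : ∀ t, y (s + t) = eb + y' t)
    (hab : ¬a ≡ b [MOD N]) (t : ℝ≥0) :
    collisionSign N a b x y t =
      if s ≤ t then collisionSign N (a + ea) (b + eb) x' y' (t - s) else 0 := by
  unfold collisionSign
  simp only [meetsWith_first_jump hx hy hx' hy' hab, meetTime_first_jump hx hy hx' hy' hab]
  by_cases hst : s ≤ t
  · rw [if_pos hst]
    obtain ⟨r, rfl⟩ := exists_add_of_le hst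
    simp only [add_tsub_cancel_left, ENNReal.coe_add,
      ENNReal.add_le_add_iff_left ENNReal.coe_ne_top]
  · have : ¬(s : ℝ≥0∞) + meetTime N (a + ea) (b + eb) x' y' ≤ t := fun h =>
      hst (ENNReal.coe_le_coe.1 (le_self_add.trans h))
    simp [hst, this, propIndicator]

theorem collisionSign_of_meet (hx : x 0 = 0) (hy : y 0 = 0) (hab : a ≡ b [MOD N]) (t : ℝ≥0) :
    collisionSign N a b x y t = propIndicator (a = b) - propIndicator (a + N = b) := by
  have h0 : meetTime N a b x y = 0 := by
    refine le_antisymm ((iInf₂_le 0 (by simpa [hx, hy] using hab)).trans ?_) (zero_le)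
    simp
  have hk : ∀ k, MeetsWith N a b x y k ↔ a + k = b := by
    intro k
    unfold MeetsWith
    rw [h0]
    constructor
    · rintro ⟨t, ht, he⟩
      have : t = 0 := by simpa using ht.symm
      subst this
      simpa [hx, hy] using he
    · intro h
      exact ⟨0, by simp, by simpa [hx, hy] using h⟩
  unfold collisionSign
  simp [hk, h0]

/-- Placing the first token a full turn ahead leaves all processors unchanged but exchanges the
collisions down and up. This symmetry makes the rows agree for two tokens that have met around the
ring. -/
theorem collisionSign_swap (N a b : ℕ) (x y : ℝ≥0 → ℕ) (t : ℝ≥0) :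
    collisionSign N b (a + N) y x t = -collisionSign N a b x y t := by
  have ht : meetTime N b (a + N) y x = meetTime N a b x y := by
    have : ∀ t, (b + y t ≡ a + N + x t [MOD N]) ↔ (a + x t ≡ b + y t [MOD N]) := by
      intro t
      rw [Nat.ModEq.comm, show a + N + x t = a + x t + N by ring]
      simp [Nat.ModEq]
    simp only [meetTime, this]
  have h1 : MeetsWith N b (a + N) y x 0 ↔ MeetsWith N a b x y N := by
    unfold MeetsWith
    rw [ht]
    exact exists_congr fun t => and_congr_right fun _ => by omega
  have h2 : MeetsWith N b (a + N) y x N ↔ MeetsWith N a b x y 0 := by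
    unfold MeetsWith
    rw [ht]
    exact exists_congr fun t => and_congr_right fun _ => by omega
  unfold collisionSign
  simp only [ht, h1, h2]
  ring

end Pair

/-! ### Measurability of the collision times -/

section Measurability

variable {Ω : Type*} [MeasurableSpace Ω]

/-- The path `x` is constant on a right neighbourhood of each time. -/
def IsRightConstant {α : Type*} (x : ℝ≥0 → α) : Prop :=
  ∀ t, ∃ δ > 0, ∀ t', t ≤ t' → t' < t + δ → x t' = x t

theorem IsRightConstant.comp₂ {α β γ : Type*} {x : ℝ≥0 → α} {y : ℝ≥0 → β}
    (hx : IsRightConstant x) (hy : IsRightConstant y) (f : α → β → γ) :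
    IsRightConstant fun t => f (x t) (y t) := by
  intro t
  obtain ⟨δ, hδ, h⟩ := hx t
  obtain ⟨δ', hδ', h'⟩ := hy t
  refine ⟨min δ δ', lt_min hδ hδ', fun t' h1 h2 => ?_⟩
  beta_reduce
  rw [h t' h1 (h2.trans_le (by gcongr; exact min_le_left _ _)),
    h' t' h1 (h2.trans_le (by gcongr; exact min_le_right _ _))]

theorem IsRightConstant.exists_finset {M : ℕ} {p : Fin M → Fin M → ℝ≥0 → Prop}
    (hp : ∀ i j, IsRightConstant (p i j)) (A : Finset (Fin M)) :
    IsRightConstant fun t => ∃ i ∈ A, ∃ j ∈ A, i ≠ j ∧ p i j t := by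
  intro t
  choose δ hδ h using fun i j => hp i j t
  by_cases hM : M = 0
  · subst hM
    exact ⟨1, one_pos, fun t' _ _ => propext (exists_congr fun i => i.elim0)⟩
  have : NeZero M := ⟨hM⟩
  have hne : (Finset.univ : Finset (Fin M × Fin M)).Nonempty := ⟨(0, 0), Finset.mem_univ _⟩
  refine ⟨Finset.univ.inf' hne fun q => δ q.1 q.2, ?_, fun t' h1 h2 => ?_⟩
  · exact (Finset.lt_inf'_iff hne).2 fun q _ => hδ q.1 q.2
  · have : ∀ i j, p i j t' = p i j t := fun i j =>
      h i j t' h1 (h2.trans_le (by gcongr; exact Finset.inf'_le _ (Finset.mem_univ (i, j))))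
    simp only [this]

theorem exists_denseSeq_btwn {t t' : ℝ≥0} (h : t < t') :
    ∃ n, t < TopologicalSpace.denseSeq ℝ≥0 n ∧ TopologicalSpace.denseSeq ℝ≥0 n < t' := by
  obtain ⟨_, ⟨n, rfl⟩, h1, h2⟩ := (TopologicalSpace.denseRange_denseSeq ℝ≥0).exists_between h
  exact ⟨n, h1, h2⟩

/-- A property that holds at `t` persists for a while, so it holds at elements of a countable dense
set arbitrarily close to the right of `t`. The infimum may be taken over that set. -/
theorem measurable_iInf_time {r : Ω → ℝ≥0∞} {p : Ω → ℝ≥0 → Prop} (hr : Measurable r)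
    (hp : ∀ t, MeasurableSet {ω | p ω t}) (hc : ∀ ω, IsRightConstant (p ω)) :
    Measurable fun ω => ⨅ (t : ℝ≥0) (_ : r ω ≤ t ∧ p ω t), (t : ℝ≥0∞) := by
  classical
  let q := TopologicalSpace.denseSeq ℝ≥0
  have heq : (fun ω => ⨅ (t : ℝ≥0) (_ : r ω ≤ t ∧ p ω t), (t : ℝ≥0∞)) =
      fun ω => ⨅ n, if r ω ≤ q n ∧ p ω (q n) then (q n : ℝ≥0∞) else ⊤ := by
    funext ω
    refine le_antisymm (le_iInf fun n => ?_) (le_iInf₂ fun t ht => ?_)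
    · split_ifs with h
      · exact iInf₂_le (q n) h
      · exact le_top
    · refine ENNReal.le_of_forall_pos_le_add fun ε hε _ => ?_
      obtain ⟨δ, hδ, h⟩ := hc ω t
      obtain ⟨n, h1, h2⟩ := exists_denseSeq_btwn
        (show t < t + min δ ε from lt_add_of_pos_right t (lt_min hδ hε))
      have hpn : p ω (q n) :=
        (h _ h1.le (h2.trans_le (by gcongr; exact min_le_left _ _))).symm ▸ ht.2
      have hrn : r ω ≤ q n := ht.1.trans (ENNReal.coe_le_coe.2 h1.le)
      refine (iInf_le _ n).trans ?_
      rw [if_pos ⟨hrn, hpn⟩, ← ENNReal.coe_add, ENNReal.coe_le_coe]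
      exact (h2.trans_le (by gcongr; exact min_le_right _ _)).le
  rw [heq]
  refine Measurable.iInf fun n => Measurable.ite ?_ measurable_const measurable_const
  exact (measurableSet_le hr measurable_const).inter (hp (q n))

/-- By right constancy, the property at time `T` is equivalent to its validity at times of a
countable dense set arbitrarily close to the right of `T`. -/
theorem measurableSet_at_time {T : Ω → ℝ≥0} {p : Ω → ℝ≥0 → Prop} (hT : Measurable T)
    (hp : ∀ t, MeasurableSet {ω | p ω t}) (hc : ∀ ω, IsRightConstant (p ω)) :
    MeasurableSet {ω | p ω (T ω)} := by
  let q := TopologicalSpace.denseSeq ℝ≥0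
  have heq : {ω | p ω (T ω)} = ⋂ k : ℕ, ⋃ n : ℕ,
      ({ω | T ω < q n} ∩ {ω | q n < T ω + 1 / ((k : ℝ≥0) + 1)}) ∩ {ω | p ω (q n)} := by
    ext ω
    simp only [Set.mem_iInter, Set.mem_iUnion, Set.mem_inter_iff, Set.mem_ofPred_eq]
    obtain ⟨δ, hδ, h⟩ := hc ω (T ω)
    constructor
    · intro hpT k
      have hk : (0 : ℝ≥0) < 1 / ((k : ℝ≥0) + 1) := by positivity
      obtain ⟨n, h1, h2⟩ := exists_denseSeq_btwn
        (show T ω < T ω + min δ (1 / ((k : ℝ≥0) + 1)) from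
          lt_add_of_pos_right _ (lt_min hδ hk))
      refine ⟨n, ⟨h1, h2.trans_le (by gcongr; exact min_le_right _ _)⟩, ?_⟩
      exact (h _ h1.le (h2.trans_le (by gcongr; exact min_le_left _ _))).symm ▸ hpT
    · intro hk
      obtain ⟨k, hkδ⟩ := exists_nat_one_div_lt hδ
      obtain ⟨n, ⟨h1, h2⟩, h3⟩ := hk k
      exact (h _ h1.le (h2.trans (by gcongr))) ▸ h3
  rw [heq]
  refine MeasurableSet.iInter fun k => MeasurableSet.iUnion fun n =>
    (MeasurableSet.inter ?_ ?_).inter (hp _)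
  · exact measurableSet_lt hT measurable_const
  · exact measurableSet_lt measurable_const (hT.add_const _)

/-- Used with `g` the random set of present tokens, which can be treated as constant on each of its
level sets. -/
theorem measurable_comp_countable {β γ : Type*} [Countable β] [MeasurableSpace γ] {g : Ω → β}
    (hg : ∀ b, MeasurableSet {ω | g ω = b}) {F : β → Ω → γ} (hF : ∀ b, Measurable (F b)) :
    Measurable fun ω => F (g ω) ω := by
  intro S hS
  have : (fun ω => F (g ω) ω) ⁻¹' S = ⋃ b, {ω | g ω = b} ∩ F b ⁻¹' S := by
    ext ω
    simp
  rw [this]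
  exact MeasurableSet.iUnion fun b => (hg b).inter (hF b hS)

/-! ### Measurability for the system of all tokens -/

section System

variable {M : ℕ} {N : ℕ} {z : Fin M → ℕ} {x : Ω → Fin M → ℝ≥0 → ℕ}

theorem measurableSet_meet (hx : ∀ i t, Measurable fun ω => x ω i t) (i j : Fin M) (t : ℝ≥0) :
    MeasurableSet {ω | Meet N z (x ω) i j t} := by
  have : Measurable fun ω => (x ω i t, x ω j t) := (hx i t).prodMk (hx j t)
  exact this (MeasurableSet.of_discrete (s := {q : ℕ × ℕ | z i + q.1 ≡ z j + q.2 [MOD N]}))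

theorem isRightConstant_meet {x : Fin M → ℝ≥0 → ℕ} (hc : ∀ i, IsRightConstant (x i))
    (i j : Fin M) : IsRightConstant (Meet N z x i j) :=
  (hc i).comp₂ (hc j) fun k l => z i + k ≡ z j + l [MOD N]

theorem measurable_nextCollision (hx : ∀ i t, Measurable fun ω => x ω i t)
    (hc : ∀ ω i, IsRightConstant (x ω i)) (A : Finset (Fin M)) {r : Ω → ℝ≥0∞}
    (hr : Measurable r) : Measurable fun ω => nextCollision N z (x ω) A (r ω) := by
  refine measurable_iInf_time hr (fun t => ?_) fun ω =>
    IsRightConstant.exists_finset (fun i j => isRightConstant_meet (hc ω) i j) A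
  have : {ω | ∃ i ∈ A, ∃ j ∈ A, i ≠ j ∧ Meet N z (x ω) i j t} =
      ⋃ i ∈ A, ⋃ j ∈ A, ⋃ (_ : i ≠ j), {ω | Meet N z (x ω) i j t} := by
    ext ω
    simp only [Set.mem_ofPred_eq, Set.mem_iUnion, exists_prop]
  rw [this]
  exact Finset.measurableSet_biUnion _ fun i _ => Finset.measurableSet_biUnion _ fun j _ =>
    MeasurableSet.iUnion fun _ => measurableSet_meet hx i j t

theorem measurableSet_survivors (hx : ∀ i t, Measurable fun ω => x ω i t)
    (hc : ∀ ω i, IsRightConstant (x ω i)) (A B : Finset (Fin M)) {T : Ω → ℝ≥0}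
    (hT : Measurable T) : MeasurableSet {ω | survivors N z (x ω) A (T ω) = B} := by
  have hm : ∀ i j, Measurable fun ω => Meet N z (x ω) i j (T ω) := fun i j =>
    measurableSet_setOfPred.1 (measurableSet_at_time hT (measurableSet_meet hx i j)
      fun ω => isRightConstant_meet (hc ω) i j)
  simp only [Finset.ext_iff, survivors, Finset.mem_filter]
  refine measurableSet_setOfPred.2 (Measurable.forall fun i => Measurable.iff
    (measurable_const.and (Measurable.forall fun j => measurable_const.imp
      (measurable_const.imp (hm i j).not))) measurable_const)

theorem measurable_stageFrom (hx : ∀ i t, Measurable fun ω => x ω i t)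
    (hc : ∀ ω i, IsRightConstant (x ω i)) (A : Finset (Fin M)) (n : ℕ) :
    (Measurable fun ω => (stageFrom N z (x ω) A n).1) ∧
      ∀ B, MeasurableSet {ω | (stageFrom N z (x ω) A n).2 = B} := by
  induction n with
  | zero => exact ⟨measurable_const, fun B => MeasurableSet.const (A = B)⟩
  | succ n ih =>
    obtain ⟨ih1, ih2⟩ := ih
    have hT : Measurable fun ω => (stageFrom N z (x ω) A (n + 1)).1 :=
      measurable_comp_countable ih2
        (F := fun B ω => nextCollision N z (x ω) B (stageFrom N z (x ω) A n).1)
        fun B => measurable_nextCollision hx hc B ih1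
    refine ⟨hT, fun B => measurableSet_setOfPred.2 ?_⟩
    refine measurable_comp_countable ih2 (F := fun B' ω =>
      (if (stageFrom N z (x ω) A (n + 1)).1 = ⊤ then B' else
        survivors N z (x ω) B' (stageFrom N z (x ω) A (n + 1)).1.toNNReal) = B) fun B' => ?_
    have h1 : Measurable fun ω => (stageFrom N z (x ω) A (n + 1)).1 = ⊤ :=
      measurableSet_setOfPred.1 (hT (measurableSet_singleton ⊤))
    have h2 := measurableSet_setOfPred.1 (measurableSet_survivors (N := N) (z := z) hx hc B' B
      hT.ennreal_toNNReal)
    have heq : ∀ ω, ((if (stageFrom N z (x ω) A (n + 1)).1 = ⊤ then B' else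
        survivors N z (x ω) B' (stageFrom N z (x ω) A (n + 1)).1.toNNReal) = B) ↔
        ((stageFrom N z (x ω) A (n + 1)).1 = ⊤ ∧ B' = B) ∨
        (¬(stageFrom N z (x ω) A (n + 1)).1 = ⊤ ∧
          survivors N z (x ω) B' (stageFrom N z (x ω) A (n + 1)).1.toNNReal = B) := by
      intro ω
      split_ifs with h <;> simp [h]
    simp only [heq]
    exact (h1.and measurable_const).or (h1.not.and h2)

theorem measurable_stabFrom (hx : ∀ i t, Measurable fun ω => x ω i t)
    (hc : ∀ ω i, IsRightConstant (x ω i)) (A : Finset (Fin M)) :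
    Measurable fun ω => stabFrom N z (x ω) A := by
  classical
  refine Measurable.iInf fun n => ?_
  obtain ⟨h1, h2⟩ := measurable_stageFrom (N := N) (z := z) hx hc A n
  simp only [iInf_eq_if]
  refine Measurable.ite ?_ h1 measurable_const
  exact measurableSet_setOfPred.2 (measurable_comp_countable h2
    (F := fun B (_ : Ω) => B.card = 1) fun B => measurable_const)

end System

/-! ### Measurability for two tokens -/

section Pair

variable {N a b : ℕ} {x y : Ω → ℝ≥0 → ℕ}

theorem measurable_meetTime (hx : ∀ t, Measurable fun ω => x ω t)
    (hy : ∀ t, Measurable fun ω => y ω t) (hcx : ∀ ω, IsRightConstant (x ω))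
    (hcy : ∀ ω, IsRightConstant (y ω)) : Measurable fun ω => meetTime N a b (x ω) (y ω) := by
  have := measurable_iInf_time (r := fun _ : Ω => (0 : ℝ≥0∞))
    (p := fun ω t => a + x ω t ≡ b + y ω t [MOD N]) measurable_const
    (fun t => ((hx t).prodMk (hy t))
      (MeasurableSet.of_discrete (s := {q : ℕ × ℕ | a + q.1 ≡ b + q.2 [MOD N]})))
    fun ω => (hcx ω).comp₂ (hcy ω) fun k l => a + k ≡ b + l [MOD N]
  simpa [meetTime] using this

theorem measurableSet_meetsWith (hx : ∀ t, Measurable fun ω => x ω t)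
    (hy : ∀ t, Measurable fun ω => y ω t) (hcx : ∀ ω, IsRightConstant (x ω))
    (hcy : ∀ ω, IsRightConstant (y ω)) (k : ℕ) :
    MeasurableSet {ω | MeetsWith N a b (x ω) (y ω) k} := by
  have hT := measurable_meetTime (N := N) (a := a) (b := b) hx hy hcx hcy
  have heq : {ω | MeetsWith N a b (x ω) (y ω) k} =
      {ω | meetTime N a b (x ω) (y ω) ≠ ⊤} ∩
      {ω | a + x ω (meetTime N a b (x ω) (y ω)).toNNReal + k =
        b + y ω (meetTime N a b (x ω) (y ω)).toNNReal} := by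
    ext ω
    simp only [MeetsWith, Set.mem_inter_iff, Set.mem_ofPred_eq]
    constructor
    · rintro ⟨t, ht, he⟩
      rw [ht]
      exact ⟨ENNReal.coe_ne_top, by simpa using he⟩
    · rintro ⟨h1, h2⟩
      exact ⟨_, (ENNReal.coe_toNNReal h1).symm, h2⟩
  rw [heq]
  refine (hT (measurableSet_singleton ⊤)).compl.inter ?_
  exact measurableSet_at_time (p := fun ω t => a + x ω t + k = b + y ω t) hT.ennreal_toNNReal
    (fun t => ((hx t).prodMk (hy t))
      (MeasurableSet.of_discrete (s := {q : ℕ × ℕ | a + q.1 + k = b + q.2})))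
    fun ω => (hcx ω).comp₂ (hcy ω) fun l l' => a + l + k = b + l'

theorem measurable_propIndicator {p : Ω → Prop} (hp : MeasurableSet {ω | p ω}) :
    Measurable fun ω => propIndicator (p ω) := by
  classical
  simp only [propIndicator]
  exact Measurable.ite hp measurable_const measurable_const

theorem measurable_collisionSign (hx : ∀ t, Measurable fun ω => x ω t)
    (hy : ∀ t, Measurable fun ω => y ω t) (hcx : ∀ ω, IsRightConstant (x ω))
    (hcy : ∀ ω, IsRightConstant (y ω)) :
    Measurable fun q : Ω × ℝ≥0 => collisionSign N a b (x q.1) (y q.1) q.2 := by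
  have hT := measurable_meetTime (N := N) (a := a) (b := b) hx hy hcx hcy
  have h1 : MeasurableSet {q : Ω × ℝ≥0 | meetTime N a b (x q.1) (y q.1) ≤ q.2} :=
    measurableSet_le (hT.comp measurable_fst) measurable_snd.coe_nnreal_ennreal
  have h2 : ∀ k, MeasurableSet {q : Ω × ℝ≥0 | MeetsWith N a b (x q.1) (y q.1) k} := fun k =>
    measurable_fst (measurableSet_meetsWith hx hy hcx hcy k)
  exact (measurable_propIndicator (h1.inter (h2 0))).sub
    (measurable_propIndicator (h1.inter (h2 N)))

end Pair

end Measurability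

/-! ### Configurations -/

section Configurations

variable {M N : ℕ} {z : Fin M → ℕ} {A : Finset (Fin M)}

theorem modEq_iff_of_le_of_le {a b : ℕ} (hN : 0 < N) (h1 : a ≤ b) (h2 : b ≤ a + N) :
    a ≡ b [MOD N] ↔ b = a ∨ b = a + N := by
  rw [Nat.modEq_iff_dvd' h1]
  constructor
  · rintro ⟨k, hk⟩
    rcases k with _ | _ | k
    · left; omega
    · right; omega
    · exfalso
      have : N * (k + 1 + 1) = N * k + N + N := by ring
      have := Nat.zero_le (N * k)
      omega
  · rintro (rfl | rfl)
    · simp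
    · simp

/-- The tokens of `A` have pairwise different processors and are met in their natural order when
one goes around the ring clockwise. -/
def IsOrdered (N : ℕ) (z : Fin M → ℕ) (A : Finset (Fin M)) : Prop :=
  ∀ i ∈ A, ∀ j ∈ A, i < j → z i < z j ∧ z j < z i + N

/-- Neighbouring tokens of `A` may have the same processor, but no three tokens have. -/
structure IsWeaklyOrdered (N : ℕ) (z : Fin M → ℕ) (A : Finset (Fin M)) : Prop where
  le : ∀ i ∈ A, ∀ j ∈ A, i < j → z i ≤ z j ∧ z j ≤ z i + N
  no_triple : ∀ i ∈ A, ∀ j ∈ A, ∀ k ∈ A, i ≠ j → j ≠ k → i ≠ k → z i ≡ z j [MOD N] →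
    ¬z j ≡ z k [MOD N]

theorem IsWeaklyOrdered.mono {B : Finset (Fin M)} (h : IsWeaklyOrdered N z A) (hBA : B ⊆ A) :
    IsWeaklyOrdered N z B where
  le i hi j hj := h.le i (hBA hi) j (hBA hj)
  no_triple i hi j hj k hk := h.no_triple i (hBA hi) j (hBA hj) k (hBA hk)

theorem IsOrdered.isFree (h : IsOrdered N z A) : IsFree N z A := by
  have key : ∀ i ∈ A, ∀ j ∈ A, i < j → ¬z i ≡ z j [MOD N] := by
    intro i hi j hj hij
    obtain ⟨h1, h2⟩ := h i hi j hj hij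
    rw [modEq_iff_of_le_of_le (by omega) h1.le h2.le]
    omega
  intro i hi j hj hij
  rcases lt_or_gt_of_ne hij with hlt | hlt
  · exact key i hi j hj hlt
  · exact fun hm => key j hj i hi hlt hm.symm

theorem IsWeaklyOrdered.isOrdered (hN : 0 < N) (h : IsWeaklyOrdered N z A) (hA : IsFree N z A) :
    IsOrdered N z A := by
  intro i hi j hj hij
  obtain ⟨h1, h2⟩ := h.le i hi j hj hij
  have := hA i hi j hj hij.ne
  rw [modEq_iff_of_le_of_le hN h1 h2] at this
  omega

/-- A processor can only be reached from itself and from its anticlockwise neighbour, each of which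
held at most one token. So no three tokens meet, and nobody is overtaken. -/
theorem IsOrdered.isWeaklyOrdered_add (hN : 0 < N) (h : IsOrdered N z A) {e : Fin M → ℕ}
    (he : ∀ i, e i ≤ 1) : IsWeaklyOrdered N (z + e) A := by
  have hle : ∀ i ∈ A, ∀ j ∈ A, i < j → (z + e) i ≤ (z + e) j ∧ (z + e) j ≤ (z + e) i + N := by
    intro i hi j hj hij
    have := h i hi j hj hij
    have := he i
    have := he j
    simp only [Pi.add_apply]
    omega
  have key : ∀ i ∈ A, ∀ j ∈ A, ∀ k ∈ A, i < j → j < k →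
      (z + e) i ≡ (z + e) j [MOD N] → ¬(z + e) j ≡ (z + e) k [MOD N] := by
    intro i hi j hj k hk hij hjk hm hm'
    have h1 := hle i hi j hj hij
    have h2 := hle j hj k hk hjk
    have h3 := hle i hi k hk (hij.trans hjk)
    rw [modEq_iff_of_le_of_le hN h1.1 h1.2] at hm
    rw [modEq_iff_of_le_of_le hN h2.1 h2.2] at hm'
    have h4 := h i hi j hj hij
    have h5 := h j hj k hk hjk
    have h6 := h i hi k hk (hij.trans hjk)
    have := he i
    have := he j
    have := he k
    simp only [Pi.add_apply] at *
    omega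
  refine ⟨hle, fun i hi j hj k hk hij hjk hik hm hm' => ?_⟩
  -- Three tokens at one processor are sorted by number, which reduces everything to `key`.
  rcases lt_or_gt_of_ne hij with h1 | h1 <;> rcases lt_or_gt_of_ne hjk with h2 | h2 <;>
    rcases lt_or_gt_of_ne hik with h3 | h3
  · exact key i hi j hj k hk h1 h2 hm hm'
  · exact absurd (h1.trans h2) h3.not_gt
  · exact key i hi k hk j hj h3 h2 (hm.trans hm') hm'.symm
  · exact key k hk i hi j hj h3 h1 (hm.trans hm').symm hm
  · exact key j hj i hi k hk h1 h3 hm.symm (hm.trans hm')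
  · exact key j hj k hk i hi h2 h3 hm' (hm.trans hm').symm
  · exact absurd (h2.trans h1) h3.not_gt
  · exact key k hk j hj i hi h2 h1 hm'.symm hm.symm

theorem mem_settle {i : Fin M} :
    i ∈ settle N z A ↔ i ∈ A ∧ ∀ j ∈ A, j ≠ i → ¬z i ≡ z j [MOD N] := by
  simp [settle]

theorem isFree_settle : IsFree N z (settle N z A) := by
  intro i hi j hj hij
  exact (mem_settle.1 hi).2 j (mem_settle.1 hj).1 hij.symm

/-- No third token is at the processor of `u` and `v`, so their removal saves no other token from
annihilation. -/
theorem IsWeaklyOrdered.settle_sdiff (h : IsWeaklyOrdered N z A) {u v : Fin M} (hu : u ∈ A)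
    (hv : v ∈ A) (huv : u ≠ v) (hm : z u ≡ z v [MOD N]) :
    settle N z (A \ {u, v}) = settle N z A := by
  ext i
  simp only [mem_settle, Finset.mem_sdiff, Finset.mem_insert, Finset.mem_singleton, not_or]
  constructor
  · rintro ⟨⟨hi, hiu, hiv⟩, hi'⟩
    refine ⟨hi, fun j hj hji hij => ?_⟩
    by_cases hju : j = u
    · subst hju
      exact h.no_triple i hi j hj v hv hiu huv hiv hij hm
    by_cases hjv : j = v
    · subst hjv
      exact h.no_triple i hi j hj u hu hiv huv.symm hiu hij hm.symm
    exact hi' j ⟨hj, hju, hjv⟩ hji hij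
  · rintro ⟨hi, hi'⟩
    refine ⟨⟨hi, ?_, ?_⟩, fun j hj => hi' j hj.1⟩
    · rintro rfl
      exact hi' v hv huv.symm hm
    · rintro rfl
      exact hi' u hu huv hm.symm

/-- The properties of the matrix `f` that allow for the annihilation of the tokens of `A` that share
their processor. -/
structure IsCompatible (N : ℕ) (z : Fin M → ℕ) (A : Finset (Fin M)) (f : Fin M → Fin M → ℝ) :
    Prop where
  antisymm : ∀ u v, f u v = -f v u
  of_eq : ∀ u ∈ A, ∀ v ∈ A, u < v → z v = z u → f u v = 1
  of_add_eq : ∀ u ∈ A, ∀ v ∈ A, u < v → z v = z u + N → f u v = -1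
  row : ∀ u ∈ A, ∀ v ∈ A, u < v → z u ≡ z v [MOD N] → ∀ b ∈ A, b ≠ u → b ≠ v → f u b = f v b

theorem IsCompatible.mono {B : Finset (Fin M)} {f : Fin M → Fin M → ℝ}
    (h : IsCompatible N z A f) (hBA : B ⊆ A) : IsCompatible N z B f where
  antisymm := h.antisymm
  of_eq u hu v hv := h.of_eq u (hBA hu) v (hBA hv)
  of_add_eq u hu v hv := h.of_add_eq u (hBA hu) v (hBA hv)
  row u hu v hv huv hm b hb := h.row u (hBA hu) v (hBA hv) huv hm b (hBA hb)

/-- Colliding pairs are removed one after the other by `pairingSum_annihilate`. It is essential that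
`c'` does not depend on `f`: compatibility prescribes the entry of a colliding pair, so one record
serves both the mean matrix and the matrices `cutSign a` that fix the normalization. -/
theorem IsWeaklyOrdered.exists_settle {m : ℕ} {z : Fin (2 * m + 1) → ℕ} (hN : 0 < N)
    (A : Finset (Fin (2 * m + 1))) (h : IsWeaklyOrdered N z A)
    (c : Fin (2 * m + 1) → Fin (2 * m + 1) → ℝ) (hc : IsDeadMatrix A c) :
    ∃ c', IsDeadMatrix (settle N z A) c' ∧ (Odd A.card → Odd (settle N z A).card) ∧
      ∀ f, IsCompatible N z A f →
        pairingSum (stateMatrix (settle N z A) c' f) = pairingSum (stateMatrix A c f) := by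
  induction hn : A.card using Nat.strong_induction_on generalizing A c with
  | _ n ih =>
    by_cases hA : IsFree N z A
    · rw [settle_eq_self hA]
      exact ⟨c, hc, fun h => hn ▸ h, fun f _ => rfl⟩
    have : ∃ u ∈ A, ∃ v ∈ A, u < v ∧ z u ≡ z v [MOD N] := by
      unfold IsFree at hA
      push Not at hA
      obtain ⟨u, hu, v, hv, huv, hm⟩ := hA
      rcases lt_or_gt_of_ne huv with hlt | hlt
      · exact ⟨u, hu, v, hv, hlt, hm⟩
      · exact ⟨v, hv, u, hu, hlt, hm.symm⟩
    obtain ⟨u, hu, v, hv, huv, hm⟩ := this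
    obtain ⟨κ, hκ, hκf⟩ : ∃ κ : ℝ, |κ| ≤ 1 ∧ ∀ f, IsCompatible N z A f → f u v = κ := by
      obtain ⟨h1, h2⟩ := h.le u hu v hv huv
      rcases (modEq_iff_of_le_of_le hN h1 h2).1 hm with he | he
      · exact ⟨1, by simp, fun f hf => hf.of_eq u hu v hv huv he⟩
      · exact ⟨-1, by simp, fun f hf => hf.of_add_eq u hu v hv huv he⟩
    have hsub : A \ {u, v} ⊆ A := Finset.sdiff_subset
    have hpair : ({u, v} : Finset (Fin (2 * m + 1))) ⊆ A := by
      intro a ha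
      rw [Finset.mem_insert, Finset.mem_singleton] at ha
      rcases ha with rfl | rfl <;> assumption
    have hcard : (A \ {u, v}).card + 2 = A.card := by
      have h2 := Finset.card_sdiff_add_card_eq_card hpair
      rwa [Finset.card_pair huv.ne] at h2
    obtain ⟨c', hc', hodd, hsum⟩ := ih _ (by omega) (A \ {u, v}) (h.mono hsub)
      (annihilate A c u v κ) (hc.annihilate huv.ne hκ) rfl
    rw [h.settle_sdiff hu hv huv.ne hm] at hc' hodd hsum
    refine ⟨c', hc', fun ho => hodd ?_, fun f hf => ?_⟩
    · rw [Nat.odd_iff] at ho ⊢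
      omega
    · rw [hsum f (hf.mono hsub), ← hκf f hf]
      exact pairingSum_annihilate hc hf.antisymm huv.ne hu hv (hf.row u hu v hv huv hm)

/-- A token numbered between `u` and `v` would be squeezed onto their common processor. -/
theorem IsWeaklyOrdered.lt_or_lt_of_eq (h : IsWeaklyOrdered N z A) {u v b : Fin M} (hu : u ∈ A)
    (hv : v ∈ A) (hb : b ∈ A) (huv : u < v) (he : z v = z u) (hbu : b ≠ u) (hbv : b ≠ v) :
    b < u ∨ v < b := by
  by_contra hcon
  push Not at hcon
  have h1 := lt_of_le_of_ne hcon.1 hbu.symm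
  have h2 := lt_of_le_of_ne hcon.2 hbv
  have h3 := (h.le u hu b hb h1).1
  have h4 := (h.le b hb v hv h2).1
  have h5 : z u = z b := by omega
  exact h.no_triple u hu v hv b hb huv.ne hbv.symm hbu.symm (by rw [he]) (by rw [he, h5])

/-- Tokens a full turn apart are extreme in `A`: a token numbered outside their range would be
squeezed onto the same processor. -/
theorem IsWeaklyOrdered.lt_and_lt_of_add_eq (h : IsWeaklyOrdered N z A) {u v b : Fin M}
    (hu : u ∈ A) (hv : v ∈ A) (hb : b ∈ A) (huv : u < v) (he : z v = z u + N) (hbu : b ≠ u)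
    (hbv : b ≠ v) : u < b ∧ b < v := by
  have hm : z u ≡ z v [MOD N] := by rw [he]; simp [Nat.ModEq]
  refine ⟨lt_of_le_of_ne (not_lt.1 fun h1 => ?_) hbu.symm,
    lt_of_le_of_ne (not_lt.1 fun h1 => ?_) hbv⟩
  · have h3 := (h.le b hb u hu h1).1
    have h4 := (h.le b hb v hv (h1.trans huv)).2
    have h5 : z u = z b := by omega
    exact h.no_triple v hv u hu b hb huv.ne' hbu.symm hbv.symm hm.symm (by rw [h5])
  · have h3 := (h.le v hv b hb h1).1
    have h4 := (h.le u hu b hb (huv.trans h1)).2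
    have h5 : z v = z b := by omega
    exact h.no_triple u hu v hv b hb huv.ne hbv.symm hbu.symm hm (by rw [h5])

/-- A survivor belongs to no colliding pair. It separates, in number, the pairs that meet around the
ring, but not the pairs at equal positions. Cutting there gives the signs `-1` and `1` respectively,
whereas `orderSign` would give `1` in both cases. -/
theorem IsWeaklyOrdered.isCompatible_cutSign (hN : 0 < N) (h : IsWeaklyOrdered N z A) {a : Fin M}
    (ha : a ∈ settle N z A) : IsCompatible N z A (cutSign a) := by
  obtain ⟨haA, hset⟩ := mem_settle.1 ha
  have hne : ∀ u ∈ A, ∀ v ∈ A, u < v → z u ≡ z v [MOD N] → a ≠ u ∧ a ≠ v := by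
    intro u hu v hv huv hm
    exact ⟨fun e => hset v hv (e ▸ huv.ne') (e ▸ hm), fun e => hset u hu (e ▸ huv.ne) (e ▸ hm.symm)⟩
  have hadd : ∀ u v, z v = z u + N → z u ≡ z v [MOD N] := fun u v he => by
    rw [he]; simp [Nat.ModEq]
  refine ⟨cutSign_antisymm a, fun u hu v hv huv he => ?_, fun u hu v hv huv he => ?_,
    fun u hu v hv huv hm b hb hbu hbv => ?_⟩
  · obtain ⟨h1, h2⟩ := hne u hu v hv huv (by rw [he])
    have := h.lt_or_lt_of_eq hu hv haA huv he h1 h2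
    unfold cutSign orderSign
    rw [if_pos (by omega), if_pos huv]
  · obtain ⟨h1, h2⟩ := hne u hu v hv huv (hadd u v he)
    have := h.lt_and_lt_of_add_eq hu hv haA huv he h1 h2
    unfold cutSign orderSign
    rw [if_neg (by omega), if_pos huv]
  · obtain ⟨h1, h2⟩ := hne u hu v hv huv hm
    obtain ⟨h3, h4⟩ := h.le u hu v hv huv
    unfold cutSign orderSign
    rcases (modEq_iff_of_le_of_le hN h3 h4).1 hm with he | he
    · have ha' := h.lt_or_lt_of_eq hu hv haA huv he h1 h2
      have hb' := h.lt_or_lt_of_eq hu hv hb huv he hbu hbv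
      split_ifs <;> first | rfl | omega
    · have ha' := h.lt_and_lt_of_add_eq hu hv haA huv he h1 h2
      have hb' := h.lt_and_lt_of_add_eq hu hv hb huv he hbu hbv
      split_ifs <;> first | rfl | omega | simp

/-- The antisymmetric matrix that agrees with `h` above the diagonal. -/
def skew (h : Fin M → Fin M → ℝ) (u v : Fin M) : ℝ :=
  if u < v then h u v else if v < u then -h v u else 0

theorem skew_antisymm (h : Fin M → Fin M → ℝ) (u v : Fin M) : skew h u v = -skew h v u := by
  unfold skew
  rcases lt_trichotomy u v with hlt | rfl | hlt
  · simp [hlt, hlt.not_gt]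
  · simp
  · simp [hlt, hlt.not_gt]

theorem skew_of_lt (h : Fin M → Fin M → ℝ) {u v : Fin M} (huv : u < v) : skew h u v = h u v :=
  if_pos huv

theorem abs_skew_le {h : Fin M → Fin M → ℝ} (hh : ∀ u v, |h u v| ≤ 1) (u v : Fin M) :
    |skew h u v| ≤ 1 := by
  unfold skew
  split_ifs
  · exact hh u v
  · rw [abs_neg]; exact hh v u
  · simp

/-- Equal positions give equal rows since the entries depend on positions only. For positions that
differ by `N`, every other `b` is numbered between `u` and `v`; the minus sign of `skew` below the
diagonal then cancels that of `hgN`. -/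
theorem IsWeaklyOrdered.isCompatible_skew (hN : 0 < N) (h : IsWeaklyOrdered N z A) {g : ℕ → ℕ → ℝ}
    (hg0 : ∀ a, g a a = 1) (hgN : ∀ a b, g b (a + N) = -g a b) :
    IsCompatible N z A (skew fun u v => g (z u) (z v)) := by
  refine ⟨skew_antisymm _, fun u hu v hv huv he => ?_, fun u hu v hv huv he => ?_,
    fun u hu v hv huv hm b hb hbu hbv => ?_⟩
  · rw [skew_of_lt _ huv, he, hg0]
  · rw [skew_of_lt _ huv, he, hgN, hg0]
  · obtain ⟨h3, h4⟩ := h.le u hu v hv huv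
    unfold skew
    rcases (modEq_iff_of_le_of_le hN h3 h4).1 hm with he | he
    · have hb' := h.lt_or_lt_of_eq hu hv hb huv he hbu hbv
      beta_reduce
      rw [he]
      split_ifs <;> first | rfl | omega
    · have hb' := h.lt_and_lt_of_add_eq hu hv hb huv he hbu hbv
      beta_reduce
      rw [if_pos hb'.1, if_neg hb'.2.not_gt, if_pos hb'.2, he, hgN, neg_neg]

end Configurations

/-! ### Bounds and vanishing of the signed sum -/

section Bounds

variable {M : ℕ} {A : Finset (Fin M)} {c : Fin M → Fin M → ℝ}

theorem abs_pairingSign_le (w : Finset (Fin M × Fin M)) : |pairingSign w| ≤ 1 := by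
  unfold pairingSign
  split_ifs <;> simp

theorem abs_pairingSum_le {B : Fin M → Fin M → ℝ} (hB : ∀ u v, |B u v| ≤ 1) :
    |pairingSum B| ≤ (pairings M).card := by
  unfold pairingSum
  refine (Finset.abs_sum_le_sum_abs _ _).trans ?_
  rw [← nsmul_one, ← Finset.sum_const]
  refine Finset.sum_le_sum fun w _ => ?_
  rw [abs_mul, Finset.abs_prod]
  exact mul_le_one₀ (abs_pairingSign_le w) (Finset.prod_nonneg fun _ _ => abs_nonneg _)
    (Finset.prod_le_one (fun _ _ => abs_nonneg _) fun p _ => hB p.1 p.2)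

theorem IsDeadMatrix.abs_stateMatrix_le (hc : IsDeadMatrix A c) {f : Fin M → Fin M → ℝ}
    (hf : ∀ u v, |f u v| ≤ 1) (u v : Fin M) : |stateMatrix A c f u v| ≤ 1 := by
  unfold stateMatrix
  split_ifs
  · exact hf u v
  · exact hc.abs_le u v

/-- If no two tokens of `A` are linked, then the signed sum vanishes. -/
theorem IsDeadMatrix.pairingSum_eq_zero (hc : IsDeadMatrix A c) (hA : 2 ≤ A.card)
    {f : Fin M → Fin M → ℝ} (hf : ∀ u v, u ∈ A → v ∈ A → f u v = 0) :
    pairingSum (stateMatrix A c f) = 0 := by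
  refine Finset.sum_eq_zero fun w hw => ?_
  obtain ⟨-, -, w₀, hcover⟩ := mem_pairings.1 hw
  -- At most one live token is the unpaired `w₀`, so some live token occurs in a pair, and its
  -- entries all vanish.
  obtain ⟨u, hu, hu0⟩ := Finset.exists_mem_ne hA w₀
  have hz : ∀ a b, a ∈ A ∨ b ∈ A → stateMatrix A c f a b = 0 := by
    intro a b hab
    unfold stateMatrix
    by_cases h : a ∈ A ∧ b ∈ A
    · rw [if_pos h, hf a b h.1 h.2]
    · rw [if_neg h]
      rcases hab with ha | hb
      · exact hc.cross a b ha fun hb => h ⟨ha, hb⟩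
      · exact hc.cross' (fun ha => h ⟨ha, hb⟩) hb
  have hmem : u ∈ insert w₀ (w.image Prod.fst ∪ w.image Prod.snd) := by
    rw [hcover]; exact Finset.mem_univ u
  simp only [Finset.mem_insert, hu0, false_or, Finset.mem_union, Finset.mem_image] at hmem
  rcases hmem with ⟨p, hp, rfl⟩ | ⟨p, hp, rfl⟩
  · rw [Finset.prod_eq_zero hp (hz _ _ (Or.inl hu)), mul_zero]
  · rw [Finset.prod_eq_zero hp (hz _ _ (Or.inr hu)), mul_zero]

theorem pairingSum_congr_of_mem {f g : Fin M → Fin M → ℝ}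
    (h : ∀ u ∈ A, ∀ v ∈ A, f u v = g u v) :
    pairingSum (stateMatrix A c f) = pairingSum (stateMatrix A c g) := by
  congr 1
  funext u v
  unfold stateMatrix
  split_ifs with huv
  · exact h u huv.1 v huv.2
  · rfl

end Bounds

/-! ### Systems with a renewal structure -/

section Renewal

variable {E : Type*} [MeasurableSpace E]

/-- `X` describes the movement of a token in terms of its source of randomness. -/
structure IsTokenPath (X : E → ℝ≥0 → ℕ) : Prop where
  measurable : ∀ t, Measurable fun ω => X ω t
  rightConstant : ∀ ω, IsRightConstant (X ω)
  zero : ∀ ω, X ω 0 = 0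

/-- The paths of all tokens. -/
def paths {M : ℕ} (X : E → ℝ≥0 → ℕ) (ω : Fin M → E) (i : Fin M) : ℝ≥0 → ℕ := X (ω i)

/-- When the first jumps have occurred, the system of `M` independent tokens starts afresh. -/
def HasRenewal (M : ℕ) (ν : Measure E) (X : E → ℝ≥0 → ℕ) : Prop :=
  ∃ (ρ : Measure (ℝ≥0 × (Fin M → ℕ))) (S : (Fin M → E) → (ℝ≥0 × (Fin M → ℕ)) × (Fin M → E)),
    IsProbabilityMeasure ρ ∧ Measurable S ∧
    (Measure.pi fun _ : Fin M => ν).map S = ρ.prod (Measure.pi fun _ : Fin M => ν) ∧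
    (∀ᵐ ω ∂(Measure.pi fun _ : Fin M => ν),
      IsFirstJump (paths X ω) (paths X (S ω).2) (S ω).1.1 (S ω).1.2) ∧
    ∀ᵐ q ∂ρ, 0 < q.1 ∧ ∀ i, q.2 i ≤ 1

variable {M N : ℕ} {ν : Measure E} {X : E → ℝ≥0 → ℕ}

/-- The difference of the probabilities that two tokens collide down or up up to time `t`. -/
noncomputable def meanSign (N : ℕ) (ν : Measure E) (X : E → ℝ≥0 → ℕ) (t : ℝ≥0) (a b : ℕ) : ℝ :=
  ∫ q : E × E, collisionSign N a b (X q.1) (X q.2) t ∂(ν.prod ν)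

/-- The matrix of the collision signs of all pairs of tokens. -/
noncomputable def pathMatrix (N : ℕ) (z : Fin M → ℕ) (x : Fin M → ℝ≥0 → ℕ) (t : ℝ≥0) :
    Fin M → Fin M → ℝ :=
  skew fun u v => collisionSign N (z u) (z v) (x u) (x v) t

/-- The matrix of the mean collision signs of all pairs of tokens. -/
noncomputable def meanMatrix (N : ℕ) (ν : Measure E) (X : E → ℝ≥0 → ℕ) (z : Fin M → ℕ)
    (t : ℝ≥0) : Fin M → Fin M → ℝ :=
  skew fun u v => meanSign N ν X t (z u) (z v)

theorem IsTokenPath.measurable_collisionSign_pair (hX : IsTokenPath X) (a b : ℕ) :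
    Measurable fun q : (E × E) × ℝ≥0 => collisionSign N a b (X q.1.1) (X q.1.2) q.2 :=
  measurable_collisionSign (x := fun q : E × E => X q.1) (y := fun q : E × E => X q.2)
    (fun t => (hX.measurable t).comp measurable_fst)
    (fun t => (hX.measurable t).comp measurable_snd)
    (fun q => hX.rightConstant q.1) fun q => hX.rightConstant q.2

theorem abs_meanSign_le [IsProbabilityMeasure ν] (t : ℝ≥0) (a b : ℕ) :
    |meanSign N ν X t a b| ≤ 1 := by
  unfold meanSign
  have := norm_integral_le_of_norm_le_const (μ := ν.prod ν)
    (f := fun q : E × E => collisionSign N a b (X q.1) (X q.2) t) (C := 1)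
    (Filter.Eventually.of_forall fun q => abs_collisionSign_le N a b _ _ t)
  simpa using this

theorem IsTokenPath.meanSign_self [IsProbabilityMeasure ν] (hX : IsTokenPath X) (hN : 0 < N)
    (t : ℝ≥0) (a : ℕ) : meanSign N ν X t a a = 1 := by
  unfold meanSign
  have : ∀ q : E × E, collisionSign N a a (X q.1) (X q.2) t = 1 := by
    intro q
    rw [collisionSign_of_meet (hX.zero _) (hX.zero _) rfl, propIndicator_of_true rfl,
      propIndicator_of_false (by omega), sub_zero]
  simp [this]

theorem meanSign_swap [SFinite ν] (t : ℝ≥0) (a b : ℕ) :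
    meanSign N ν X t b (a + N) = -meanSign N ν X t a b := by
  unfold meanSign
  rw [← integral_neg, ← integral_prod_swap]
  refine integral_congr_ae (Filter.Eventually.of_forall fun q => ?_)
  exact collisionSign_swap N a b (X q.1) (X q.2) t

/-- Injectivity of `f` means that the pairs use disjoint sets of tokens, hence independent sources
of randomness. -/
theorem integral_prod_pairs [IsProbabilityMeasure ν] {m : ℕ} {f : Fin m × Bool → Fin M}
    (hf : Function.Injective f) {g : Fin m → E × E → ℝ} (hg : ∀ i, Measurable (g i)) :
    ∫ ω, ∏ i, g i (ω (f (i, false)), ω (f (i, true))) ∂(Measure.pi fun _ : Fin M => ν) =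
      ∏ i, ∫ ω, g i (ω (f (i, false)), ω (f (i, true))) ∂(Measure.pi fun _ : Fin M => ν) := by
  rw [← Measure.infinitePi_eq_pi]
  let Y : Fin m → (Fin M → E) → Bool → E := fun i ω b => ω (f (i, b))
  have hY : ∀ i, Measurable (Y i) := fun i => by fun_prop
  have hmap : ∀ i, (Measure.infinitePi fun _ : Fin M => ν).map (Y i) =
      Measure.infinitePi fun _ : Bool => ν := fun i =>
    Measure.map_infinitePi_infinitePi_of_inj (P := fun _ : Fin M => ν)
      (f := fun b => f (i, b)) fun b b' h => by simpa using hf h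
  have hind : iIndepFun Y (Measure.infinitePi fun _ : Fin M => ν) := by
    rw [iIndepFun_iff_map_fun_eq_infinitePi_map hY]
    simp only [hmap]
    have h1 := Measure.map_infinitePi_infinitePi_of_inj (P := fun _ : Fin M => ν) hf
    have h2 := Measure.infinitePi_map_curry (ι := Fin m) (κ := Bool) fun _ _ => ν
    rw [← h2, ← h1, Measure.map_map (by fun_prop) (by fun_prop)]
    rfl
  exact hind.integral_fun_prod_comp (f := fun i (η : Bool → E) => g i (η false, η true))
    (fun i => (hY i).aemeasurable) fun i =>
      ((hg i).comp (by fun_prop)).aestronglyMeasurable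

theorem integral_pair [IsProbabilityMeasure ν] {u v : Fin M} (huv : u ≠ v) {g : E × E → ℝ}
    (hg : Measurable g) :
    ∫ ω, g (ω u, ω v) ∂(Measure.pi fun _ : Fin M => ν) = ∫ q, g q ∂(ν.prod ν) := by
  have hmap := Measure.infinitePi_map_eval_prod (P := fun _ : Fin M => ν) huv
  rw [← Measure.infinitePi_eq_pi, ← hmap,
    integral_map (by fun_prop) hg.aestronglyMeasurable]

theorem IsTokenPath.measurable_entry (hX : IsTokenPath X) (A : Finset (Fin M))
    (c : Fin M → Fin M → ℝ) (z : Fin M → ℕ) (u v : Fin M) :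
    Measurable fun q : (E × E) × ℝ≥0 => if u ∈ A ∧ v ∈ A then
      collisionSign N (z u) (z v) (X q.1.1) (X q.1.2) q.2 else c u v := by
  split_ifs
  · exact hX.measurable_collisionSign_pair _ _
  · exact measurable_const

theorem IsTokenPath.measurable_stateMatrix (hX : IsTokenPath X) (A : Finset (Fin M))
    (c : Fin M → Fin M → ℝ) (z : Fin M → ℕ) {u v : Fin M} (huv : u < v) :
    Measurable fun q : (Fin M → E) × ℝ≥0 =>
      stateMatrix A c (pathMatrix N z (paths X q.1) q.2) u v := by
  simp only [stateMatrix, pathMatrix, skew_of_lt _ huv]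
  have hm : Measurable fun q : (Fin M → E) × ℝ≥0 => ((q.1 u, q.1 v), q.2) := by fun_prop
  have h := (hX.measurable_entry (N := N) A c z u v).comp hm
  exact h

theorem measurable_pairingTerm {α : Type*} [MeasurableSpace α] {f : α → Fin M → Fin M → ℝ}
    (hf : ∀ u v, u < v → Measurable fun q => f q u v) {w : Finset (Fin M × Fin M)}
    (hw : w ∈ pairings M) :
    Measurable fun q => pairingSign w * ∏ p ∈ w, f q p.1 p.2 :=
  (Finset.measurable_fun_prod _ fun p hp =>
    hf p.1 p.2 ((mem_pairings.1 hw).2.1 p hp)).const_mul _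

theorem measurable_pairingSum {α : Type*} [MeasurableSpace α] {f : α → Fin M → Fin M → ℝ}
    (hf : ∀ u v, u < v → Measurable fun q => f q u v) :
    Measurable fun q => pairingSum (f q) :=
  Finset.measurable_fun_sum _ fun _ hw => measurable_pairingTerm hf hw

theorem IsTokenPath.measurable_pairingSum (hX : IsTokenPath X) (A : Finset (Fin M))
    (c : Fin M → Fin M → ℝ) (z : Fin M → ℕ) :
    Measurable fun q : (Fin M → E) × ℝ≥0 =>
      pairingSum (stateMatrix A c (pathMatrix N z (paths X q.1) q.2)) :=
  Herman.measurable_pairingSum fun _ _ huv => hX.measurable_stateMatrix A c z huv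

theorem IsTokenPath.integral_pairing_prod [IsProbabilityMeasure ν] {m : ℕ} (hX : IsTokenPath X)
    {w : Finset (Fin (2 * m + 1) × Fin (2 * m + 1))} (hw : w ∈ pairings (2 * m + 1))
    (A : Finset (Fin (2 * m + 1))) (c : Fin (2 * m + 1) → Fin (2 * m + 1) → ℝ)
    (z : Fin (2 * m + 1) → ℕ) (t : ℝ≥0) :
    ∫ ω, ∏ p ∈ w, stateMatrix A c (pathMatrix N z (paths X ω) t) p.1 p.2
        ∂(Measure.pi fun _ : Fin (2 * m + 1) => ν) =
      ∏ p ∈ w, stateMatrix A c (meanMatrix N ν X z t) p.1 p.2 := by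
  obtain ⟨σ, rfl⟩ := exists_pairsOf_eq hw
  obtain ⟨τ, hor, -, -⟩ := exists_reorientation σ
  have hl := lists_pairsOf hor
  have hlt : ∀ i, fstOf τ i < sndOf τ i := fun i =>
    (mem_pairings.1 hw).2.1 (fstOf τ i, sndOf τ i) ((lists_iff.1 hl _).2 ⟨i, rfl⟩)
  simp only [← prod_eq_prod_of_lists hl]
  have hg : ∀ i, Measurable fun q : E × E => if fstOf τ i ∈ A ∧ sndOf τ i ∈ A then
      collisionSign N (z (fstOf τ i)) (z (sndOf τ i)) (X q.1) (X q.2) t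
      else c (fstOf τ i) (sndOf τ i) := by
    intro i
    have h := (hX.measurable_entry (N := N) A c z (fstOf τ i) (sndOf τ i)).comp
      (measurable_prodMk_right (y := t))
    exact h
  -- The slots of a list are distinct, so its pairs are disjoint.
  have key := integral_prod_pairs (ν := ν)
    (f := fun p : Fin m × Bool => τ (position (Sum.inl (p.2, p.1)))) (by
      intro p q hpq
      have := position_injective (τ.injective hpq)
      simp only [Sum.inl.injEq, Prod.mk.injEq] at this
      exact Prod.ext this.2 this.1) hg
  have hleft : ∀ (ω : Fin (2 * m + 1) → E) (i : Fin m),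
      stateMatrix A c (pathMatrix N z (paths X ω) t) (fstOf τ i) (sndOf τ i) =
      if fstOf τ i ∈ A ∧ sndOf τ i ∈ A then collisionSign N (z (fstOf τ i)) (z (sndOf τ i))
        (X (ω (fstOf τ i))) (X (ω (sndOf τ i))) t else c (fstOf τ i) (sndOf τ i) := by
    intro ω i
    simp only [stateMatrix, pathMatrix, skew_of_lt _ (hlt i), paths]
  have hright : ∀ i : Fin m,
      stateMatrix A c (meanMatrix N ν X z t) (fstOf τ i) (sndOf τ i) =
      ∫ ω, (if fstOf τ i ∈ A ∧ sndOf τ i ∈ A then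
        collisionSign N (z (fstOf τ i)) (z (sndOf τ i)) (X (ω (fstOf τ i)))
          (X (ω (sndOf τ i))) t else c (fstOf τ i) (sndOf τ i))
        ∂(Measure.pi fun _ : Fin (2 * m + 1) => ν) := by
    intro i
    rw [integral_pair (hlt i).ne (hg i)]
    simp only [stateMatrix, meanMatrix, skew_of_lt _ (hlt i), meanSign]
    split_ifs
    · rfl
    · simp
  simp only [hleft, hright]
  exact key

theorem IsTokenPath.integral_pairingSum [IsProbabilityMeasure ν] {m : ℕ} (hX : IsTokenPath X)
    {A : Finset (Fin (2 * m + 1))} {c : Fin (2 * m + 1) → Fin (2 * m + 1) → ℝ}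
    (hc : IsDeadMatrix A c) (z : Fin (2 * m + 1) → ℕ) (t : ℝ≥0) :
    ∫ ω, pairingSum (stateMatrix A c (pathMatrix N z (paths X ω) t))
        ∂(Measure.pi fun _ : Fin (2 * m + 1) => ν) =
      pairingSum (stateMatrix A c (meanMatrix N ν X z t)) := by
  have hmeas : ∀ w ∈ pairings (2 * m + 1), Measurable fun ω : Fin (2 * m + 1) → E =>
      pairingSign w * ∏ p ∈ w, stateMatrix A c (pathMatrix N z (paths X ω) t) p.1 p.2 := by
    intro w hw
    have hm : Measurable fun ω : Fin (2 * m + 1) → E => (ω, t) := by fun_prop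
    have h := (measurable_pairingTerm
      (fun _ _ huv => hX.measurable_stateMatrix (N := N) A c z huv) hw).comp hm
    exact h
  unfold pairingSum
  rw [integral_finsetSum]
  · refine Finset.sum_congr rfl fun w hw => ?_
    rw [integral_const_mul]
    congr 1
    exact hX.integral_pairing_prod hw A c z t
  · intro w hw
    refine Integrable.of_bound (hmeas w hw).aestronglyMeasurable 1
      (Filter.Eventually.of_forall fun ω => ?_)
    rw [Real.norm_eq_abs, abs_mul, Finset.abs_prod]
    exact mul_le_one₀ (abs_pairingSign_le w) (Finset.prod_nonneg fun _ _ => abs_nonneg _)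
      (Finset.prod_le_one (fun _ _ => abs_nonneg _) fun p _ => hc.abs_stateMatrix_le
        (abs_skew_le fun u v => abs_collisionSign_le N _ _ _ _ t) p.1 p.2)

/-- The pathwise difference of the two sides of the formula. -/
noncomputable def discrepancy (N : ℕ) (A : Finset (Fin M)) (c : Fin M → Fin M → ℝ)
    (z : Fin M → ℕ) (x : Fin M → ℝ≥0 → ℕ) (t : ℝ≥0) : ℝ :=
  propIndicator (stabFrom N z x A ≤ t) - pairingSum (stateMatrix A c (pathMatrix N z x t))

/-- The difference of the two sides of the formula. -/
noncomputable def meanDiscrepancy (N : ℕ) (ν : Measure E) (X : E → ℝ≥0 → ℕ) (A : Finset (Fin M))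
    (c : Fin M → Fin M → ℝ) (z : Fin M → ℕ) (t : ℝ≥0) : ℝ :=
  (Measure.pi fun _ : Fin M => ν).real {ω | stabFrom N z (paths X ω) A ≤ t} -
    pairingSum (stateMatrix A c (meanMatrix N ν X z t))

theorem IsTokenPath.measurable_stabFrom (hX : IsTokenPath X) (A : Finset (Fin M))
    (z : Fin M → ℕ) : Measurable fun ω : Fin M → E => stabFrom N z (paths X ω) A :=
  Herman.measurable_stabFrom (x := paths X)
    (fun i t => (hX.measurable t).comp (measurable_pi_apply i))
    (fun ω i => hX.rightConstant (ω i)) A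

theorem IsTokenPath.measurable_discrepancy (hX : IsTokenPath X) (A : Finset (Fin M))
    (c : Fin M → Fin M → ℝ) (z : Fin M → ℕ) :
    Measurable fun q : (Fin M → E) × ℝ≥0 => discrepancy N A c z (paths X q.1) q.2 :=
  (measurable_propIndicator (measurableSet_le ((hX.measurable_stabFrom A z).comp measurable_fst)
    measurable_snd.coe_nnreal_ennreal)).sub (hX.measurable_pairingSum A c z)

theorem abs_discrepancy_le {A : Finset (Fin M)} {c : Fin M → Fin M → ℝ} (hc : IsDeadMatrix A c)
    (z : Fin M → ℕ) (x : Fin M → ℝ≥0 → ℕ) (t : ℝ≥0) :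
    |discrepancy N A c z x t| ≤ 1 + (pairings M).card := by
  unfold discrepancy
  refine (abs_sub _ _).trans (add_le_add ?_ (abs_pairingSum_le (hc.abs_stateMatrix_le
    (abs_skew_le fun u v => abs_collisionSign_le N _ _ _ _ t))))
  rw [abs_of_nonneg (propIndicator_nonneg _)]
  exact propIndicator_le_one _

theorem integral_propIndicator {Ω : Type*} [MeasurableSpace Ω] {μ : Measure Ω} {p : Ω → Prop}
    (hp : MeasurableSet {ω | p ω}) : ∫ ω, propIndicator (p ω) ∂μ = μ.real {ω | p ω} := by
  classical
  rw [← integral_indicator_one hp]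
  refine integral_congr_ae (Filter.Eventually.of_forall fun ω => ?_)
  simp [propIndicator, Set.indicator_apply]

theorem IsTokenPath.integral_discrepancy [IsProbabilityMeasure ν] {m : ℕ} (hX : IsTokenPath X)
    {A : Finset (Fin (2 * m + 1))} {c : Fin (2 * m + 1) → Fin (2 * m + 1) → ℝ}
    (hc : IsDeadMatrix A c) (z : Fin (2 * m + 1) → ℕ) (t : ℝ≥0) :
    ∫ ω, discrepancy N A c z (paths X ω) t ∂(Measure.pi fun _ : Fin (2 * m + 1) => ν) =
      meanDiscrepancy N ν X A c z t := by
  have hset : MeasurableSet {ω : Fin (2 * m + 1) → E | stabFrom N z (paths X ω) A ≤ t} :=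
    measurableSet_le (hX.measurable_stabFrom A z) measurable_const
  unfold discrepancy meanDiscrepancy
  rw [integral_sub, integral_propIndicator hset, hX.integral_pairingSum hc]
  · refine Integrable.of_bound (measurable_propIndicator hset).aestronglyMeasurable 1
      (Filter.Eventually.of_forall fun ω => ?_)
    rw [Real.norm_eq_abs, abs_of_nonneg (propIndicator_nonneg _)]
    exact propIndicator_le_one _
  · refine Integrable.of_bound ((hX.measurable_pairingSum A c z).comp
      measurable_prodMk_right).aestronglyMeasurable (pairings (2 * m + 1)).card
      (Filter.Eventually.of_forall fun ω => abs_pairingSum_le (hc.abs_stateMatrix_le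
        (abs_skew_le fun u v => abs_collisionSign_le N _ _ _ _ t)))

/-- Before the jump there is no collision: at least two tokens remain, and the signed sum vanishes
together with all live entries. From the jump on, both terms are those of the new system with its
clock started at `s`. -/
theorem discrepancy_of_isFirstJump {A : Finset (Fin M)} {c : Fin M → Fin M → ℝ}
    (hc : IsDeadMatrix A c) {z : Fin M → ℕ} (hA : IsFree N z A) (hcard : 2 ≤ A.card)
    {x x' : Fin M → ℝ≥0 → ℕ} {s : ℝ≥0} {e : Fin M → ℕ} (h : IsFirstJump x x' s e) (t : ℝ≥0) :
    discrepancy N A c z x t = if s ≤ t then discrepancy N A c (z + e) x' (t - s) else 0 := by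
  have hentry : ∀ u ∈ A, ∀ v ∈ A, pathMatrix N z x t u v =
      if s ≤ t then pathMatrix N (z + e) x' (t - s) u v else 0 := by
    intro u hu v hv
    have hcs : ∀ a ∈ A, ∀ b ∈ A, a ≠ b → collisionSign N (z a) (z b) (x a) (x b) t =
        if s ≤ t then collisionSign N ((z + e) a) ((z + e) b) (x' a) (x' b) (t - s) else 0 :=
      fun a ha b hb hab => collisionSign_first_jump (h.before a) (h.before b) (h.after a)
        (h.after b) (hA a ha b hb hab) t
    unfold pathMatrix skew
    beta_reduce
    by_cases h1 : u < v
    · rw [if_pos h1, hcs u hu v hv h1.ne]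
      simp only [if_pos h1]
    by_cases h2 : v < u
    · rw [if_neg h1, if_pos h2, hcs v hv u hu h2.ne]
      simp only [if_neg h1, if_pos h2]
      split_ifs <;> simp
    · simp [h1, h2]
  unfold discrepancy
  rw [h.stabFrom_eq hA (by omega)]
  by_cases hst : s ≤ t
  · rw [if_pos hst]
    congr 1
    · obtain ⟨r, rfl⟩ := exists_add_of_le hst
      simp only [add_tsub_cancel_left, ENNReal.coe_add,
        ENNReal.add_le_add_iff_left ENNReal.coe_ne_top]
    · refine pairingSum_congr_of_mem fun u hu v hv => ?_
      rw [hentry u hu v hv, if_pos hst]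
  · rw [if_neg hst, hc.pairingSum_eq_zero hcard, propIndicator_of_false, sub_zero]
    · exact fun hle => hst (ENNReal.coe_le_coe.1 (le_self_add.trans hle))
    · intro u v hu hv
      rw [hentry u hu v hv, if_neg hst]

/-- This is the contraction factor of one renewal; almost sure positivity of the waiting time makes
it strictly smaller than `1`. -/
theorem integral_exp_neg_lt_one {α : Type*} [MeasurableSpace α] {ρ : Measure α}
    [IsProbabilityMeasure ρ] {f : α → ℝ≥0} (hf : Measurable f) (hpos : ∀ᵐ q ∂ρ, 0 < f q) :
    ∫ q, Real.exp (-(f q : ℝ)) ∂ρ < 1 := by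
  have hint : Integrable (fun q => Real.exp (-(f q : ℝ))) ρ := by
    refine Integrable.of_bound (by fun_prop) 1 (Filter.Eventually.of_forall fun q => ?_)
    rw [Real.norm_eq_abs, Real.abs_exp, Real.exp_le_one_iff]
    simp
  have h1 : 0 < ∫ q, (1 - Real.exp (-(f q : ℝ))) ∂ρ := by
    rw [integral_pos_iff_support_of_nonneg_ae]
    · rw [(mem_ae_iff_prob_eq_one ?_).1]
      · exact one_pos
      · filter_upwards [hpos] with q hq
        rw [Function.mem_support]
        have : Real.exp (-(f q : ℝ)) < 1 := by
          rw [Real.exp_lt_one_iff]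
          have : (0 : ℝ) < f q := by exact_mod_cast hq
          linarith
        exact (sub_pos.2 this).ne'
      · exact measurableSet_support (by fun_prop)
    · refine Filter.Eventually.of_forall fun q => ?_
      simp
    · exact (integrable_const _).sub hint
  rw [integral_sub (integrable_const _) hint] at h1
  simp at h1
  linarith

theorem IsTokenPath.measurable_renewalKernel (hX : IsTokenPath X) (A : Finset (Fin M))
    (c : Fin M → Fin M → ℝ) (z : Fin M → ℕ) (t : ℝ≥0) :
    Measurable fun p : (ℝ≥0 × (Fin M → ℕ)) × (Fin M → E) =>
      if p.1.1 ≤ t then discrepancy N A c (z + p.1.2) (paths X p.2) (t - p.1.1) else 0 := by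
  have h1 : Measurable fun p : (Fin M → ℕ) × ((Fin M → E) × ℝ≥0) =>
      discrepancy N A c (z + p.1) (paths X p.2.1) p.2.2 :=
    measurable_from_prod_countable_right fun e => hX.measurable_discrepancy A c (z + e)
  have h2 : Measurable fun p : (ℝ≥0 × (Fin M → ℕ)) × (Fin M → E) =>
      (p.1.2, (p.2, t - p.1.1)) := by fun_prop
  have h3 : MeasurableSet {p : (ℝ≥0 × (Fin M → ℕ)) × (Fin M → E) | p.1.1 ≤ t} :=
    measurableSet_le (by fun_prop) measurable_const
  have h4 := h1.comp h2
  exact Measurable.ite h3 h4 measurable_const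

/-- The tokens of `A` are ordered, and `c` keeps track of the tokens that have been annihilated. -/
structure IsState {m : ℕ} (N : ℕ) (z : Fin (2 * m + 1) → ℕ) (A : Finset (Fin (2 * m + 1)))
    (c : Fin (2 * m + 1) → Fin (2 * m + 1) → ℝ) : Prop where
  ordered : IsOrdered N z A
  odd : Odd A.card
  dead : IsDeadMatrix A c
  normalized : ∀ a ∈ A, pairingSum (stateMatrix A c (cutSign a)) = 1

/-- The stabilization time is unchanged because the annihilation takes place at time `0`, and the
sum is unchanged because the mean matrix is compatible. The argument needs means: two tokens at the
same processor have different paths, but with the same law. -/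
theorem IsTokenPath.exists_settled_state [IsProbabilityMeasure ν] {m : ℕ} (hX : IsTokenPath X)
    (hN : 0 < N) {z : Fin (2 * m + 1) → ℕ} {A : Finset (Fin (2 * m + 1))}
    {c : Fin (2 * m + 1) → Fin (2 * m + 1) → ℝ} (h : IsState N z A c) {e : Fin (2 * m + 1) → ℕ}
    (he : ∀ i, e i ≤ 1) :
    ∃ A' c', IsState N (z + e) A' c' ∧
      ∀ t, meanDiscrepancy N ν X A c (z + e) t = meanDiscrepancy N ν X A' c' (z + e) t := by
  have hw := h.ordered.isWeaklyOrdered_add hN he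
  obtain ⟨c', hc', hodd, hsum⟩ := hw.exists_settle hN A c h.dead
  have hsub : settle N (z + e) A ⊆ A := Finset.filter_subset _ _
  refine ⟨settle N (z + e) A, c', ⟨(hw.mono hsub).isOrdered hN isFree_settle, hodd h.odd, hc',
    fun a ha => ?_⟩, fun t => ?_⟩
  · rw [hsum _ (hw.isCompatible_cutSign hN ha), h.normalized a (hsub ha)]
  · unfold meanDiscrepancy
    congr 1
    · congr 1
      ext ω
      simp only [Set.mem_ofPred_eq]
      rw [stabFrom_settle (x := paths X ω) fun i => hX.zero (ω i)]
    · exact (hsum _ (hw.isCompatible_skew hN (hX.meanSign_self hN t)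
        fun a b => meanSign_swap t a b)).symm

/-- The only live entry is diagonal, hence `0` by antisymmetry, so the mean matrix may be replaced
by `cutSign a`. The normalization then gives `1`. -/
theorem IsState.meanDiscrepancy_of_card_eq_one [IsProbabilityMeasure ν] {m : ℕ}
    {z : Fin (2 * m + 1) → ℕ} {A : Finset (Fin (2 * m + 1))}
    {c : Fin (2 * m + 1) → Fin (2 * m + 1) → ℝ} (h : IsState N z A c) (hA : A.card = 1)
    (t : ℝ≥0) : meanDiscrepancy N ν X A c z t = 0 := by
  obtain ⟨a, rfl⟩ := Finset.card_eq_one.1 hA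
  unfold meanDiscrepancy
  rw [← pairingSum_congr_of_mem (f := cutSign a), h.normalized a (Finset.mem_singleton_self a)]
  · simp [stabFrom_of_card_eq_one hA]
  · intro u hu v hv
    rw [Finset.mem_singleton] at hu hv
    rw [hu, hv]
    have h1 := cutSign_antisymm a a a
    have h2 := skew_antisymm (fun v w => meanSign N ν X t (z v) (z w)) a a
    unfold meanMatrix
    linarith

theorem abs_meanDiscrepancy_le [IsProbabilityMeasure ν] {A : Finset (Fin M)}
    {c : Fin M → Fin M → ℝ} (hc : IsDeadMatrix A c) (z : Fin M → ℕ) (t : ℝ≥0) :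
    |meanDiscrepancy N ν X A c z t| ≤ 1 + (pairings M).card := by
  unfold meanDiscrepancy
  refine (abs_sub _ _).trans (add_le_add ?_ (abs_pairingSum_le (hc.abs_stateMatrix_le
    (abs_skew_le fun u v => abs_meanSign_le t _ _))))
  rw [abs_of_nonneg measureReal_nonneg]
  exact measureReal_le_one

theorem IsState.meanDiscrepancy_eq_zero [IsProbabilityMeasure ν] {m : ℕ} (hX : IsTokenPath X)
    (hR : HasRenewal (2 * m + 1) ν X) (hN : 0 < N) {z : Fin (2 * m + 1) → ℕ}
    {A : Finset (Fin (2 * m + 1))} {c : Fin (2 * m + 1) → Fin (2 * m + 1) → ℝ}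
    (h : IsState N z A c) (t : ℝ≥0) : meanDiscrepancy N ν X A c z t = 0 := by
  obtain ⟨ρ, S, hρ, hS, hmap, hjump, hmark⟩ := hR
  set D : ℝ := 1 + (pairings (2 * m + 1)).card with hD
  have hD0 : 0 ≤ D := by positivity
  set q : ℝ := ∫ p, Real.exp (-(p.1 : ℝ)) ∂ρ with hq
  have hq0 : 0 ≤ q := integral_nonneg fun p => (Real.exp_pos _).le
  have hq1 : q < 1 := integral_exp_neg_lt_one measurable_fst (hmark.mono fun p hp => hp.1)
  have hexp : Integrable (fun p : ℝ≥0 × (Fin (2 * m + 1) → ℕ) => Real.exp (-(p.1 : ℝ))) ρ := by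
    refine Integrable.of_bound (by fun_prop) 1 (Filter.Eventually.of_forall fun p => ?_)
    rw [Real.norm_eq_abs, Real.abs_exp, Real.exp_le_one_iff]
    simp
  -- The weight `exp t` turns a delay by `s` into the factor `exp (-s)`, whose mean is `q`.
  have bound : ∀ n : ℕ, ∀ (z : Fin (2 * m + 1) → ℕ) (A : Finset (Fin (2 * m + 1)))
      (c : Fin (2 * m + 1) → Fin (2 * m + 1) → ℝ), IsState N z A c → ∀ t : ℝ≥0,
      |meanDiscrepancy N ν X A c z t| ≤ D * q ^ n * Real.exp t := by
    intro n
    induction n with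
    | zero =>
      intro z A c h t
      refine (abs_meanDiscrepancy_le h.dead z t).trans ?_
      rw [pow_zero, mul_one]
      exact le_mul_of_one_le_right hD0 (Real.one_le_exp t.2)
    | succ n ih =>
      intro z A c h t
      by_cases hA : A.card = 1
      · rw [h.meanDiscrepancy_of_card_eq_one hA, abs_zero]
        positivity
      have hcard : 2 ≤ A.card := by
        obtain ⟨k, hk⟩ := h.odd
        omega
      let K : (ℝ≥0 × (Fin (2 * m + 1) → ℕ)) × (Fin (2 * m + 1) → E) → ℝ := fun p =>
        if p.1.1 ≤ t then discrepancy N A c (z + p.1.2) (paths X p.2) (t - p.1.1) else 0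
      have hK : Measurable K := hX.measurable_renewalKernel A c z t
      have hKint : Integrable K (ρ.prod (Measure.pi fun _ : Fin (2 * m + 1) => ν)) := by
        refine Integrable.of_bound hK.aestronglyMeasurable D
          (Filter.Eventually.of_forall fun p => ?_)
        simp only [K]
        split_ifs
        · exact abs_discrepancy_le h.dead _ _ _
        · simpa using hD0
      -- Renewal equation: the paths are split at the first jump, and the restarted system is
      -- integrated first.
      have hrec : meanDiscrepancy N ν X A c z t =
          ∫ p, (if p.1 ≤ t then meanDiscrepancy N ν X A c (z + p.2) (t - p.1) else 0) ∂ρ := by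
        rw [← hX.integral_discrepancy h.dead]
        have h1 : ∫ ω, discrepancy N A c z (paths X ω) t
            ∂(Measure.pi fun _ : Fin (2 * m + 1) => ν) =
            ∫ ω, K (S ω) ∂(Measure.pi fun _ : Fin (2 * m + 1) => ν) := by
          refine integral_congr_ae ?_
          filter_upwards [hjump] with ω hω
          exact discrepancy_of_isFirstJump h.dead h.ordered.isFree hcard hω t
        rw [h1, ← integral_map hS.aemeasurable hK.aestronglyMeasurable, hmap,
          integral_prod _ hKint]
        refine integral_congr_ae (Filter.Eventually.of_forall fun p => ?_)
        simp only [K]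
        split_ifs
        · exact hX.integral_discrepancy h.dead _ _
        · simp
      rw [hrec, ← Real.norm_eq_abs]
      refine (norm_integral_le_of_norm_le (hexp.const_mul (D * q ^ n * Real.exp t)) ?_).trans
        (le_of_eq ?_)
      · filter_upwards [hmark] with p hp
        by_cases hpt : p.1 ≤ t
        · rw [if_pos hpt]
          -- After the jump, tokens may share a processor; the induction hypothesis applies to the
          -- settled state.
          obtain ⟨A', c', h', heq⟩ := hX.exists_settled_state (ν := ν) hN h hp.2
          rw [heq, mul_assoc, ← Real.exp_add]
          refine (ih _ _ _ h' _).trans (le_of_eq ?_)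
          rw [NNReal.coe_sub hpt, sub_eq_add_neg]
        · rw [if_neg hpt, norm_zero]
          positivity
      · rw [integral_const_mul, ← hq]
        ring
  have hlim : Filter.Tendsto (fun n : ℕ => D * q ^ n * Real.exp t) Filter.atTop (nhds 0) := by
    have := ((tendsto_pow_atTop_nhds_zero_of_lt_one hq0 hq1).const_mul D).mul_const (Real.exp t)
    simpa using this
  exact abs_nonpos_iff.1 (ge_of_tendsto' hlim fun n => bound n z A c h t)

/-- The formula for a system with a renewal structure. -/
theorem IsTokenPath.stabTime_formula [IsProbabilityMeasure ν] {m : ℕ} (hX : IsTokenPath X)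
    (hR : HasRenewal (2 * m + 1) ν X) (hN : 0 < N) {z : Fin (2 * m + 1) → ℕ}
    (hz : IsOrdered N z Finset.univ) (t : ℝ≥0) :
    (Measure.pi fun _ : Fin (2 * m + 1) => ν).real {ω | stabTime N z (paths X ω) ≤ t} =
      ∑ w ∈ pairings (2 * m + 1), pairingSign w * ∏ p ∈ w, meanSign N ν X t (z p.1) (z p.2) := by
  have huniv : ∀ f : Fin (2 * m + 1) → Fin (2 * m + 1) → ℝ,
      stateMatrix Finset.univ (fun _ _ => 0) f = f := by
    intro f
    funext u v
    simp [stateMatrix]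
  -- Initially all tokens are live, so the record of annihilated pairs plays no role and can be `0`.
  have hstate : IsState N z Finset.univ (fun _ _ => (0 : ℝ)) :=
    ⟨hz, by simp, ⟨by simp, by simp, by simp⟩, fun a _ => by rw [huniv, pairingSum_cutSign]⟩
  have := hstate.meanDiscrepancy_eq_zero hX hR hN t
  unfold meanDiscrepancy at this
  rw [huniv, sub_eq_zero] at this
  simp only [stabTime_eq_stabFrom]
  rw [this]
  refine Finset.sum_congr rfl fun w hw => ?_
  congr 1
  refine Finset.prod_congr rfl fun p hp => ?_
  exact skew_of_lt _ ((mem_pairings.1 hw).2.1 p hp)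

end Renewal

/-! ### Sequences of independent random variables -/

section Sequences

variable {α : Type*} [MeasurableSpace α] (η : Measure α) [IsProbabilityMeasure η]

/-- The law of a sequence of independent random variables with the law `η`. -/
noncomputable def seqLaw : Measure (ℕ → α) := Measure.infinitePi fun _ => η

instance : IsProbabilityMeasure (seqLaw η) := by
  unfold seqLaw
  infer_instance

/-- The sequence `a, b 0, b 1, …`. -/
def consSeq {α : Type*} (a : α) (b : ℕ → α) : ℕ → α
  | 0 => a
  | k + 1 => b k

theorem measurable_consSeq : Measurable fun p : α × (ℕ → α) => consSeq p.1 p.2 := by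
  refine measurable_pi_iff.2 fun k => ?_
  cases k with
  | zero => exact measurable_fst
  | succ k => exact (measurable_pi_apply k).comp measurable_snd

/-- The product measure is determined by finite-dimensional cylinders, and a cylinder of `consSeq a
b` is a condition on `a` times a cylinder in `b`. -/
theorem map_consSeq :
    (η.prod (seqLaw η)).map (fun p => consSeq p.1 p.2) = seqLaw η := by
  classical
  refine Measure.eq_infinitePi _ fun s t ht => ?_
  -- Filling up with trivial conditions allows the index set to be an initial segment, where head
  -- and tail separate.
  let t' : ℕ → Set α := fun k => if k ∈ s then t k else Set.univ
  have ht' : ∀ k, MeasurableSet (t' k) := by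
    intro k
    simp only [t']
    split_ifs
    · exact ht k
    · exact MeasurableSet.univ
  obtain ⟨n, hn⟩ := s.exists_nat_subset_range
  have hn' : s ⊆ Finset.range (n + 1) := hn.trans (by simp)
  have hset : (fun p : α × (ℕ → α) => consSeq p.1 p.2) ⁻¹' ((s : Set ℕ).pi t) =
      t' 0 ×ˢ ((Finset.range n : Set ℕ).pi fun k => t' (k + 1)) := by
    ext p
    simp only [Set.mem_preimage, Set.mem_pi, Finset.mem_coe, Set.mem_prod, Finset.mem_range, t']
    constructor
    · intro h
      refine ⟨?_, fun k _ => ?_⟩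
      · split_ifs with h0
        · exact h 0 h0
        · trivial
      · split_ifs with h0
        · exact h (k + 1) h0
        · trivial
    · rintro ⟨h0, h1⟩ k hk
      cases k with
      | zero => rw [if_pos hk] at h0; exact h0
      | succ k =>
        have := h1 k (by simpa using hn' hk)
        rw [if_pos hk] at this
        exact this
  rw [Measure.map_apply measurable_consSeq (MeasurableSet.pi s.countable_toSet fun k _ => ht k),
    hset, Measure.prod_prod, seqLaw, Measure.infinitePi_pi _ fun k _ => ht' (k + 1), mul_comm,
    ← Finset.prod_range_succ' (fun k => η (t' k))]
  have hprod : ∏ k ∈ s, η (t k) = ∏ k ∈ s, η (t' k) :=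
    Finset.prod_congr rfl fun k hk => by simp only [t', if_pos hk]
  rw [hprod]
  refine (Finset.prod_subset hn' fun k _ hk => ?_).symm
  simp only [t', if_neg hk, measure_univ]

theorem measurable_head_tail : Measurable fun b : ℕ → α => (b 0, fun k => b (k + 1)) := by
  fun_prop

theorem map_head_tail :
    (seqLaw η).map (fun b => (b 0, fun k => b (k + 1))) = η.prod (seqLaw η) := by
  conv_lhs => rw [← map_consSeq η]
  rw [Measure.map_map measurable_head_tail measurable_consSeq]
  exact Measure.map_id

theorem map_heads_tails (M : ℕ) :
    (Measure.pi fun _ : Fin M => seqLaw η).map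
        (fun ω => ((fun i => ω i 0), fun i k => ω i (k + 1))) =
      (Measure.pi fun _ : Fin M => η).prod (Measure.pi fun _ : Fin M => seqLaw η) := by
  have h1 := Measure.pi_map_pi (ι := Fin M) (μ := fun _ => seqLaw η)
    (f := fun _ (b : ℕ → α) => (b 0, fun k => b (k + 1)))
    (hμ := fun _ => by rw [map_head_tail]; infer_instance)
    fun _ => measurable_head_tail.aemeasurable
  simp only [map_head_tail] at h1
  rw [← (measurePreserving_arrowProdEquivProdArrow α (ℕ → α) (Fin M) (fun _ => η)
    fun _ => seqLaw η).map_eq, ← h1, Measure.map_map (by fun_prop) (by fun_prop)]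
  rfl

/-- The family over `Fin M × ℕ` is regrouped by currying into one independent sequence for each
token. -/
theorem map_eq_pi_seqLaw {Ω : Type*} [MeasurableSpace Ω] {μ : Measure Ω} {M : ℕ}
    {Y : Fin M → ℕ → Ω → α} (hY : ∀ i k, Measurable (Y i k))
    (hind : iIndepFun (fun p : Fin M × ℕ => Y p.1 p.2) μ) (hlaw : ∀ i k, μ.map (Y i k) = η) :
    μ.map (fun ω i k => Y i k ω) = Measure.pi fun _ : Fin M => seqLaw η := by
  have h1 := hind.map_fun_eq_infinitePi_map fun p : Fin M × ℕ => hY p.1 p.2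
  simp only [hlaw] at h1
  have h2 := Measure.infinitePi_map_curry (ι := Fin M) (κ := ℕ) fun _ _ => η
  unfold seqLaw
  rw [← Measure.infinitePi_eq_pi, ← h2, ← h1, Measure.map_map (by fun_prop) (by fun_prop)]
  rfl

end Sequences

/-! ### The formula for a given movement of the tokens -/

section Transfer

variable {E : Type*} [MeasurableSpace E] {ν : Measure E} [IsProbabilityMeasure ν]
  {X : E → ℝ≥0 → ℕ} {N : ℕ} {Ω : Type*} [MeasurableSpace Ω] {μ : Measure Ω}

theorem IsTokenPath.measurableSet_collision (hX : IsTokenPath X) (a b k : ℕ) (t : ℝ≥0) :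
    MeasurableSet {q : E × E |
      meetTime N a b (X q.1) (X q.2) ≤ t ∧ MeetsWith N a b (X q.1) (X q.2) k} := by
  have h1 : ∀ t, Measurable fun q : E × E => X q.1 t := fun t =>
    (hX.measurable t).comp measurable_fst
  have h2 : ∀ t, Measurable fun q : E × E => X q.2 t := fun t =>
    (hX.measurable t).comp measurable_snd
  have h3 : ∀ q : E × E, IsRightConstant (X q.1) := fun q => hX.rightConstant q.1
  have h4 : ∀ q : E × E, IsRightConstant (X q.2) := fun q => hX.rightConstant q.2
  exact (measurableSet_le (measurable_meetTime h1 h2 h3 h4) measurable_const).inter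
    (measurableSet_meetsWith h1 h2 h3 h4 k)

theorem IsTokenPath.meanSign_eq (hX : IsTokenPath X) (t : ℝ≥0) (a b : ℕ) :
    meanSign N ν X t a b =
      (ν.prod ν).real {q | meetTime N a b (X q.1) (X q.2) ≤ t ∧ MeetsWith N a b (X q.1) (X q.2) 0} -
      (ν.prod ν).real
        {q | meetTime N a b (X q.1) (X q.2) ≤ t ∧ MeetsWith N a b (X q.1) (X q.2) N} := by
  have hint : ∀ k, Integrable (fun q : E × E => propIndicator
      (meetTime N a b (X q.1) (X q.2) ≤ t ∧ MeetsWith N a b (X q.1) (X q.2) k)) (ν.prod ν) := by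
    intro k
    refine Integrable.of_bound (measurable_propIndicator
      (hX.measurableSet_collision a b k t)).aestronglyMeasurable 1
      (Filter.Eventually.of_forall fun q => ?_)
    rw [Real.norm_eq_abs, abs_of_nonneg (propIndicator_nonneg _)]
    exact propIndicator_le_one _
  unfold meanSign collisionSign
  rw [integral_sub (hint 0) (hint N), integral_propIndicator (hX.measurableSet_collision a b 0 t),
    integral_propIndicator (hX.measurableSet_collision a b N t)]

/-- All events depend only on the paths, so their probabilities can be computed on the product
space. Agreement of `d` with the canonical paths is needed only almost surely. -/
theorem IsTokenPath.formula_of_law {m : ℕ} (hX : IsTokenPath X)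
    (hR : HasRenewal (2 * m + 1) ν X) (hN : 0 < N) {z : Fin (2 * m + 1) → ℕ}
    (hz : IsOrdered N z Finset.univ) {d : Fin (2 * m + 1) → ℝ≥0 → Ω → ℕ}
    {Y : Ω → Fin (2 * m + 1) → E} (hY : Measurable Y)
    (hlaw : μ.map Y = Measure.pi fun _ : Fin (2 * m + 1) => ν)
    (hd : ∀ᵐ ω ∂μ, ∀ i t, d i t ω = X (Y ω i) t) (t : ℝ≥0) :
    μ.real {ω | stabTime N z (fun i s => d i s ω) ≤ t} =
      ∑ w ∈ pairings (2 * m + 1), pairingSign w *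
        ∏ p ∈ w,
          (μ.real {ω | pairTime N z (fun i s => d i s ω) p.1 p.2 ≤ t ∧
              CollideDown N z (fun i s => d i s ω) p.1 p.2} -
            μ.real {ω | pairTime N z (fun i s => d i s ω) p.1 p.2 ≤ t ∧
              CollideUp N z (fun i s => d i s ω) p.1 p.2}) := by
  have hpaths : ∀ᵐ ω ∂μ, (fun i s => d i s ω) = paths X (Y ω) := by
    filter_upwards [hd] with ω hω
    funext i s
    exact hω i s
  have htransfer : ∀ P : (Fin (2 * m + 1) → ℝ≥0 → ℕ) → Prop,
      μ.real {ω | P fun i s => d i s ω} = μ.real {ω | P (paths X (Y ω))} := by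
    intro P
    refine measureReal_congr ?_
    filter_upwards [hpaths] with ω hω
    exact propext (by change P _ ↔ P _; rw [hω])
  have hstab : MeasurableSet {ω : Fin (2 * m + 1) → E | stabTime N z (paths X ω) ≤ t} := by
    simp only [stabTime_eq_stabFrom]
    exact measurableSet_le (hX.measurable_stabFrom _ z) measurable_const
  have hleft : μ.real {ω | stabTime N z (fun i s => d i s ω) ≤ t} =
      (Measure.pi fun _ : Fin (2 * m + 1) => ν).real {ω | stabTime N z (paths X ω) ≤ t} := by
    rw [htransfer fun x => stabTime N z x ≤ t, ← hlaw, map_measureReal_apply hY hstab]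
    rfl
  have hpair : ∀ (p : Fin (2 * m + 1) × Fin (2 * m + 1)) (k : ℕ), p.1 ≠ p.2 →
      μ.real {ω | meetTime N (z p.1) (z p.2) (X (Y ω p.1)) (X (Y ω p.2)) ≤ t ∧
        MeetsWith N (z p.1) (z p.2) (X (Y ω p.1)) (X (Y ω p.2)) k} =
      (ν.prod ν).real {q | meetTime N (z p.1) (z p.2) (X q.1) (X q.2) ≤ t ∧
        MeetsWith N (z p.1) (z p.2) (X q.1) (X q.2) k} := by
    intro p k hp
    have h1 := Measure.infinitePi_map_eval_prod (P := fun _ : Fin (2 * m + 1) => ν) hp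
    rw [Measure.infinitePi_eq_pi, ← hlaw, Measure.map_map (by fun_prop) hY] at h1
    rw [← h1, map_measureReal_apply (by fun_prop) (hX.measurableSet_collision _ _ k t)]
    rfl
  rw [hleft, hX.stabTime_formula hR hN hz t]
  refine Finset.sum_congr rfl fun w hw => ?_
  congr 1
  refine Finset.prod_congr rfl fun p hp => ?_
  have hne := ((mem_pairings.1 hw).2.1 p hp).ne
  rw [hX.meanSign_eq, ← hpair p 0 hne, ← hpair p N hne,
    htransfer fun x => pairTime N z x p.1 p.2 ≤ t ∧ CollideDown N z x p.1 p.2,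
    htransfer fun x => pairTime N z x p.1 p.2 ≤ t ∧ CollideUp N z x p.1 p.2]
  have hdown : ∀ x : Fin (2 * m + 1) → ℝ≥0 → ℕ, CollideDown N z x p.1 p.2 ↔
      MeetsWith N (z p.1) (z p.2) (x p.1) (x p.2) 0 := fun x => Iff.rfl
  have hup : ∀ x : Fin (2 * m + 1) → ℝ≥0 → ℕ, CollideUp N z x p.1 p.2 ↔
      MeetsWith N (z p.1) (z p.2) (x p.1) (x p.2) N := fun x => Iff.rfl
  simp only [hdown, hup]
  rfl

theorem ae_of_map_eq_prod {α β γ : Type*} [MeasurableSpace α] [MeasurableSpace β]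
    [MeasurableSpace γ] {P : Measure α} {ρ : Measure β} {Q : Measure γ} [SFinite Q] [NeZero Q]
    {S : α → β × γ} (hS : Measurable S) (hmap : P.map S = ρ.prod Q) {p : β → Prop}
    (hp : MeasurableSet {b | p b}) (h : ∀ᵐ ω ∂P, p (S ω).1) : ∀ᵐ b ∂ρ, p b := by
  have h1 : ∀ᵐ q ∂(ρ.prod Q), p q.1 := by
    have h2 : MeasurableSet {q : β × γ | p q.1} := measurable_fst hp
    rw [← hmap]
    exact (ae_map_iff hS.aemeasurable h2).2 h
  have h2 := Measure.ae_ae_of_ae_prod h1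
  filter_upwards [h2] with b hb
  exact hb.exists.choose_spec

end Transfer

/-! ### The synchronous protocol -/

section Synchronous

/-- The number of passings of a token that is passed in step `k + 1` iff `b k = true`. -/
noncomputable def syncPath (b : ℕ → Bool) (t : ℝ≥0) : ℕ :=
  ((Finset.range ⌊t⌋₊).filter fun k => b k = true).card

theorem syncPath_one_add (b : ℕ → Bool) (t : ℝ≥0) :
    syncPath b (1 + t) = (if b 0 = true then 1 else 0) + syncPath (fun k => b (k + 1)) t := by
  unfold syncPath
  rw [add_comm 1 t, Nat.floor_add_one (zero_le), Finset.card_filter, Finset.card_filter,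
    Finset.sum_range_succ', add_comm]

theorem syncPath_of_lt_one (b : ℕ → Bool) {t : ℝ≥0} (ht : t < 1) : syncPath b t = 0 := by
  unfold syncPath
  rw [Nat.floor_eq_zero.2 ht]
  simp

theorem isTokenPath_syncPath : IsTokenPath syncPath where
  measurable t := by
    simp only [syncPath, Finset.card_filter]
    refine Finset.measurable_fun_sum _ fun k _ => ?_
    exact (Measurable.of_discrete (f := fun c : Bool => if c = true then 1 else 0)).comp
      (measurable_pi_apply k)
  rightConstant b t := by
    refine ⟨⌊t⌋₊ + 1 - t, tsub_pos_of_lt (Nat.lt_floor_add_one t), fun t' h1 h2 => ?_⟩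
    rw [add_tsub_cancel_of_le (Nat.lt_floor_add_one t).le] at h2
    have : ⌊t'⌋₊ = ⌊t⌋₊ := by
      rw [Nat.floor_eq_iff (zero_le)]
      exact ⟨(Nat.floor_le (zero_le)).trans h1, h2⟩
    unfold syncPath
    rw [this]
  zero b := syncPath_of_lt_one b one_pos

/-- The jump time is the constant `1`, even if nobody is passed in the first step (then `e = 0`).
`S` splits off the first choice of every token. -/
theorem hasRenewal_syncPath (M : ℕ) (η : Measure Bool) [IsProbabilityMeasure η] :
    HasRenewal M (seqLaw η) syncPath := by
  let f : (Fin M → Bool) → ℝ≥0 × (Fin M → ℕ) := fun h => (1, fun i => if h i = true then 1 else 0)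
  have hf : Measurable f := Measurable.of_discrete
  let S : (Fin M → ℕ → Bool) → (ℝ≥0 × (Fin M → ℕ)) × (Fin M → ℕ → Bool) :=
    fun ω => (f fun i => ω i 0, fun i k => ω i (k + 1))
  have hS : Measurable S := by
    refine Measurable.prodMk (hf.comp ?_) ?_ <;> fun_prop
  have hmap : (Measure.pi fun _ : Fin M => seqLaw η).map S =
      ((Measure.pi fun _ : Fin M => η).map f).prod (Measure.pi fun _ : Fin M => seqLaw η) := by
    have h := Measure.map_prod_map (Measure.pi fun _ : Fin M => η)
      (Measure.pi fun _ : Fin M => seqLaw η) hf measurable_id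
    rw [Measure.map_id] at h
    rw [h, ← map_heads_tails, Measure.map_map (hf.prodMap measurable_id) (by fun_prop)]
    rfl
  refine ⟨_, S, Measure.isProbabilityMeasure_map hf.aemeasurable, hS, hmap, ?_, ?_⟩
  · refine Filter.Eventually.of_forall fun ω => ⟨fun i t ht => syncPath_of_lt_one _ ht,
      fun i t => syncPath_one_add _ _⟩
  · rw [ae_map_iff hf.aemeasurable]
    · refine Filter.Eventually.of_forall fun h => ⟨one_pos, fun i => ?_⟩
      simp only [f]
      split_ifs <;> simp
    · have h : MeasurableSet {q : ℝ≥0 × (Fin M → ℕ) | (0 : ℝ≥0) < q.1} :=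
        measurableSet_lt measurable_const measurable_fst
      refine MeasurableSet.inter h ?_
      exact measurable_snd (MeasurableSet.of_discrete (s := {e : Fin M → ℕ | ∀ i, e i ≤ 1}))

theorem measure_bool_eq {η η' : Measure Bool} [IsProbabilityMeasure η] [IsProbabilityMeasure η']
    (h : η.real {true} = η'.real {true}) : η = η' := by
  have ht : η {true} = η' {true} := by
    rwa [measureReal_def, measureReal_def,
      ENNReal.toReal_eq_toReal_iff' (measure_ne_top _ _) (measure_ne_top _ _)] at h
  have hc : ({false} : Set Bool) = {true}ᶜ := by ext b; cases b <;> simp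
  refine Measure.ext_of_singleton fun b => ?_
  cases b
  · rw [hc, prob_compl_eq_one_sub (measurableSet_singleton _),
      prob_compl_eq_one_sub (measurableSet_singleton _), ht]
  · exact ht

theorem IsSynchronousMovement.formula {N m : ℕ} (hN : 0 < N) {z : Fin (2 * m + 1) → ℕ}
    (hz : IsOrdered N z Finset.univ) {Ω : Type*} [MeasurableSpace Ω] {μ : Measure Ω}
    [IsProbabilityMeasure μ] {d : Fin (2 * m + 1) → ℝ≥0 → Ω → ℕ} {r : ℝ}
    (hd : IsSynchronousMovement μ r d) (t : ℝ≥0) :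
    μ.real {ω | stabTime N z (fun i s => d i s ω) ≤ t} =
      ∑ w ∈ pairings (2 * m + 1), pairingSign w *
        ∏ p ∈ w,
          (μ.real {ω | pairTime N z (fun i s => d i s ω) p.1 p.2 ≤ t ∧
              CollideDown N z (fun i s => d i s ω) p.1 p.2} -
            μ.real {ω | pairTime N z (fun i s => d i s ω) p.1 p.2 ≤ t ∧
              CollideUp N z (fun i s => d i s ω) p.1 p.2}) := by
  obtain ⟨B, hB, hind, hr, hdB⟩ := hd
  have hprob : ∀ i k, IsProbabilityMeasure (μ.map (B i k)) := fun i k =>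
    Measure.isProbabilityMeasure_map (hB i k).aemeasurable
  have hreal : ∀ i k, (μ.map (B i k)).real {true} = r := by
    intro i k
    rw [map_measureReal_apply (hB i k) (measurableSet_singleton _)]
    exact hr i k
  have hlaw : ∀ i k, μ.map (B i k) = μ.map (B 0 0) := fun i k =>
    measure_bool_eq ((hreal i k).trans (hreal 0 0).symm)
  exact isTokenPath_syncPath.formula_of_law (hasRenewal_syncPath _ (μ.map (B 0 0))) hN hz
    (Y := fun ω i k => B i k ω) (by fun_prop) (map_eq_pi_seqLaw _ hB hind hlaw)
    (Filter.Eventually.of_forall fun ω i t => hdB i t ω) t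

end Synchronous

/-! ### The asynchronous protocol -/

section AsynchronousPath

/-- The sequence `b` of holding times is positive and has an infinite sum. -/
def IsProper (b : ℕ → ℝ) : Prop :=
  (∀ k, 0 < b k) ∧ ∀ C : ℕ, ∃ n, (C : ℝ) < ∑ l ∈ Finset.range n, b l

open Classical in
/-- The number of passings of a token with the holding times `b`, if `b` is proper. -/
noncomputable def asyncPath (b : ℕ → ℝ) (t : ℝ≥0) : ℕ :=
  if IsProper b then {k : ℕ | ∑ l ∈ Finset.range (k + 1), b l ≤ (t : ℝ)}.ncard else 0

variable {b : ℕ → ℝ} {t : ℝ≥0}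

theorem asyncPath_of_proper (h : IsProper b) (t : ℝ≥0) :
    asyncPath b t = {k : ℕ | ∑ l ∈ Finset.range (k + 1), b l ≤ (t : ℝ)}.ncard := if_pos h

theorem IsProper.strictMono (h : IsProper b) : StrictMono fun n => ∑ l ∈ Finset.range n, b l :=
  strictMono_nat_of_lt_succ fun n => by
    rw [Finset.sum_range_succ]
    exact lt_add_of_pos_right _ (h.1 n)

theorem IsProper.asyncPath_eq (h : IsProper b) {n : ℕ}
    (h1 : ∑ l ∈ Finset.range n, b l ≤ t) (h2 : t < ∑ l ∈ Finset.range (n + 1), b l) :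
    asyncPath b t = n := by
  have hset : {k : ℕ | ∑ l ∈ Finset.range (k + 1), b l ≤ (t : ℝ)} = Finset.range n := by
    ext k
    simp only [Set.mem_ofPred_eq, Finset.coe_range, Set.mem_Iio]
    constructor
    · intro hk
      exact Nat.lt_of_succ_lt_succ (h.strictMono.lt_iff_lt.1 (hk.trans_lt h2))
    · intro hk
      exact (h.strictMono.monotone (Nat.succ_le_of_lt hk)).trans h1
  rw [asyncPath_of_proper h, hset, Set.ncard_coe_finset, Finset.card_range]

theorem IsProper.asyncPath_spec (h : IsProper b) (t : ℝ≥0) :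
    ∑ l ∈ Finset.range (asyncPath b t), b l ≤ t ∧
      t < ∑ l ∈ Finset.range (asyncPath b t + 1), b l := by
  classical
  have hex : ∃ n, (t : ℝ) < ∑ l ∈ Finset.range n, b l := by
    obtain ⟨C, hC⟩ := exists_nat_gt (t : ℝ)
    obtain ⟨n, hn⟩ := h.2 C
    exact ⟨n, hC.trans hn⟩
  obtain ⟨n, hn⟩ : ∃ n, Nat.find hex = n + 1 := by
    refine Nat.exists_eq_succ_of_ne_zero fun h0 => ?_
    have := Nat.find_spec hex
    rw [h0, Finset.range_zero, Finset.sum_empty] at this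
    exact absurd this (not_lt.2 t.coe_nonneg)
  have h1 : ∑ l ∈ Finset.range n, b l ≤ t := not_lt.1 (Nat.find_min hex (by omega))
  have h2 : (t : ℝ) < ∑ l ∈ Finset.range (n + 1), b l := by
    rw [← hn]
    exact Nat.find_spec hex
  rw [h.asyncPath_eq h1 h2]
  exact ⟨h1, h2⟩

theorem IsProper.asyncPath_eq_iff (h : IsProper b) {n : ℕ} : asyncPath b t = n ↔
    ∑ l ∈ Finset.range n, b l ≤ t ∧ t < ∑ l ∈ Finset.range (n + 1), b l := by
  refine ⟨?_, fun hn => h.asyncPath_eq hn.1 hn.2⟩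
  rintro rfl
  exact h.asyncPath_spec t

theorem measurableSet_isProper : MeasurableSet {b : ℕ → ℝ | IsProper b} := by
  have h1 : MeasurableSet {b : ℕ → ℝ | ∀ k, 0 < b k} := by
    rw [Set.ofPred_forall]
    exact MeasurableSet.iInter fun k => measurableSet_lt measurable_const (measurable_pi_apply k)
  have h2 : MeasurableSet {b : ℕ → ℝ | ∀ C : ℕ, ∃ n, (C : ℝ) < ∑ l ∈ Finset.range n, b l} := by
    rw [Set.ofPred_forall]
    refine MeasurableSet.iInter fun C => ?_
    rw [Set.ofPred_exists]
    exact MeasurableSet.iUnion fun n => measurableSet_lt measurable_const (by fun_prop)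
  exact h1.inter h2

/-- The properties are required for every sample. Giving improper sequences the constant path `0`
ensures this; for proper ones, each time lies in exactly one interval between successive passings.
-/
theorem isTokenPath_asyncPath : IsTokenPath asyncPath where
  measurable t := by
    refine measurable_to_countable' fun n => ?_
    have hset : (fun b => asyncPath b t) ⁻¹' {n} =
        ({b | IsProper b} ∩ ({b | ∑ l ∈ Finset.range n, b l ≤ t} ∩
          {b | t < ∑ l ∈ Finset.range (n + 1), b l})) ∪ ({b | IsProper b}ᶜ ∩ {_b | 0 = n}) := by
      ext b
      by_cases hb : IsProper b
      · simp [hb, hb.asyncPath_eq_iff]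
      · simp [hb, asyncPath]
    rw [hset]
    exact (measurableSet_isProper.inter ((measurableSet_le (by fun_prop) measurable_const).inter
      (measurableSet_lt measurable_const (by fun_prop)))).union
      (measurableSet_isProper.compl.inter (MeasurableSet.const _))
  rightConstant b t := by
    by_cases hb : IsProper b
    · obtain ⟨h1, h2⟩ := hb.asyncPath_spec t
      refine ⟨(∑ l ∈ Finset.range (asyncPath b t + 1), b l - t).toNNReal,
        Real.toNNReal_pos.2 (sub_pos.2 h2), fun t' ht ht' => ?_⟩
      refine hb.asyncPath_eq (h1.trans (NNReal.coe_le_coe.2 ht)) ?_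
      have := NNReal.coe_lt_coe.2 ht'
      rw [NNReal.coe_add, Real.coe_toNNReal _ (sub_pos.2 h2).le] at this
      linarith
    · exact ⟨1, one_pos, fun t' _ _ => by simp only [asyncPath, if_neg hb]⟩
  zero b := by
    by_cases hb : IsProper b
    · exact hb.asyncPath_eq (by simp) (by simpa using hb.1 0)
    · exact if_neg hb

theorem IsProper.asyncPath_of_lt (h : IsProper b) (ht : t < b 0) : asyncPath b t = 0 :=
  h.asyncPath_eq (by simp) (by simpa using ht)

theorem IsProper.tail (h : IsProper b) : IsProper fun k => b (k + 1) := by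
  refine ⟨fun k => h.1 (k + 1), fun C => ?_⟩
  obtain ⟨C', hC'⟩ := exists_nat_gt (C + b 0)
  obtain ⟨n, hn⟩ := h.2 C'
  refine ⟨n, ?_⟩
  have := h.strictMono.monotone (Nat.le_succ n)
  simp only [Nat.succ_eq_add_one, Finset.sum_range_succ'] at this
  linarith

theorem IsProper.consSeq (h : IsProper b) {a : ℝ} (ha : 0 < a) : IsProper (consSeq a b) := by
  refine ⟨fun k => ?_, fun C => ?_⟩
  · cases k with
    | zero => exact ha
    | succ k => exact h.1 k
  · obtain ⟨n, hn⟩ := h.2 C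
    refine ⟨n + 1, ?_⟩
    rw [Finset.sum_range_succ']
    exact hn.trans (lt_add_of_pos_right _ ha)

theorem IsProper.asyncPath_jump (h : IsProper b) {s : ℝ≥0} (hs : (s : ℝ) = b 0) (t : ℝ≥0) :
    asyncPath b (s + t) = 1 + asyncPath (fun k => b (k + 1)) t := by
  obtain ⟨h1, h2⟩ := h.tail.asyncPath_spec t
  rw [add_comm 1]
  refine h.asyncPath_eq ?_ ?_ <;>
  · rw [Finset.sum_range_succ', NNReal.coe_add]
    linarith

/-- A token that is still waiting at time `s` continues like one whose first holding time is
shortened by `s`. -/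
theorem IsProper.asyncPath_wait (h : IsProper b) {s : ℝ≥0} (hs : s < b 0) (t : ℝ≥0) :
    asyncPath b (s + t) = asyncPath (Herman.consSeq (b 0 - s) fun k => b (k + 1)) t := by
  obtain ⟨h1, h2⟩ := (h.tail.consSeq (sub_pos.2 hs)).asyncPath_spec t
  generalize asyncPath (Herman.consSeq (b 0 - s) fun k => b (k + 1)) t = n at h1 h2
  have hsum : ∀ k, ∑ l ∈ Finset.range (k + 1), Herman.consSeq (b 0 - s) (fun k => b (k + 1)) l =
      ∑ l ∈ Finset.range (k + 1), b l - s := by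
    intro k
    simp only [Finset.sum_range_succ', Herman.consSeq]
    ring
  rw [hsum] at h2
  refine h.asyncPath_eq ?_ ?_
  · cases n with
    | zero => simpa using (s + t).coe_nonneg
    | succ n =>
      rw [hsum] at h1
      rw [NNReal.coe_add]
      linarith
  · rw [NNReal.coe_add]
    linarith

end AsynchronousPath

/-! ### The exponential distribution -/

section Exponential

variable {rate : ℝ}

theorem expMeasure_Iic (hr : 0 < rate) (x : ℝ) : expMeasure rate (Set.Iic x) =
    ENNReal.ofReal (if 0 ≤ x then 1 - Real.exp (-(rate * x)) else 0) := by
  have := isProbabilityMeasure_expMeasure hr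
  rw [← cdf_expMeasure_eq hr, ofReal_cdf]

theorem ae_pos_expMeasure (hr : 0 < rate) : ∀ᵐ x ∂(expMeasure rate), 0 < x := by
  have h : expMeasure rate (Set.Iic 0) = 0 := by
    rw [expMeasure_Iic hr]
    simp
  rw [ae_iff]
  simp only [not_lt]
  exact h

theorem nullSingletonClass_expMeasure : NullSingletonClass (expMeasure rate) := by
  rw [show expMeasure rate = volume.withDensity (exponentialPDF rate) from rfl]
  infer_instance

theorem expMeasure_Ioc (hr : 0 < rate) {a b : ℝ} (ha : 0 ≤ a) (hab : a ≤ b) :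
    expMeasure rate (Set.Ioc a b) =
      ENNReal.ofReal (Real.exp (-(rate * a)) - Real.exp (-(rate * b))) := by
  have := isProbabilityMeasure_expMeasure hr
  rw [← measure_cdf (expMeasure rate), StieltjesFunction.measure_Ioc, cdf_expMeasure_eq hr,
    cdf_expMeasure_eq hr, if_pos ha, if_pos (ha.trans hab)]
  congr 1
  ring

/-- The exponential distribution has no memory. -/
theorem map_sub_restrict_expMeasure (hr : 0 < rate) {s : ℝ} (hs : 0 ≤ s) :
    ((expMeasure rate).restrict (Set.Ioi s)).map (fun x => x - s) =
      ENNReal.ofReal (Real.exp (-(rate * s))) • expMeasure rate := by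
  have := isProbabilityMeasure_expMeasure hr
  refine Measure.ext_of_Iic _ _ fun a => ?_
  have hset : (fun x : ℝ => x - s) ⁻¹' Set.Iic a ∩ Set.Ioi s = Set.Ioc s (s + a) := by
    ext x
    simp only [Set.mem_inter_iff, Set.mem_preimage, Set.mem_Iic, Set.mem_Ioi, Set.mem_Ioc]
    constructor <;> rintro ⟨h1, h2⟩ <;> constructor <;> linarith
  rw [Measure.map_apply (by fun_prop) measurableSet_Iic,
    Measure.restrict_apply ((by fun_prop : Measurable fun x : ℝ => x - s) measurableSet_Iic), hset,
    Measure.smul_apply, smul_eq_mul, expMeasure_Iic hr]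
  split_ifs with h
  · rw [expMeasure_Ioc hr hs (by linarith), ← ENNReal.ofReal_mul (Real.exp_nonneg _), mul_sub,
      mul_one, ← Real.exp_add]
    congr 4
    ring
  · rw [Set.Ioc_eq_empty (by linarith)]
    simp

/-- For divergence it suffices that almost surely, for each `C`, a single holding time exceeds `C`.
The probability that the first `K` of them are at most `C` is a `K`-th power of a number below `1`.
-/
theorem ae_isProper (hr : 0 < rate) [IsProbabilityMeasure (expMeasure rate)] :
    ∀ᵐ b ∂(seqLaw (expMeasure rate)), IsProper b := by
  have hpos : ∀ᵐ b ∂(seqLaw (expMeasure rate)), ∀ k, 0 < b k := by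
    rw [ae_all_iff]
    intro k
    exact (measurePreserving_eval_infinitePi (fun _ : ℕ => expMeasure rate)
      k).quasiMeasurePreserving.ae (ae_pos_expMeasure hr)
  have hbdd : ∀ C : ℕ, ∀ᵐ b ∂(seqLaw (expMeasure rate)), ∃ k, (C : ℝ) < b k := by
    intro C
    have hlt : expMeasure rate (Set.Iic (C : ℝ)) < 1 := by
      rw [expMeasure_Iic hr, if_pos (Nat.cast_nonneg C), ENNReal.ofReal_lt_one]
      linarith [Real.exp_pos (-(rate * C))]
    have hle : ∀ K : ℕ, seqLaw (expMeasure rate) {b | ¬∃ k, (C : ℝ) < b k} ≤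
        expMeasure rate (Set.Iic (C : ℝ)) ^ K := by
      intro K
      have h := Measure.infinitePi_pi (fun _ : ℕ => expMeasure rate) (s := Finset.range K)
        (t := fun _ => Set.Iic (C : ℝ)) fun _ _ => measurableSet_Iic
      rw [Finset.prod_const, Finset.card_range] at h
      rw [← h]
      refine measure_mono fun b hb k _ => ?_
      simp only [Set.mem_ofPred_eq, not_exists, not_lt] at hb
      exact hb k
    rw [ae_iff]
    exact le_antisymm (ge_of_tendsto' (ENNReal.tendsto_pow_atTop_nhds_zero_of_lt_one hlt) hle)
      (zero_le)
  filter_upwards [hpos, ae_all_iff.2 hbdd] with b h1 h2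
  refine ⟨h1, fun C => ?_⟩
  obtain ⟨k, hk⟩ := h2 C
  refine ⟨k + 1, hk.trans_le ?_⟩
  exact Finset.single_le_sum (fun l _ => (h1 l).le) (Finset.self_mem_range_succ k)

end Exponential

/-! ### The first passing among independent exponential holding times -/

section AsynchronousRenewal

variable {n : ℕ}

/-- The `i`-th entry is strictly smaller than all other ones. -/
def minSet (i : Fin (n + 1)) : Set (Fin (n + 1) → ℝ) := {h | ∀ j, h i < h (i.succAbove j)}

theorem measurableSet_minSet (i : Fin (n + 1)) : MeasurableSet (minSet i) := by
  unfold minSet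
  rw [Set.ofPred_forall]
  exact MeasurableSet.iInter fun j => measurableSet_lt (by fun_prop) (by fun_prop)

theorem mem_minSet {i : Fin (n + 1)} {h : Fin (n + 1) → ℝ} :
    h ∈ minSet i ↔ ∀ j, j ≠ i → h i < h j := by
  constructor
  · intro hi j hj
    obtain ⟨k, rfl⟩ := Fin.exists_succAbove_eq hj
    exact hi k
  · exact fun hi j => hi _ (Fin.succAbove_ne i j)

/-- The minimum `h i`, and the differences of the other entries and the minimum. -/
def excess (i : Fin (n + 1)) (h : Fin (n + 1) → ℝ) : ℝ × (Fin n → ℝ) :=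
  (h i, fun j => h (i.succAbove j) - h i)

theorem measurable_excess (i : Fin (n + 1)) : Measurable (excess i) := by
  unfold excess
  fun_prop

/-- Lack of memory in all coordinates at once; the factor is the probability that all of them exceed
`s`. -/
theorem pi_expMeasure_shift {rate : ℝ} (hr : 0 < rate) [IsProbabilityMeasure (expMeasure rate)]
    {s : ℝ} (hs : 0 ≤ s) {B : Set (Fin n → ℝ)} (hB : MeasurableSet B) :
    (Measure.pi fun _ : Fin n => expMeasure rate) {g | (∀ j, s < g j) ∧ (fun j => g j - s) ∈ B} =
      ENNReal.ofReal (Real.exp (-(rate * s))) ^ n *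
        (Measure.pi fun _ : Fin n => expMeasure rate) B := by
  have h1 := Measure.pi_map_pi (ι := Fin n)
    (μ := fun _ => (expMeasure rate).restrict (Set.Ioi s)) (f := fun _ (x : ℝ) => x - s)
    fun _ => (by fun_prop : Measurable fun x : ℝ => x - s).aemeasurable
  rw [← Measure.restrict_pi_pi] at h1
  simp only [map_sub_restrict_expMeasure hr hs] at h1
  have h2 : (Measure.pi fun _ : Fin n => ENNReal.ofReal (Real.exp (-(rate * s))) • expMeasure rate) =
      ENNReal.ofReal (Real.exp (-(rate * s))) ^ n •
        Measure.pi fun _ : Fin n => expMeasure rate := by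
    have : SigmaFinite (ENNReal.ofReal (Real.exp (-(rate * s))) • expMeasure rate) := by
      have := (expMeasure rate).smul_finite
        (ENNReal.ofReal_ne_top (r := Real.exp (-(rate * s))))
      infer_instance
    refine Measure.pi_eq fun t ht => ?_
    simp only [Measure.smul_apply, smul_eq_mul, Measure.pi_pi, Finset.prod_mul_distrib,
      Finset.prod_const, Finset.card_univ, Fintype.card_fin]
  rw [h2] at h1
  have hm : Measurable fun (g : Fin n → ℝ) j => g j - s := by fun_prop
  have h3 := congrArg (fun m => m B) h1
  simp only [Measure.smul_apply, smul_eq_mul] at h3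
  rw [Measure.map_apply hm hB, Measure.restrict_apply (hm hB)] at h3
  rw [← h3]
  congr 1
  ext g
  simp only [Set.mem_ofPred_eq, Set.mem_inter_iff, Set.mem_preimage, Set.mem_pi, Set.mem_univ,
    true_implies, Set.mem_Ioi]
  exact and_comm

/-- Given that entry `i` is the smallest one, it is independent of the excesses of the others, which
are again independent and exponentially distributed. -/
theorem map_excess {rate : ℝ} (hr : 0 < rate) [IsProbabilityMeasure (expMeasure rate)]
    (i : Fin (n + 1)) :
    ((Measure.pi fun _ : Fin (n + 1) => expMeasure rate).restrict (minSet i)).map (excess i) =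
      (((Measure.pi fun _ : Fin (n + 1) => expMeasure rate).restrict (minSet i)).map
        fun h => h i).prod (Measure.pi fun _ : Fin n => expMeasure rate) := by
  -- On rectangles, for a given minimum `s`, the condition on the excesses has a probability in
  -- which only the factor `exp (-(rate * s)) ^ n` depends on `s`.
  have key : ∀ (A : Set ℝ) (B : Set (Fin n → ℝ)), MeasurableSet A → MeasurableSet B →
      ((Measure.pi fun _ : Fin (n + 1) => expMeasure rate).restrict (minSet i)).map (excess i)
        (A ×ˢ B) = (∫⁻ s, A.indicator (fun s => ENNReal.ofReal (Real.exp (-(rate * s))) ^ n) s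
          ∂(expMeasure rate)) * (Measure.pi fun _ : Fin n => expMeasure rate) B := by
    intro A B hA hB
    let D : Set (ℝ × (Fin n → ℝ)) :=
      {p | p.1 ∈ A ∧ (∀ j, p.1 < p.2 j) ∧ (fun j => p.2 j - p.1) ∈ B}
    have hD : MeasurableSet D := by
      refine (measurable_fst hA).inter (MeasurableSet.inter ?_ ?_)
      · change MeasurableSet {p : ℝ × (Fin n → ℝ) | ∀ j, p.1 < p.2 j}
        rw [Set.ofPred_forall]
        exact MeasurableSet.iInter fun j => measurableSet_lt (by fun_prop) (by fun_prop)
      · have hm : Measurable fun (p : ℝ × (Fin n → ℝ)) j => p.2 j - p.1 := by fun_prop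
        exact hm hB
    have hpre : excess i ⁻¹' (A ×ˢ B) ∩ minSet i =
        MeasurableEquiv.piFinSuccAbove (fun _ : Fin (n + 1) => ℝ) i ⁻¹' D := by
      ext h
      change (_ ∧ _) ∧ _ ↔ _ ∧ _ ∧ _
      rw [and_assoc]
      exact and_congr_right fun _ => and_comm
    rw [Measure.map_apply (measurable_excess i) (hA.prod hB),
      Measure.restrict_apply (measurable_excess i (hA.prod hB)), hpre,
      (measurePreserving_piFinSuccAbove (fun _ : Fin (n + 1) => expMeasure rate) i).measure_preimage
        hD.nullMeasurableSet, Measure.prod_apply hD,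
      ← lintegral_mul_const _ ((by fun_prop : Measurable fun s : ℝ =>
        ENNReal.ofReal (Real.exp (-(rate * s))) ^ n).indicator hA)]
    refine lintegral_congr_ae ?_
    filter_upwards [ae_pos_expMeasure hr] with s hs
    by_cases hsA : s ∈ A
    · rw [Set.indicator_of_mem hsA, ← pi_expMeasure_shift hr hs.le hB]
      congr 1
      ext g
      exact and_iff_right hsA
    · rw [Set.indicator_of_notMem hsA, zero_mul]
      have : Prod.mk s ⁻¹' D = ∅ := by
        ext g
        exact iff_of_false (fun hg => hsA hg.1) (Set.notMem_empty g)
      rw [this, measure_empty]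
  refine (Measure.prod_eq fun A B hA hB => ?_).symm
  rw [key A B hA hB]
  congr 1
  -- The full set in place of `B` identifies the first factor as the law of the minimum on `minSet
  -- i`.
  have h1 := key A Set.univ hA MeasurableSet.univ
  rw [measure_univ, mul_one] at h1
  rw [← h1, Measure.map_apply (measurable_excess i) (hA.prod MeasurableSet.univ),
    Measure.map_apply (measurable_pi_apply i) hA]
  congr 1
  ext h
  simp [excess]

/-- The new sequence of holding times: that of token `i` is `b i`, and the sequences of the other
tokens are completed by `g`. -/
def complete {α : Type*} (i : Fin (n + 1)) (p : (Fin n → α) × (Fin (n + 1) → ℕ → α)) :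
    Fin (n + 1) → ℕ → α :=
  i.insertNth (α := fun _ => ℕ → α) (p.2 i) fun j => consSeq (p.1 j) (p.2 (i.succAbove j))

theorem complete_self {α : Type*} (i : Fin (n + 1))
    (p : (Fin n → α) × (Fin (n + 1) → ℕ → α)) : complete i p i = p.2 i := by
  simp [complete]

theorem complete_succAbove {α : Type*} (i : Fin (n + 1))
    (p : (Fin n → α) × (Fin (n + 1) → ℕ → α)) (j : Fin n) :
    complete i p (i.succAbove j) = consSeq (p.1 j) (p.2 (i.succAbove j)) := by
  simp [complete]

variable {α : Type*} [MeasurableSpace α]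

theorem measurable_complete (i : Fin (n + 1)) : Measurable (complete (α := α) i) := by
  refine measurable_pi_iff.2 ((Fin.forall_iff_succAbove i).2 ⟨?_, fun j => ?_⟩)
  · simp only [complete_self]
    fun_prop
  · simp only [complete_succAbove]
    have h := (measurable_consSeq (α := α)).comp
      (f := fun p : (Fin n → α) × (Fin (n + 1) → ℕ → α) => (p.1 j, p.2 (i.succAbove j)))
      (by fun_prop)
    exact h

/-- A fresh head is prepended to every sequence except that of `i`. The proof gives `i` a head as
well and discards it, so that the map acts coordinatewise and each coordinate keeps the law `seqLaw
η`. -/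
theorem map_complete (η : Measure α) [IsProbabilityMeasure η] (i : Fin (n + 1)) :
    ((Measure.pi fun _ : Fin n => η).prod (Measure.pi fun _ : Fin (n + 1) => seqLaw η)).map
      (complete i) = Measure.pi fun _ : Fin (n + 1) => seqLaw η := by
  classical
  let f : Fin (n + 1) → α × (ℕ → α) → ℕ → α := fun k p => if k = i then p.2 else consSeq p.1 p.2
  have hf : ∀ k, Measurable (f k) := by
    intro k
    by_cases hk : k = i
    · simp only [f, if_pos hk]
      exact measurable_snd
    · simp only [f, if_neg hk]
      exact measurable_consSeq
  have hmap : ∀ k, (η.prod (seqLaw η)).map (f k) = seqLaw η := by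
    intro k
    by_cases hk : k = i
    · simp only [f, if_pos hk]
      exact (measurePreserving_snd (μ := η) (ν := seqLaw η)).map_eq
    · simp only [f, if_neg hk]
      exact map_consSeq η
  have h1 := Measure.pi_map_pi (ι := Fin (n + 1)) (μ := fun _ => η.prod (seqLaw η)) (f := f)
    (hμ := fun k => by rw [hmap]; infer_instance) fun k => (hf k).aemeasurable
  simp only [hmap] at h1
  have h2 : (Measure.pi fun _ : Fin (n + 1) => η).map (fun h j => h (i.succAbove j)) =
      Measure.pi fun _ : Fin n => η :=
    ((measurePreserving_snd (μ := η) (ν := Measure.pi fun _ : Fin n => η)).comp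
      (measurePreserving_piFinSuccAbove (fun _ : Fin (n + 1) => η) i)).map_eq
  have h3 := Measure.map_prod_map (Measure.pi fun _ : Fin (n + 1) => η)
    (Measure.pi fun _ : Fin (n + 1) => seqLaw η)
    (by fun_prop : Measurable fun (h : Fin (n + 1) → α) (j : Fin n) => h (i.succAbove j))
    measurable_id
  rw [h2, Measure.map_id] at h3
  have hid : Measurable (Prod.map (fun (h : Fin (n + 1) → α) (j : Fin n) => h (i.succAbove j))
      (id : (Fin (n + 1) → ℕ → α) → _)) := by fun_prop
  rw [h3, Measure.map_map (measurable_complete i) hid,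
    ← (measurePreserving_arrowProdEquivProdArrow α (ℕ → α) (Fin (n + 1)) (fun _ => η)
      fun _ => seqLaw η).map_eq, Measure.map_map ((measurable_complete i).comp hid)
      (MeasurableEquiv.measurable _), ← h1]
  congr 1
  funext q
  funext k
  revert k
  refine (Fin.forall_iff_succAbove i).2 ⟨?_, fun j => ?_⟩
  · simp only [Function.comp_apply, complete_self, f, if_pos]
    rfl
  · simp only [Function.comp_apply, complete_succAbove, f, if_neg (Fin.succAbove_ne i j)]
    rfl

end AsynchronousRenewal

/-- Maps on the sets of a partition whose image laws all have the same second factor can be put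
together. -/
theorem exists_map_eq_prod {α β γ ι : Type*} [MeasurableSpace α] [MeasurableSpace β]
    [MeasurableSpace γ] [Countable ι] [Nonempty ι] {P : Measure α} [IsProbabilityMeasure P]
    {Q : Measure γ} [IsProbabilityMeasure Q] {G : ι → Set α} (hG : ∀ i, MeasurableSet (G i))
    (hdisj : Pairwise (Function.onFun Disjoint G)) (hcover : ∀ᵐ ω ∂P, ω ∈ ⋃ i, G i)
    {S : ι → α → β × γ} (hS : ∀ i, Measurable (S i)) {ρ : ι → Measure β} [∀ i, SFinite (ρ i)]
    (hmap : ∀ i, (P.restrict (G i)).map (S i) = (ρ i).prod Q) :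
    ∃ (ρ' : Measure β) (S' : α → β × γ), IsProbabilityMeasure ρ' ∧ Measurable S' ∧
      P.map S' = ρ'.prod Q ∧ ∀ i, Set.EqOn S' (S i) (G i) := by
  obtain ⟨S', hS', heq⟩ := exists_measurable_piecewise G hG S hS fun i j hij ω hω =>
    absurd hω.2 (Set.disjoint_left.1 (hdisj hij) hω.1)
  have hprod : P.map S' = (Measure.sum ρ).prod Q := by
    have h1 : P.restrict (⋃ i, G i) = P := Measure.restrict_eq_self_of_ae_mem hcover
    conv_lhs => rw [← h1, Measure.restrict_iUnion hdisj hG]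
    rw [Measure.map_sum hS'.aemeasurable, Measure.prod_sum_left]
    congr 1
    funext i
    rw [← hmap i]
    refine Measure.map_congr ?_
    filter_upwards [ae_restrict_mem (hG i)] with ω hω
    exact heq i hω
  -- The single `ρ i` need not have mass `1`; the mass of their sum is found by comparing total
  -- masses.
  refine ⟨_, S', ⟨?_⟩, hS', hprod, heq⟩
  have h := congrArg (fun m => m Set.univ) hprod
  beta_reduce at h
  rw [Measure.map_apply hS' MeasurableSet.univ, Set.preimage_univ, measure_univ,
    ← Set.univ_prod_univ, Measure.prod_prod, measure_univ (μ := Q), mul_one] at h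
  exact h.symm

/-! ### Renewal and the formula for the asynchronous protocol -/

section AsynchronousFormula

variable {n : ℕ} {rate : ℝ}

/-- The configuration of the holding times after the first jump, which is that of token `i`. -/
noncomputable def asyncShift (i : Fin (n + 1)) (ω : Fin (n + 1) → ℕ → ℝ) :
    (ℝ≥0 × (Fin (n + 1) → ℕ)) × (Fin (n + 1) → ℕ → ℝ) :=
  (((ω i 0).toNNReal, Pi.single i 1),
    complete i ((excess i fun j => ω j 0).2, fun j k => ω j (k + 1)))

theorem measurable_asyncShift (i : Fin (n + 1)) : Measurable (asyncShift i) := by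
  have h1 : Measurable fun ω : Fin (n + 1) → ℕ → ℝ =>
      ((excess i fun j => ω j 0).2, fun j k => ω j (k + 1)) := by
    unfold excess
    fun_prop
  have h2 := (measurable_complete (α := ℝ) i).comp h1
  have h3 : Measurable fun ω : Fin (n + 1) → ℕ → ℝ => (ω i 0).toNNReal := by fun_prop
  exact (h3.prodMk measurable_const).prodMk h2

/-- The heads are split off from the tails, `map_excess` makes the remaining waiting times fresh and
independent of the minimum, and `map_complete` attaches them to the tails. -/
theorem map_asyncShift (hr : 0 < rate) [IsProbabilityMeasure (expMeasure rate)]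
    (i : Fin (n + 1)) :
    ((Measure.pi fun _ : Fin (n + 1) => seqLaw (expMeasure rate)).restrict
      {ω | (fun j => ω j 0) ∈ minSet i}).map (asyncShift i) =
      ((((Measure.pi fun _ : Fin (n + 1) => expMeasure rate).restrict (minSet i)).map
        fun h => h i).map fun s => (s.toNNReal, Pi.single i 1)).prod
        (Measure.pi fun _ : Fin (n + 1) => seqLaw (expMeasure rate)) := by
  have hht : Measurable fun ω : Fin (n + 1) → ℕ → ℝ =>
      ((fun j => ω j 0), fun j k => ω j (k + 1)) := by fun_prop
  have hf : Measurable fun s : ℝ => (s.toNNReal, (Pi.single i 1 : Fin (n + 1) → ℕ)) := by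
    fun_prop
  have hex := (measurable_excess i).prodMap (measurable_id (α := Fin (n + 1) → ℕ → ℝ))
  have hrestrict : ((Measure.pi fun _ : Fin (n + 1) => seqLaw (expMeasure rate)).restrict
      {ω | (fun j => ω j 0) ∈ minSet i}).map (fun ω => ((fun j => ω j 0), fun j k => ω j (k + 1))) =
      ((Measure.pi fun _ : Fin (n + 1) => expMeasure rate).restrict (minSet i)).prod
        (Measure.pi fun _ : Fin (n + 1) => seqLaw (expMeasure rate)) := by
    have h := Measure.prod_restrict (μ := Measure.pi fun _ : Fin (n + 1) => expMeasure rate)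
      (ν := Measure.pi fun _ : Fin (n + 1) => seqLaw (expMeasure rate)) (minSet i) Set.univ
    rw [Measure.restrict_univ] at h
    rw [h, ← map_heads_tails, Measure.restrict_map hht
      ((measurableSet_minSet i).prod MeasurableSet.univ)]
    congr 2
    ext ω
    simp
  have h1 := Measure.map_prod_map
    ((Measure.pi fun _ : Fin (n + 1) => expMeasure rate).restrict (minSet i))
    (Measure.pi fun _ : Fin (n + 1) => seqLaw (expMeasure rate)) (measurable_excess i)
    measurable_id
  rw [Measure.map_id, map_excess hr, ← hrestrict, Measure.map_map hex hht] at h1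
  have h2 := Measure.map_prod_map
    (((Measure.pi fun _ : Fin (n + 1) => expMeasure rate).restrict (minSet i)).map fun h => h i)
    ((Measure.pi fun _ : Fin n => expMeasure rate).prod
      (Measure.pi fun _ : Fin (n + 1) => seqLaw (expMeasure rate))) hf (measurable_complete i)
  rw [map_complete] at h2
  rw [h2, ← Measure.prodAssoc_prod, h1, Measure.map_map MeasurableEquiv.prodAssoc.measurable
    (hex.comp hht), Measure.map_map (hf.prodMap (measurable_complete i))
    (MeasurableEquiv.prodAssoc.measurable.comp (hex.comp hht))]
  rfl

theorem isFirstJump_asyncShift {i : Fin (n + 1)} {ω : Fin (n + 1) → ℕ → ℝ}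
    (hω : ∀ j, IsProper (ω j)) (hi : (fun j => ω j 0) ∈ minSet i) :
    IsFirstJump (paths asyncPath ω) (paths asyncPath (asyncShift i ω).2)
      (asyncShift i ω).1.1 (asyncShift i ω).1.2 := by
  have hs : ((ω i 0).toNNReal : ℝ) = ω i 0 := Real.coe_toNNReal _ ((hω i).1 0).le
  refine ⟨fun j t ht => ?_, (Fin.forall_iff_succAbove i).2 ⟨fun t => ?_, fun j t => ?_⟩⟩
  · refine (hω j).asyncPath_of_lt ?_
    have h1 : (t : ℝ) < ω i 0 := by
      rw [← hs]
      exact NNReal.coe_lt_coe.2 ht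
    rcases eq_or_ne j i with rfl | hj
    · exact h1
    · exact h1.trans (mem_minSet.1 hi j hj)
  · simp only [paths, asyncShift, complete_self, Pi.single_eq_same]
    exact (hω i).asyncPath_jump hs t
  · simp only [paths, asyncShift, complete_succAbove, excess,
      Pi.single_eq_of_ne (Fin.succAbove_ne i j), zero_add]
    have h := (hω (i.succAbove j)).asyncPath_wait (s := (ω i 0).toNNReal)
      (by rw [hs]; exact hi j) t
    rw [hs] at h
    exact h

/-- Without atoms there are almost surely no ties, so the minimum is attained only once. -/
theorem ae_exists_mem_minSet {η : Measure ℝ} [IsProbabilityMeasure η] [NullSingletonClass η] :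
    ∀ᵐ h ∂(Measure.pi fun _ : Fin (n + 1) => η), ∃ i, h ∈ minSet i := by
  have hne : ∀ i j : Fin (n + 1), i ≠ j →
      ∀ᵐ h ∂(Measure.pi fun _ : Fin (n + 1) => η), h i ≠ h j := by
    intro i j hij
    have h1 := Measure.infinitePi_map_eval_prod (P := fun _ : Fin (n + 1) => η) hij
    rw [Measure.infinitePi_eq_pi] at h1
    have h2 : MeasurableSet {q : ℝ × ℝ | q.1 ≠ q.2} :=
      (measurableSet_eq_fun measurable_fst measurable_snd).compl
    have hm : Measurable fun h : Fin (n + 1) → ℝ => (h i, h j) := by fun_prop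
    have h3 : ∀ᵐ q ∂(η.prod η), q.1 ≠ q.2 := by
      refine (Measure.ae_prod_iff_ae_ae h2).2 (Filter.Eventually.of_forall fun x => ?_)
      rw [ae_iff]
      simp only [ne_eq, not_not]
      have h4 : {y : ℝ | x = y} = {x} := by
        ext y
        exact eq_comm
      rw [h4]
      exact measure_singleton x
    rw [← h1] at h3
    exact (ae_map_iff hm.aemeasurable h2).1 h3
  have hall : ∀ᵐ h ∂(Measure.pi fun _ : Fin (n + 1) => η), ∀ i j, i ≠ j → h i ≠ h j := by
    simp only [ae_all_iff]
    exact hne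
  filter_upwards [hall] with h hh
  obtain ⟨i, hi⟩ := Finite.exists_min h
  exact ⟨i, mem_minSet.2 fun j hj => lt_of_le_of_ne (hi j) (hh i j hj.symm)⟩

/-- The sample space is partitioned, up to a null set, by the token that is passed first; on each
part `asyncShift i` describes the restart. -/
theorem hasRenewal_asyncPath (n : ℕ) (hr : 0 < rate) [IsProbabilityMeasure (expMeasure rate)] :
    HasRenewal (n + 1) (seqLaw (expMeasure rate)) asyncPath := by
  have hproper : ∀ᵐ ω ∂(Measure.pi fun _ : Fin (n + 1) => seqLaw (expMeasure rate)),
      ∀ j, IsProper (ω j) := by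
    rw [ae_all_iff]
    intro j
    exact (measurePreserving_eval (fun _ : Fin (n + 1) => seqLaw (expMeasure rate))
      j).quasiMeasurePreserving.ae (ae_isProper hr)
  have hcover : ∀ᵐ ω ∂(Measure.pi fun _ : Fin (n + 1) => seqLaw (expMeasure rate)),
      ω ∈ ⋃ i, {ω | (fun j => ω j 0) ∈ minSet i} := by
    have := nullSingletonClass_expMeasure (rate := rate)
    have h := measurePreserving_pi (fun _ : Fin (n + 1) => seqLaw (expMeasure rate)) _
      fun _ => measurePreserving_eval_infinitePi (fun _ : ℕ => expMeasure rate) 0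
    filter_upwards [h.quasiMeasurePreserving.ae ae_exists_mem_minSet] with ω hω
    exact Set.mem_iUnion.2 hω
  have hhead : Measurable fun (ω : Fin (n + 1) → ℕ → ℝ) j => ω j 0 := by fun_prop
  obtain ⟨ρ, S, hρ, hS, hmap, heq⟩ := exists_map_eq_prod
    (fun i => hhead (measurableSet_minSet i)) (fun i k hik => Set.disjoint_left.2 fun ω h1 h2 =>
      (lt_asymm (mem_minSet.1 (show (fun j => ω j 0) ∈ minSet i from h1) k hik.symm)
        (mem_minSet.1 (show (fun j => ω j 0) ∈ minSet k from h2) i hik)).elim) hcover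
    measurable_asyncShift (map_asyncShift hr)
  refine ⟨ρ, S, hρ, hS, hmap, ?_, ?_⟩
  · filter_upwards [hproper, hcover] with ω h1 h2
    obtain ⟨i, hi⟩ := Set.mem_iUnion.1 h2
    rw [heq i hi]
    exact isFirstJump_asyncShift h1 hi
  · refine ae_of_map_eq_prod hS hmap ?_ ?_
    · have h : MeasurableSet {q : ℝ≥0 × (Fin (n + 1) → ℕ) | (0 : ℝ≥0) < q.1} :=
        measurableSet_lt measurable_const measurable_fst
      refine MeasurableSet.inter h ?_
      exact measurable_snd (MeasurableSet.of_discrete (s := {e : Fin (n + 1) → ℕ | ∀ i, e i ≤ 1}))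
    · filter_upwards [hproper, hcover] with ω h1 h2
      obtain ⟨i, hi⟩ := Set.mem_iUnion.1 h2
      rw [heq i hi]
      refine ⟨Real.toNNReal_pos.2 ((h1 i).1 0), fun j => ?_⟩
      simp only [asyncShift, Pi.single_apply]
      split_ifs <;> simp

theorem IsAsynchronousMovement.formula {N m : ℕ} (hN : 0 < N) {z : Fin (2 * m + 1) → ℕ}
    (hz : IsOrdered N z Finset.univ) {Ω : Type*} [MeasurableSpace Ω] {μ : Measure Ω}
    {d : Fin (2 * m + 1) → ℝ≥0 → Ω → ℕ} (hr : 0 < rate)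
    (hd : IsAsynchronousMovement μ rate d) (t : ℝ≥0) :
    μ.real {ω | stabTime N z (fun i s => d i s ω) ≤ t} =
      ∑ w ∈ pairings (2 * m + 1), pairingSign w *
        ∏ p ∈ w,
          (μ.real {ω | pairTime N z (fun i s => d i s ω) p.1 p.2 ≤ t ∧
              CollideDown N z (fun i s => d i s ω) p.1 p.2} -
            μ.real {ω | pairTime N z (fun i s => d i s ω) p.1 p.2 ≤ t ∧
              CollideUp N z (fun i s => d i s ω) p.1 p.2}) := by
  obtain ⟨ξ, hξ, hind, hlaw, hdξ⟩ := hd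
  have := isProbabilityMeasure_expMeasure hr
  have hY : Measurable fun ω i k => ξ i k ω := by fun_prop
  have hmap := map_eq_pi_seqLaw (expMeasure rate) hξ hind hlaw
  refine isTokenPath_asyncPath.formula_of_law (hasRenewal_asyncPath (2 * m) hr) hN hz hY hmap
    ?_ t
  have hproper : ∀ᵐ ω ∂(Measure.pi fun _ : Fin (2 * m + 1) => seqLaw (expMeasure rate)),
      ∀ j, IsProper (ω j) := by
    rw [ae_all_iff]
    intro j
    exact (measurePreserving_eval (fun _ : Fin (2 * m + 1) => seqLaw (expMeasure rate))
      j).quasiMeasurePreserving.ae (ae_isProper hr)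
  rw [← hmap] at hproper
  filter_upwards [ae_of_ae_map hY.aemeasurable hproper] with ω hω i t
  rw [hdξ, asyncPath_of_proper (hω i)]

end AsynchronousFormula

end Herman

theorem mainTheorem4 {N M : ℕ} (hN : Odd N) (hM : Odd M) (hM3 : 3 ≤ M)
    (z : Fin M → ℕ) (hz : StrictMono z) (hzN : ∀ i, 1 ≤ z i ∧ z i ≤ N)
    {Ω : Type*} [MeasurableSpace Ω] (μ : Measure Ω) [IsProbabilityMeasure μ]
    (d : Fin M → ℝ≥0 → Ω → ℕ)
    (hd : (∃ r : ℝ, 0 < r ∧ r < 1 ∧ Herman.IsSynchronousMovement μ r d) ∨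
      (∃ rate : ℝ, 0 < rate ∧ Herman.IsAsynchronousMovement μ rate d))
    (t : ℝ≥0) :
    μ.real {ω | Herman.stabTime N z (fun i s => d i s ω) ≤ t} =
      ∑ w ∈ Herman.pairings M, Herman.pairingSign w *
        ∏ p ∈ w,
          (μ.real {ω | Herman.pairTime N z (fun i s => d i s ω) p.1 p.2 ≤ t ∧
              Herman.CollideDown N z (fun i s => d i s ω) p.1 p.2} -
            μ.real {ω | Herman.pairTime N z (fun i s => d i s ω) p.1 p.2 ≤ t ∧
              Herman.CollideUp N z (fun i s => d i s ω) p.1 p.2}) := by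
  obtain ⟨m, rfl⟩ := hM
  -- Positions between `1` and `N` differ by less than a full turn.
  have hzo : Herman.IsOrdered N z Finset.univ := by
    intro i _ j _ hij
    have h1 := hz hij
    have h2 := hzN i
    have h3 := hzN j
    omega
  rcases hd with ⟨r, -, -, hd⟩ | ⟨rate, hr, hd⟩
  · exact hd.formula hN.pos hzo t
  · exact hd.formula hN.pos hzo hr t
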